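/- Let $k$ be a field, $V$ a finite-dimensional $k$-vector space, $V^{(m)}=V^{\otimes m}$ for $m\ge 0$ and $V^{(m)}=0$ for $m<0$. Let $2\le a<b$ be integers and let $R_a\subseteq V^{(a)}$, $R_b\subseteq V^{(b)}$ be subspaces satisfying the minimality condition $R_b\cap\sum_{j=0}^{b-a}V^{(j)}\otimes R_a\otimes V^{(b-a-j)}=0$. Let $I=\bigoplus_m I_m$ be the two-sided ideal of the tensor algebra $T(V)$ generated by $R_a\oplus R_b$ (with $I_m=I\cap V^{(m)}$), and let $A=T(V)/I$, graded by tensor degree. For $s\in\{a,b\}$ put $n_s(2l)=sl$, $n_s(2l+1)=sl+1$, and $\bar J^s_n=\bigcap_{j=0}^{n-s}V^{(j)}\otimes R_s\otimes V^{(n-s-j)}$ for $n\ge s$. For $i\ge 2$ let $\delta_i$ be the $A$-linear map $A\otimes(\bar J^a_{n_a(i)}\oplus\bar J^b_{n_b(i)})\to A\otimes J_{i-1}$, where $J_1=V$ and $J_{i-1}=\bar J^a_{n_a(i-1)}\oplus\bar J^b_{n_b(i-1)}$ for $i\ge 3$, given on the summand of index $s$ by the restriction of $$\alpha\otimes v_1\cdots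 v_{n_s(i)}\mapsto \begin{cases}\alpha v_1\cdots v_{s-1}\otimes v_s\cdots v_{n_s(i)} & (i \text{ even}),\\ \alpha v_1\otimes v_2\cdots v_{n_s(i)} & (i\text{ odd}).\end{cases}$$ Here $A\otimes \bar J^s_{n_s(i)}$ is graded by total tensor degree. A graded $A$-module $M$ is $2$-pure in degrees $l_1<l_2$ if there are subspaces $M_{l_1},M_{l_2}$ of $M$, concentrated in degrees $l_1$, $l_2$ respectively (possibly zero), such that $M=AM_{l_1}+AM_{l_2}$ and $M_{l_2}\cap AM_{l_1}=0$. For $j\ge 2$ say that $(P_j)$ holds if $\operatorname{Ker}(\delta_j)$ is $2$-pure in degrees $n_a(j+1)$ and $n_b(j+1)$ and there is an isomorphism of graded vector spaces $k\otimes_A\operatorname{Ker}(\delta_j)\simeq \bar J^a_{n_a(j+1)}\oplus\bar J^b_{n_b(j+1)}$. For $i\ge 3$, $n\in\mathbb N_0$ and $s,s'\in\{a,b\}$ define the subspaces of $V^{(n)}$ $$E^s=V^{(n-n_s(i))}\otimes\bar J^s_{n_s(i)},\qquad F^s=I_{n-n_s(i)}\otimes V^{(n_s(i))},\qquad G^s_{s'}=\sum_{j=n-n_s(i)-s'+1}^{n-n_s(i-1)-s'}V^{(j)}\otimes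 R_{s'}\otimes V^{(n-s'-j)},$$ and put $X^{a,m}_b=(V^{(m)}\otimes R_a)\cap\sum_{j=0}^{m+a-b-1}V^{(j)}\otimes R_b\otimes V^{(m+a-b-j)}$. A tuple $(E,F_1,\dots,F_t)$ of subspaces is distributive if $E\cap\sum_jF_j=\sum_j(E\cap F_j)$. **Proposition.** Let $i\ge 3$ and suppose that $(P_j)$ holds for all $j$ with $2\le j<i$. Then $(P_i)$ holds if and only if the tuples $(E^s,F^s,G^s_a,G^s_b)$ are distributive for each $s\in\{a,b\}$ and all $n\in\mathbb N_0$ (equivalently, in this criterion, just for all $n\ge n_s(i)$), and the following inclusions hold: if $i$ is even, for all $n\in\mathbb N_0$ with $n_a(i-1)+b\le n\le n_a(i)+b-1$, $$E^a\cap\big(X^{a,n-n_a(i)}_b\otimes V^{(n_a(i-2))}\big)\subseteq V^{(n-n_a(i+1))}\otimes\bar J^a_{n_a(i+1)}+I_{n-n_a(i)}\otimes\bar J^a_{n_a(i)};$$ if $i$ is odd, $$(V^{(b-1)}\otimes\bar J^a_{n_a(i)})\cap\Big(\big((V^{(b-1)}\otimes R_a)\cap(R_b\otimes V^{(a-1)})\big)\otimes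 V^{(n_a(i-2))}\Big)\subseteq V^{(b-a)}\otimes\bar J^a_{n_a(i+1)}+I_{b-1}\otimes\bar J^a_{n_a(i)}.$$ -/

import Mathlib

open scoped TensorProduct

noncomputable section

namespace MultiKoszul

/-! ### Graded modules over a graded algebra -/

section GradedModules

variable {k A : Type*} [Field k] [Ring A] [Algebra k A]
variable {M : Type*} [AddCommGroup M] [Module k M] [Module A M] [IsScalarTower k A M]

/-- The graded module `M = ⨁ₙ ℳ n` is `s`-pure in degrees `l 0 < ⋯ < l (s - 1)`: there are
subspaces `N i` of `M`, concentrated in degree `l i`, with `M = ∑ A • N i` and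
`N i ∩ ∑_{j < i} A • N j = 0`. (The subspaces `N i` may vanish.) -/
def IsPure (ℳ : ℤ → Submodule k M) {s : ℕ} (l : Fin s → ℤ) : Prop :=
  StrictMono l ∧ ∃ N : Fin s → Submodule k M,
    (∀ i, N i ≤ ℳ (l i)) ∧
    (⨆ i, Submodule.span A (N i : Set M)) = ⊤ ∧
    ∀ i, N i ⊓ (⨆ j, ⨆ _ : j < i, Submodule.span A (N j : Set M)).restrictScalars k = ⊥

variable (M) in
/-- The submodule `A_{>0} • M`, where `A = ⨁ₘ 𝒜 m`. -/
def irrelevantSMul (𝒜 : ℤ → Submodule k A) : Submodule A M :=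
  Submodule.span A {x | ∃ m : ℤ, 0 < m ∧ ∃ α ∈ 𝒜 m, ∃ y : M, x = α • y}

variable (M) in
/-- `k ⊗_A M`, realized as `M / (A_{>0} • M)` (here `k = A / A_{>0}`). -/
abbrev Coinv (𝒜 : ℤ → Submodule k A) : Type _ := M ⧸ irrelevantSMul M 𝒜

/-- The grading of `k ⊗_A M` induced by the one of `M`. -/
def coinvGrading (𝒜 : ℤ → Submodule k A) (ℳ : ℤ → Submodule k M) (n : ℤ) :
    Submodule k (Coinv M 𝒜) :=
  (ℳ n).map ((irrelevantSMul M 𝒜).mkQ.restrictScalars k)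

/-- A sequence `(E, F₁, …, F_t)` of subspaces is distributive if
`E ∩ ∑ F_j = ∑ (E ∩ F_j)`. -/
def IsDistributive {W : Type*} [AddCommGroup W] [Module k W] (E : Submodule k W) {t : ℕ}
    (F : Fin t → Submodule k W) : Prop :=
  E ⊓ (⨆ j, F j) = ⨆ j, E ⊓ F j

end GradedModules

/-! ### Subspaces of the tensor algebra

A subspace of `V^{⊗p}` is regarded as a subspace of `T(V)`. For subspaces `W ⊆ V^{⊗p}` and
`W' ⊆ V^{⊗q}`, the subspace `W ⊗ W'` of `V^{⊗(p+q)}` is then the product `W * W'` in `T(V)`. -/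

section TensorSubspaces

variable {k V : Type*} [Field k] [AddCommGroup V] [Module k V]

variable (k V) in
/-- The subspace `V^{(n)} = V^{⊗n}` of `T(V)`, which is zero for `n < 0`. -/
def TP (n : ℤ) : Submodule k (TensorAlgebra k V) :=
  if 0 ≤ n then (LinearMap.range (TensorAlgebra.ι k : V →ₗ[k] TensorAlgebra k V)) ^ n.toNat else ⊥

/-- `n_s(2l) = s l` and `n_s(2l + 1) = s l + 1`. -/
def nfun (s t : ℕ) : ℕ := s * (t / 2) + t % 2

/-- `∑_{j = lo}^{hi} V^{(j)} ⊗ R ⊗ V^{(n - s - j)}`, for a subspace `R` of `V^{(s)}`. -/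
def relSum (s : ℕ) (R : Submodule k (TensorAlgebra k V)) (n lo hi : ℤ) :
    Submodule k (TensorAlgebra k V) :=
  ⨆ j ∈ Finset.Icc lo hi, TP k V j * R * TP k V (n - s - j)

/-- `J̄ₙ = ⋂_{j = 0}^{n - s} V^{(j)} ⊗ R ⊗ V^{(n - s - j)}`, for a subspace `R` of `V^{(s)}`
and `n ≥ s`. -/
def Jbar (s : ℕ) (R : Submodule k (TensorAlgebra k V)) (n : ℤ) :
    Submodule k (TensorAlgebra k V) :=
  ⨅ j ∈ Finset.Icc (0 : ℤ) (n - s), TP k V j * R * TP k V (n - s - j)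

/-- `J_i^s = J̄_{n_s(i)}`, for `i ≥ 2`. -/
abbrev J (s : ℕ) (R : Submodule k (TensorAlgebra k V)) (i : ℕ) :
    Submodule k (TensorAlgebra k V) :=
  Jbar s R (nfun s i)

/-! ### The algebra `A = T(V) / ⟨R_a ⊕ R_b⟩` -/

variable (Ra Rb : Submodule k (TensorAlgebra k V))

/-- The two-sided ideal `I` of `T(V)` generated by `R_a ⊕ R_b`. -/
def relIdeal : Ideal (TensorAlgebra k V) :=
  (TwoSidedIdeal.span ((Ra : Set (TensorAlgebra k V)) ∪ (Rb : Set (TensorAlgebra k V)))).asIdeal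

instance : (relIdeal Ra Rb).IsTwoSided := by
  unfold relIdeal
  infer_instance

/-- The homogeneous component `I_m = I ∩ V^{(m)}` of the ideal of relations. -/
def relIdealPiece (m : ℤ) : Submodule k (TensorAlgebra k V) :=
  (relIdeal Ra Rb).restrictScalars k ⊓ TP k V m

/-- The algebra `A = T(V) / I`. -/
abbrev Alg : Type _ := TensorAlgebra k V ⧸ relIdeal Ra Rb

/-- The canonical projection `T(V) → A`. -/
def proj : TensorAlgebra k V →ₐ[k] Alg Ra Rb := Ideal.Quotient.mkₐ k (relIdeal Ra Rb)

/-- The homogeneous component `A_m`, which is zero for `m < 0`. -/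
def algGrading (m : ℤ) : Submodule k (Alg Ra Rb) :=
  (TP k V m).map (proj Ra Rb).toLinearMap

/-! ### The differentials -/

variable (k V) in
/-- The action of a vector `v` on `T(V) × (T(V) ⊗ T(V))` by `(x, z) ↦ (v x, v ⊗ x)`. -/
def peelAux : V →ₗ[k] Module.End k
    (TensorAlgebra k V × (TensorAlgebra k V ⊗[k] TensorAlgebra k V)) where
  toFun v := LinearMap.prod
    (LinearMap.mulLeft k (TensorAlgebra.ι k v) ∘ₗ LinearMap.fst k _ _)
    (TensorProduct.mk k _ _ (TensorAlgebra.ι k v) ∘ₗ LinearMap.fst k _ _)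
  map_add' v w := by
    refine LinearMap.ext fun x => Prod.ext ?_ ?_ <;> simp [add_mul]
  map_smul' c v := by
    refine LinearMap.ext fun x => Prod.ext ?_ ?_ <;> simp [TensorProduct.smul_tmul']

variable (k V) in
/-- Splitting off the first letter: `v₁ ⋯ vₙ ↦ v₁ ⊗ v₂ ⋯ vₙ` for `n ≥ 1`, and `1 ↦ 0`. -/
def peelOne : TensorAlgebra k V →ₗ[k] TensorAlgebra k V ⊗[k] TensorAlgebra k V :=
  LinearMap.snd k _ _ ∘ₗ LinearMap.applyₗ (1, 0) ∘ₗ (TensorAlgebra.lift k (peelAux k V)).toLinearMap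

variable (k V) in
/-- Splitting off the first `p` letters: `v₁ ⋯ vₙ ↦ v₁ ⋯ v_p ⊗ v_{p+1} ⋯ vₙ` for `n ≥ p`
(and `0` for `n < p`). -/
def peel : ℕ → (TensorAlgebra k V →ₗ[k] TensorAlgebra k V ⊗[k] TensorAlgebra k V)
  | 0 => TensorProduct.mk k _ _ 1
  | p + 1 =>
    (LinearMap.mul' k (TensorAlgebra k V)).rTensor (TensorAlgebra k V) ∘ₗ
      (TensorProduct.assoc k _ _ _).symm.toLinearMap ∘ₗ
      (peelOne k V).lTensor (TensorAlgebra k V) ∘ₗ peel p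

lemma peelAux_apply (v : V) (y : TensorAlgebra k V × (TensorAlgebra k V ⊗[k] TensorAlgebra k V)) :
    peelAux k V v y = (TensorAlgebra.ι k v * y.1, TensorAlgebra.ι k v ⊗ₜ[k] y.1) := rfl

lemma peelOne_mul (v : V) (x : TensorAlgebra k V) :
    peelOne k V (TensorAlgebra.ι k v * x) = TensorAlgebra.ι k v ⊗ₜ[k] x := by
  have key : ∀ x : TensorAlgebra k V,
      ∀ y, ((TensorAlgebra.lift k (peelAux k V) x) y).1 = x * y.1 := by
    intro x
    induction x using TensorAlgebra.induction with
    | algebraMap r => intro y; simp [Algebra.smul_def]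
    | ι v => intro y; simp [peelAux_apply]
    | mul x y hx hy => intro z; simp [hx, hy, mul_assoc]
    | add x y hx hy => intro z; simp [hx, hy, add_mul]
  have h := key x (1, 0)
  simp only [mul_one] at h
  simp [peelOne, peelAux_apply, h]

/-- `peel` is indeed given by the formula in its description. -/
lemma peel_mul (p : ℕ) (w x : TensorAlgebra k V) (hw : w ∈ TP k V p) :
    peel k V p (w * x) = w ⊗ₜ[k] x := by
  have hw' : w ∈ (LinearMap.range (TensorAlgebra.ι k : V →ₗ[k] TensorAlgebra k V)) ^ p := by
    simpa [TP] using hw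
  clear hw
  induction p generalizing w x with
  | zero =>
    rw [pow_zero, Submodule.mem_one] at hw'
    obtain ⟨r, rfl⟩ := hw'
    simp [peel, Algebra.algebraMap_eq_smul_one, TensorProduct.smul_tmul]
  | succ p ih =>
    rw [pow_succ] at hw'
    refine Submodule.mul_induction_on hw' ?_ ?_
    · rintro m hm _ ⟨v, rfl⟩
      simp [peel, mul_assoc, ih m _ hm, peelOne_mul]
    · intro y z hy hz
      rw [add_mul, map_add, hy, hz, TensorProduct.add_tmul]

/-- The number of letters moved by `δ_i` on the summand of index `s`: `s - 1` if `i` is even,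
and `1` if `i` is odd. -/
def jump (s i : ℕ) : ℕ := if Even i then s - 1 else 1

variable (a b : ℕ)

/-- `J_i = J_i^a ⊕ J_i^b`, for `i ≥ 2`. -/
abbrev JJ (i : ℕ) : Type _ := (J a Ra i) × (J b Rb i)

/-- The grading of `J_i = J_i^a ⊕ J_i^b` inherited from `T(V)`. -/
def JJGrading (i : ℕ) (n : ℤ) : Submodule k (JJ Ra Rb a b i) :=
  ((TP k V n).comap (J a Ra i).subtype).prod ((TP k V n).comap (J b Rb i).subtype)

/-- The module `A ⊗ J_i`, for `i ≥ 2`. -/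
abbrev KMod (i : ℕ) : Type _ := Alg Ra Rb ⊗[k] JJ Ra Rb a b i

/-- The grading of `A ⊗ J_i`: the component of degree `n` is
`A_{n - n_a(i)} ⊗ J_i^a ⊕ A_{n - n_b(i)} ⊗ J_i^b`. -/
def KGrading (i : ℕ) (n : ℤ) : Submodule k (KMod Ra Rb a b i) :=
  Submodule.map₂ (TensorProduct.mk k _ _) (algGrading Ra Rb (n - nfun a i))
      (LinearMap.range (LinearMap.inl k (J a Ra i) (J b Rb i))) ⊔
    Submodule.map₂ (TensorProduct.mk k _ _) (algGrading Ra Rb (n - nfun b i))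
      (LinearMap.range (LinearMap.inr k (J a Ra i) (J b Rb i)))

/-- The differential `δ_i` on `A ⊗ J_i = A ⊗ (J_i^a ⊕ J_i^b)`, for `i ≥ 2`. It is the `A`-linear
map sending `α ⊗ v₁ ⋯ vₙ`, with `v₁ ⋯ vₙ` in the summand of index `s ∈ {a, b}` (so `n = n_s(i)`),
to `α v₁ ⋯ v_{s-1} ⊗ v_s ⋯ vₙ` if `i` is even and to `α v₁ ⊗ v₂ ⋯ vₙ` if `i` is odd.
It takes values in `A ⊗ J_{i-1}`, where `J_{i-1} ⊆ T(V)` is `V` for `i = 2`, and the (direct) sum of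
`J_{i-1}^a ⊆ V^{(n_a(i-1))}` and `J_{i-1}^b ⊆ V^{(n_b(i-1))}` for `i ≥ 3`; as `A ⊗ J_{i-1}` is a
submodule of `A ⊗ T(V)`, the latter is taken as the codomain, which does not affect the kernel. -/
def delta (i : ℕ) : KMod Ra Rb a b i →ₗ[Alg Ra Rb] Alg Ra Rb ⊗[k] TensorAlgebra k V :=
  TensorProduct.AlgebraTensorModule.lift
    (LinearMap.toSpanSingleton (Alg Ra Rb)
      (JJ Ra Rb a b i →ₗ[k] Alg Ra Rb ⊗[k] TensorAlgebra k V)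
      ((proj Ra Rb).toLinearMap.rTensor (TensorAlgebra k V) ∘ₗ
        LinearMap.coprod (peel k V (jump a i) ∘ₗ (J a Ra i).subtype)
          (peel k V (jump b i) ∘ₗ (J b Rb i).subtype)))

/-- The graded `A`-module `Ker(δ_i)`. -/
abbrev Ker (i : ℕ) : Submodule (Alg Ra Rb) (KMod Ra Rb a b i) :=
  LinearMap.ker (delta Ra Rb a b i)

/-- The grading of `Ker(δ_i)`. -/
def kerGrading (i : ℕ) (n : ℤ) : Submodule k (Ker Ra Rb a b i) :=
  (KGrading Ra Rb a b i n).comap ((Ker Ra Rb a b i).subtype.restrictScalars k)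

/-- `Ker(δ_i)` is `2`-pure in degrees `n_a(i+1)` and `n_b(i+1)`, and
`k ⊗_A Ker(δ_i) ≃ J_{i+1}^a ⊕ J_{i+1}^b` as graded vector spaces. -/
def HasExpectedPurity (i : ℕ) : Prop :=
  IsPure (A := Alg Ra Rb) (M := Ker Ra Rb a b i) (kerGrading Ra Rb a b i)
      ![(nfun a (i + 1) : ℤ), (nfun b (i + 1) : ℤ)] ∧
    ∃ e : Coinv (Ker Ra Rb a b i) (algGrading Ra Rb) ≃ₗ[k] JJ Ra Rb a b (i + 1),
      ∀ n : ℤ, (coinvGrading (algGrading Ra Rb) (kerGrading Ra Rb a b i) n).map e.toLinearMap =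
        JJGrading Ra Rb a b (i + 1) n

/-! ### The subspaces `E^s`, `F^s`, `G^s_{s'}` and `X^{s,m}_{s'}` -/

/-- `E^s = V^{(n - n_s(i))} ⊗ J̄_{n_s(i)}`, where `R = R_s`. -/
def ESub (s : ℕ) (R : Submodule k (TensorAlgebra k V)) (i : ℕ) (n : ℤ) :
    Submodule k (TensorAlgebra k V) :=
  TP k V (n - nfun s i) * Jbar s R (nfun s i)

/-- `F^s = I_{n - n_s(i)} ⊗ V^{(n_s(i))}`. -/
def FSub (s i : ℕ) (n : ℤ) : Submodule k (TensorAlgebra k V) :=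
  relIdealPiece Ra Rb (n - nfun s i) * TP k V (nfun s i)

/-- `G^s_{s'} = ∑_{j = n - n_s(i) - s' + 1}^{n - n_s(i-1) - s'} V^{(j)} ⊗ R_{s'} ⊗ V^{(n - s' - j)}`,
where `R' = R_{s'}`. -/
def GSub (s s' : ℕ) (R' : Submodule k (TensorAlgebra k V)) (i : ℕ) (n : ℤ) :
    Submodule k (TensorAlgebra k V) :=
  relSum s' R' n (n - nfun s i - s' + 1) (n - nfun s (i - 1) - s')

/-- `X^{s,m}_{s'} = (V^{(m)} ⊗ R_s) ∩
∑_{j = 0}^{m + s - s' - 1} V^{(j)} ⊗ R_{s'} ⊗ V^{(m + s - s' - j)}`, where `R = R_s`,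
`R' = R_{s'}`. -/
def XSub (s s' : ℕ) (R R' : Submodule k (TensorAlgebra k V)) (m : ℤ) :
    Submodule k (TensorAlgebra k V) :=
  (TP k V m * R) ⊓ relSum s' R' (m + s) 0 (m + s - s' - 1)

/-- The tuple `(E^a, F^a, G^a_a, G^a_b)` is distributive (in degree `n`). -/
def TupleADistributive (i : ℕ) (n : ℤ) : Prop :=
  IsDistributive (ESub a Ra i n) ![FSub Ra Rb a i n, GSub a a Ra i n, GSub a b Rb i n]

/-- The tuple `(E^b, F^b, G^b_a, G^b_b)` is distributive (in degree `n`). -/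
def TupleBDistributive (i : ℕ) (n : ℤ) : Prop :=
  IsDistributive (ESub b Rb i n) ![FSub Ra Rb b i n, GSub b a Ra i n, GSub b b Rb i n]

/-- For `i` even: `E^a ∩ (X^{a,n-n_a(i)}_b ⊗ V^{(n_a(i-2))}) ⊆
V^{(n-n_a(i+1))} ⊗ J̄_{n_a(i+1)} + I_{n-n_a(i)} ⊗ J̄_{n_a(i)}`,
for all `n` with `n_a(i-1) + b ≤ n ≤ n_a(i) + b - 1`. -/
def EvenInclusions (i : ℕ) : Prop :=
  ∀ n : ℤ, (nfun a (i - 1) : ℤ) + b ≤ n → n ≤ (nfun a i : ℤ) + b - 1 →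
    ESub a Ra i n ⊓ (XSub a b Ra Rb (n - nfun a i) * TP k V (nfun a (i - 2))) ≤
      TP k V (n - nfun a (i + 1)) * Jbar a Ra (nfun a (i + 1)) ⊔
        relIdealPiece Ra Rb (n - nfun a i) * Jbar a Ra (nfun a i)

/-- For `i` odd: `(V^{(b-1)} ⊗ J̄_{n_a(i)}) ∩
(((V^{(b-1)} ⊗ R_a) ∩ (R_b ⊗ V^{(a-1)})) ⊗ V^{(n_a(i-2))}) ⊆
V^{(b-a)} ⊗ J̄_{n_a(i+1)} + I_{b-1} ⊗ J̄_{n_a(i)}`. -/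
def OddInclusion (i : ℕ) : Prop :=
  (TP k V ((b : ℤ) - 1) * Jbar a Ra (nfun a i)) ⊓
      (((TP k V ((b : ℤ) - 1) * Ra) ⊓ (Rb * TP k V ((a : ℤ) - 1))) * TP k V (nfun a (i - 2))) ≤
    TP k V ((b : ℤ) - a) * Jbar a Ra (nfun a (i + 1)) ⊔
      relIdealPiece Ra Rb ((b : ℤ) - 1) * Jbar a Ra (nfun a i)

end TensorSubspaces

end MultiKoszul

end

open scoped TensorProduct

noncomputable section
namespace MultiKoszul
variable {k V : Type*} [Field k] [AddCommGroup V] [Module k V]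

/-! Write `i = j + 2`, `q = n_s(i-2)`, `d = n_s(i+1) - n_s(i)`, so that `n_s(i) = s + q` and
`n_s(i-1) = q + d`. The proof turns `(P_i)` into a statement about subspaces of `T(V)` and then
decides which of the resulting inclusions are automatic.

Module side. `J_{i+1}` always embeds in `Ker δ_i`, its `b`-part meets the submodule generated by its
`a`-part trivially, and both parts sit in the right degrees. By a dimension count, for which `V` has
to be finite-dimensional, `(P_i)` therefore holds exactly when `J_{i+1}` generates `Ker δ_i`
(`hasExpectedPurity_iff`). Elements of `A ⊗ J_i` are represented by tensors, on which `δ_i` merely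
moves the bar between coefficient and generator. For `i ≥ 3` the summands `a` and `b` have targets
of different degrees, so they separate, and `(P_i)` becomes, for each `s` and `p`, the inclusion `E
∩ (I_{p+s-d} ⊗ V^{(q+d)}) ⊆ I_p ⊗ J̄_{n_s(i)} + V^{(p-d)} ⊗ J̄_{n_s(i+1)}` with `E = V^{(p)} ⊗
J̄_{n_s(i)}` (`kernelGenerated_iff_exactAt`).

Tensor side. The second space on the left is `F + G_a + G_b`: a relation placed in a word either
lies within the first `p` letters or ends after them. As `E ∩ F = I_p ⊗ J̄_{n_s(i)}`, the inclusion
amounts to distributivity of `(E, F, G_a, G_b)` together with bounds on `E ∩ G_a` and `E ∩ G_b`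
(`RelationData.exact_iff`). Exactness at `A ⊗ J_2`, which is `(P_2)`, settles three of the four
bounds. It yields a strong form of the extra condition known from `N`-Koszul algebras: a relation at
the last place that is a combination of relations at earlier places is a relation at the last but
one place (`pow_succ_mul_inf_placements_le`). This bounds `E^s ∩ G^s_s`. It also gives `E^b ∩ G^b_a
= 0`, by propagating the minimality condition (`RelationData.pow_mul_inf_relPart_eq_bot`). What
remains is `E^a ∩ G^a_b`. Dropping first letters reduces it to `p < b`, and the range of summation
turns it into the stated inclusions for even and odd `i`. -/

variable (k V) in
/-- The subspace of letters of `T(V)`. -/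
abbrev letters : Submodule k (TensorAlgebra k V) :=
  LinearMap.range (TensorAlgebra.ι k : V →ₗ[k] TensorAlgebra k V)

local notation "𝕋" => TensorAlgebra k V
local notation "𝕃" => letters k V

/-! ### Splitting off the last letters -/

variable (k V) in
/-- The action of a vector `v` on `k × (T(V) ⊗ T(V))` by `(c, z) ↦ (0, v z + c (1 ⊗ v))`. -/
def rsplitAux : V →ₗ[k] Module.End k (k × (𝕋 ⊗[k] 𝕋)) where
  toFun v := LinearMap.prod 0
    ((LinearMap.mulLeft k (TensorAlgebra.ι k v)).rTensor 𝕋 ∘ₗ LinearMap.snd k _ _ +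
      (LinearMap.fst k _ _).smulRight ((1 : 𝕋) ⊗ₜ[k] TensorAlgebra.ι k v))
  map_add' v w := by
    refine LinearMap.ext fun x => Prod.ext (by simp) ?_
    have h : LinearMap.mulLeft k (TensorAlgebra.ι k v + TensorAlgebra.ι k w) =
        LinearMap.mulLeft k (TensorAlgebra.ι k v) + LinearMap.mulLeft k (TensorAlgebra.ι k w) :=
      LinearMap.ext fun x => by simp [add_mul]
    simp [h, LinearMap.rTensor_add, TensorProduct.tmul_add]
    abel
  map_smul' c v := by
    refine LinearMap.ext fun x => Prod.ext (by simp) ?_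
    have h : LinearMap.mulLeft k (c • TensorAlgebra.ι k v) =
        c • LinearMap.mulLeft k (TensorAlgebra.ι k v) :=
      LinearMap.ext fun x => by simp
    simp [h, LinearMap.rTensor_smul, smul_comm c]

lemma rsplitAux_apply (v : V) (y : k × (𝕋 ⊗[k] 𝕋)) :
    rsplitAux k V v y = (0, (LinearMap.mulLeft k (TensorAlgebra.ι k v)).rTensor 𝕋 y.2 +
      y.1 • ((1 : 𝕋) ⊗ₜ[k] TensorAlgebra.ι k v)) := rfl

variable (k V) in
/-- Splitting off the last letter: `v₁ ⋯ vₙ ↦ v₁ ⋯ vₙ₋₁ ⊗ vₙ`. -/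
def rsplitOne : 𝕋 →ₗ[k] 𝕋 ⊗[k] 𝕋 :=
  LinearMap.snd k _ _ ∘ₗ LinearMap.applyₗ (1, 0) ∘ₗ
    (TensorAlgebra.lift k (rsplitAux k V)).toLinearMap

lemma rsplitOne_mul (x : 𝕋) (v : V) :
    rsplitOne k V (x * TensorAlgebra.ι k v) = x ⊗ₜ[k] TensorAlgebra.ι k v := by
  have key : ∀ x : 𝕋, ∀ z, TensorAlgebra.lift k (rsplitAux k V) x (0, z) =
      (0, (LinearMap.mulLeft k x).rTensor 𝕋 z) := by
    intro x
    induction x using TensorAlgebra.induction with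
    | algebraMap r =>
      intro z
      have h : LinearMap.mulLeft k (algebraMap k 𝕋 r) = r • LinearMap.id :=
        LinearMap.ext fun x => by simp [Algebra.smul_def]
      simp [h, LinearMap.rTensor_smul]
    | ι v => intro z; simp [rsplitAux_apply]
    | mul x y hx hy =>
      intro z
      rw [map_mul, Module.End.mul_apply, hy, hx, LinearMap.mulLeft_mul, LinearMap.rTensor_comp]
      rfl
    | add x y hx hy =>
      intro z
      have h : LinearMap.mulLeft k (x + y) = LinearMap.mulLeft k x + LinearMap.mulLeft k y :=
        LinearMap.ext fun x => by simp [add_mul]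
      rw [map_add, LinearMap.add_apply, hx, hy, h, LinearMap.rTensor_add]
      simp
  have h0 : rsplitAux k V v (1, 0) = (0, (1 : 𝕋) ⊗ₜ[k] TensorAlgebra.ι k v) := by
    simp [rsplitAux_apply]
  simp [rsplitOne, h0, key]

variable (k V) in
/-- Splitting off the last `p` letters. -/
def rsplit : ℕ → (𝕋 →ₗ[k] 𝕋 ⊗[k] 𝕋)
  | 0 => (TensorProduct.mk k _ _).flip 1
  | p + 1 =>
    (LinearMap.mul' k 𝕋).lTensor 𝕋 ∘ₗ (TensorProduct.assoc k _ _ _).toLinearMap ∘ₗ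
      (rsplitOne k V).rTensor 𝕋 ∘ₗ rsplit p

lemma rsplit_mul (p : ℕ) (x w : 𝕋) (hw : w ∈ 𝕃 ^ p) : rsplit k V p (x * w) = x ⊗ₜ[k] w := by
  induction p generalizing w x with
  | zero =>
    rw [pow_zero, Submodule.mem_one] at hw
    obtain ⟨r, rfl⟩ := hw
    simp [rsplit, Algebra.algebraMap_eq_smul_one]
  | succ p ih =>
    rw [pow_succ'] at hw
    refine Submodule.mul_induction_on hw ?_ ?_
    · rintro _ ⟨v, rfl⟩ m hm
      simp [rsplit, ← mul_assoc, ih _ m hm, rsplitOne_mul]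
    · intro y z hy hz
      rw [mul_add, map_add, hy, hz, TensorProduct.tmul_add]

lemma TP_natCast (n : ℕ) : TP k V (n : ℤ) = 𝕃 ^ n := by simp [TP]

lemma TP_of_neg {n : ℤ} (hn : n < 0) : TP k V n = ⊥ := by simp [TP, hn]

lemma peel_mul' (p : ℕ) (w x : 𝕋) (hw : w ∈ 𝕃 ^ p) : peel k V p (w * x) = w ⊗ₜ[k] x :=
  peel_mul p w x (by rwa [TP_natCast])

/-! ### Products of subspaces and the lattice operations -/

/-- Subtract from the identity a linear lift to `X` of the class modulo `Y`. Tensor products of such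
maps are the tool for computing intersections of products. -/
lemma exists_linearMap_fix_and_map_inf {E : Type*} [AddCommGroup E] [Module k E]
    (X Y : Submodule k E) :
    ∃ f : E →ₗ[k] E, (∀ y ∈ Y, f y = y) ∧ ∀ x ∈ X, f x ∈ X ⊓ Y := by
  set h : X →ₗ[k] E ⧸ Y := Y.mkQ ∘ₗ X.subtype
  obtain ⟨s, hs⟩ := LinearMap.exists_rightInverse_of_surjective h.rangeRestrict
    h.range_rangeRestrict
  obtain ⟨g, hg⟩ := LinearMap.exists_extend s
  refine ⟨LinearMap.id - X.subtype ∘ₗ g ∘ₗ Y.mkQ, fun y hy => ?_, fun x hx => ⟨?_, ?_⟩⟩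
  · simp [(Submodule.Quotient.mk_eq_zero Y).2 hy]
  · exact X.sub_mem hx (Submodule.coe_mem _)
  · have h1 : g (Y.mkQ x) = s (h.rangeRestrict ⟨x, hx⟩) := by
      rw [← hg]; rfl
    have h2 : h (s (h.rangeRestrict ⟨x, hx⟩)) = h ⟨x, hx⟩ := by
      have := LinearMap.congr_fun hs (h.rangeRestrict ⟨x, hx⟩)
      exact congrArg Subtype.val this
    have : Y.mkQ (x - (g (Y.mkQ x) : E)) = 0 := by
      rw [map_sub, h1, sub_eq_zero]
      exact h2.symm
    simpa using (Submodule.Quotient.mk_eq_zero Y).1 this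

/-- Apply `f` to the first `p` letters and `g` to the remaining ones. -/
def leftMap (p : ℕ) (f g : 𝕋 →ₗ[k] 𝕋) : 𝕋 →ₗ[k] 𝕋 :=
  LinearMap.mul' k 𝕋 ∘ₗ TensorProduct.map f g ∘ₗ peel k V p

lemma leftMap_mul {p : ℕ} (f g : 𝕋 →ₗ[k] 𝕋) {w : 𝕋} (hw : w ∈ 𝕃 ^ p) (x : 𝕋) :
    leftMap p f g (w * x) = f w * g x := by
  simp [leftMap, peel_mul' p w x hw]

/-- Apply `g` to the last `p` letters and `f` to the remaining ones. -/
def rightMap (p : ℕ) (f g : 𝕋 →ₗ[k] 𝕋) : 𝕋 →ₗ[k] 𝕋 :=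
  LinearMap.mul' k 𝕋 ∘ₗ TensorProduct.map f g ∘ₗ rsplit k V p

lemma rightMap_mul {p : ℕ} (f g : 𝕋 →ₗ[k] 𝕋) (x : 𝕋) {w : 𝕋} (hw : w ∈ 𝕃 ^ p) :
    rightMap p f g (x * w) = f x * g w := by
  simp [rightMap, rsplit_mul p x w hw]

lemma map_mem_of_mul {E : Type*} [AddCommGroup E] [Module k E] {X W : Submodule k 𝕋}
    {Z : Submodule k E} (φ : 𝕋 →ₗ[k] E)
    (h : ∀ x ∈ X, ∀ w ∈ W, φ (x * w) ∈ Z) {z : 𝕋} (hz : z ∈ X * W) : φ z ∈ Z := by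
  have : X * W ≤ Z.comap φ := Submodule.mul_le.2 h
  exact this hz

lemma map_eq_of_mul {E : Type*} [AddCommGroup E] [Module k E] {X W : Submodule k 𝕋}
    (φ ψ : 𝕋 →ₗ[k] E) (h : ∀ x ∈ X, ∀ w ∈ W, φ (x * w) = ψ (x * w)) {z : 𝕋} (hz : z ∈ X * W) :
    φ z = ψ z := by
  have : X * W ≤ LinearMap.eqLocus φ ψ := Submodule.mul_le.2 h
  exact this hz

/-- The map `f ⊗ g` fixes `Y * W'`, hence the given element, and sends `X * W` into the product of
the intersections. It is well defined on tensors because the right factors have a common degree, so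
the place where to cut is known. -/
lemma mul_inf_mul_of_right_le {r : ℕ} {X Y W W' : Submodule k 𝕋} (hW : W ≤ 𝕃 ^ r)
    (hW' : W' ≤ 𝕃 ^ r) : X * W ⊓ Y * W' = (X ⊓ Y) * (W ⊓ W') := by
  refine le_antisymm ?_ (le_inf (mul_le_mul' inf_le_left inf_le_left)
    (mul_le_mul' inf_le_right inf_le_right))
  rintro z ⟨h1, h2⟩
  obtain ⟨f, hf, hf'⟩ := exists_linearMap_fix_and_map_inf X Y
  obtain ⟨g, hg, hg'⟩ := exists_linearMap_fix_and_map_inf W W'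
  have e : rightMap r f g z = z := map_eq_of_mul (rightMap r f g) LinearMap.id
    (fun x hx w hw => by simp [rightMap_mul f g x (hW' hw), hf x hx, hg w hw]) h2
  rw [← e]
  refine map_mem_of_mul _ (fun x hx w hw => ?_) h1
  rw [rightMap_mul f g x (hW hw)]
  exact Submodule.mul_mem_mul (hf' x hx) (hg' w hw)

lemma mul_inf_mul_of_left_le {p : ℕ} {X Y W W' : Submodule k 𝕋} (hX : X ≤ 𝕃 ^ p)
    (hY : Y ≤ 𝕃 ^ p) : X * W ⊓ Y * W' = (X ⊓ Y) * (W ⊓ W') := by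
  refine le_antisymm ?_ (le_inf (mul_le_mul' inf_le_left inf_le_left)
    (mul_le_mul' inf_le_right inf_le_right))
  rintro z ⟨h1, h2⟩
  obtain ⟨f, hf, hf'⟩ := exists_linearMap_fix_and_map_inf X Y
  obtain ⟨g, hg, hg'⟩ := exists_linearMap_fix_and_map_inf W W'
  have e : leftMap p f g z = z := map_eq_of_mul (leftMap p f g) LinearMap.id
    (fun x hx w hw => by simp [leftMap_mul f g (hY hx) w, hf x hx, hg w hw]) h2
  rw [← e]
  refine map_mem_of_mul _ (fun x hx w hw => ?_) h1
  rw [leftMap_mul f g (hX hx) w]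
  exact Submodule.mul_mem_mul (hf' x hx) (hg' w hw)

/-! ### Homogeneous subspaces of the tensor algebra -/

variable (k V) in
/-- The projection of `T(V)` onto its component of degree `n`. -/
def homProj (n : ℕ) : 𝕋 →ₗ[k] 𝕋 :=
  GradedAlgebra.proj (fun n : ℕ => 𝕃 ^ n) n

lemma homProj_of_mem {n : ℕ} {x : 𝕋} (hx : x ∈ 𝕃 ^ n) : homProj k V n x = x :=
  DirectSum.decompose_of_mem_same (fun n : ℕ => 𝕃 ^ n) hx

lemma homProj_of_mem_ne {m n : ℕ} {x : 𝕋} (hx : x ∈ 𝕃 ^ m) (h : m ≠ n) : homProj k V n x = 0 :=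
  DirectSum.decompose_of_mem_ne (fun n : ℕ => 𝕃 ^ n) hx h

lemma homProj_mem {X : ℕ → Submodule k 𝕋} (hX : ∀ n, X n ≤ 𝕃 ^ n) (n : ℕ) {x : 𝕋}
    (hx : x ∈ ⨆ n, X n) : homProj k V n x ∈ X n := by
  have : (⨆ n, X n) ≤ (X n).comap (homProj k V n) := by
    refine iSup_le fun m x hx => ?_
    rw [Submodule.mem_comap]
    obtain rfl | h := eq_or_ne m n
    · rwa [homProj_of_mem (hX _ hx)]
    · rw [homProj_of_mem_ne (hX _ hx) h]
      exact zero_mem _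
  exact this hx

lemma mem_of_mem_iSup {X : ℕ → Submodule k 𝕋} (hX : ∀ n, X n ≤ 𝕃 ^ n) {n : ℕ} {x : 𝕋}
    (hx : x ∈ ⨆ n, X n) (hn : x ∈ 𝕃 ^ n) : x ∈ X n := by
  have := homProj_mem hX n hx
  rwa [homProj_of_mem hn] at this

lemma mem_of_homProj_mem {X : Submodule k 𝕋} {x : 𝕋} (h : ∀ n, homProj k V n x ∈ X) : x ∈ X := by
  classical
  rw [← DirectSum.sum_support_decompose (fun n : ℕ => 𝕃 ^ n) x]
  exact X.sum_mem fun n _ => h n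

lemma iSup_letters_pow : (⨆ n : ℕ, 𝕃 ^ n) = ⊤ :=
  (DirectSum.Decomposition.isInternal (fun n : ℕ => 𝕃 ^ n)).submodule_iSup_eq_top

lemma letters_pow_inf_of_ne {m n : ℕ} (h : m ≠ n) : 𝕃 ^ m ⊓ 𝕃 ^ n = ⊥ := by
  rw [eq_bot_iff]
  rintro x ⟨h1, h2⟩
  rw [Submodule.mem_bot, ← homProj_of_mem h1, homProj_of_mem_ne h2 h.symm]

/-! ### Overlaps of the relations -/

lemma mem_mul_mono {X X' Y Y' : Submodule k 𝕋} (hX : X ≤ X') (hY : Y ≤ Y') {z : 𝕋}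
    (hz : z ∈ X * Y) : z ∈ X' * Y' :=
  mul_le_mul' hX hY hz

lemma letters_pow_mul_inf {p : ℕ} (X Y : Submodule k 𝕋) :
    𝕃 ^ p * X ⊓ 𝕃 ^ p * Y = 𝕃 ^ p * (X ⊓ Y) := by
  rw [mul_inf_mul_of_left_le le_rfl le_rfl, inf_idem]

lemma mul_letters_pow_inf {p : ℕ} (X Y : Submodule k 𝕋) :
    X * 𝕃 ^ p ⊓ Y * 𝕃 ^ p = (X ⊓ Y) * 𝕃 ^ p := by
  rw [mul_inf_mul_of_right_le le_rfl le_rfl, inf_idem]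

lemma mul_letters_inf (X Y : Submodule k 𝕋) : X * 𝕃 ⊓ Y * 𝕃 = (X ⊓ Y) * 𝕃 := by
  simpa using mul_letters_pow_inf (p := 1) X Y

/-- `∑_{j = 0}^m V^{(j)} ⊗ R ⊗ V^{(m - j)}`. -/
def placements (R : Submodule k 𝕋) : ℕ → Submodule k 𝕋
  | 0 => R
  | m + 1 => placements R m * 𝕃 ⊔ 𝕃 ^ (m + 1) * R

lemma pow_mul_le_placements (R : Submodule k 𝕋) (m : ℕ) : 𝕃 ^ m * R ≤ placements R m := by
  cases m with
  | zero => simp [placements]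
  | succ m => exact le_sup_right

lemma letters_mul_placements (R : Submodule k 𝕋) (m : ℕ) :
    𝕃 * placements R m ≤ placements R (m + 1) := by
  induction m with
  | zero => simp [placements]
  | succ m ih =>
    conv_lhs => rw [placements]
    rw [Submodule.mul_sup, ← mul_assoc, ← mul_assoc, ← pow_succ']
    exact sup_le ((mul_le_mul_left ih 𝕃).trans le_sup_left) le_sup_right

lemma placements_mul_pow (R : Submodule k 𝕋) (m q : ℕ) :
    placements R m * 𝕃 ^ q ≤ placements R (m + q) := by
  induction q with
  | zero => simp
  | succ q ih =>
    rw [pow_succ, ← mul_assoc]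
    exact (mul_le_mul_left ih 𝕃).trans le_sup_left

/-- `∑_{j = 1}^m K_j ⊗ R ⊗ V^{(m - j)}`. -/
def idealPlacements (K : ℕ → Submodule k 𝕋) (R : Submodule k 𝕋) : ℕ → Submodule k 𝕋
  | 0 => ⊥
  | m + 1 => idealPlacements K R m * 𝕃 ⊔ K (m + 1) * R

/-! ### Relations at the last place, with coefficients in an abstract right ideal `K` -/

section Overlaps

variable {s : ℕ} {R : Submodule k (TensorAlgebra k V)}
  {K : ℕ → Submodule k (TensorAlgebra k V)}

lemma mul_pow_le_of_mul_letters_le (hKL : ∀ m : ℕ, K m * 𝕃 ≤ K (m + 1)) (m q : ℕ) :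
    K m * 𝕃 ^ q ≤ K (m + q) := by
  induction q with
  | zero => simp
  | succ q ih =>
    rw [pow_succ, ← mul_assoc]
    exact (mul_le_mul_left ih 𝕃).trans (hKL _)

lemma placements_le (hRK : ∀ m : ℕ, 𝕃 ^ m * R ≤ K (m + s))
    (hKL : ∀ m : ℕ, K m * 𝕃 ≤ K (m + 1)) (m : ℕ) :
    placements R m ≤ K (m + s) := by
  induction m with
  | zero => simpa [placements] using hRK 0
  | succ m ih =>
    refine sup_le ((mul_le_mul_left ih 𝕃).trans ((hKL _).trans_eq ?_)) (hRK _)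
    congr 1; omega

lemma idealPlacements_le (hR : R ≤ 𝕃 ^ s) (hKL : ∀ m : ℕ, K m * 𝕃 ≤ K (m + 1)) (m : ℕ) :
    idealPlacements K R m ≤ K m * 𝕃 ^ s := by
  induction m with
  | zero => exact bot_le
  | succ m ih =>
    refine sup_le ((mul_le_mul_left ih 𝕃).trans ?_) (mul_le_mul_right hR _)
    rw [mul_assoc, ← pow_succ, pow_succ', ← mul_assoc]
    exact mul_le_mul_left (hKL m) _

/-- The placements of `R` lying in the right ideal generated by `K_p` have coefficients in `K`. -/
lemma placements_inf_le_idealPlacements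
    (hRs : R ≤ 𝕃 ^ s) (hRK : ∀ m : ℕ, 𝕃 ^ m * R ≤ K (m + s)) (hKL : ∀ m : ℕ, K m * 𝕃 ≤ K (m + 1))
    (hmin : ∀ p q : ℕ, p < s → p + q = s → R ⊓ K p * 𝕃 ^ q = ⊥)
    (hker : ∀ m : ℕ, 𝕃 ^ (m + 1) * R ⊓ K (m + s) * 𝕃 ≤ 𝕃 ^ m * (𝕃 * R ⊓ R * 𝕃) ⊔ K (m + 1) * R)
    {p : ℕ} (hp : p < s) (m q : ℕ) (hm : m ≤ p) (hq : p + q = s + m) :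
    placements R m ⊓ K p * 𝕃 ^ q ≤ idealPlacements K R m := by
  induction m generalizing q with
  | zero => exact (hmin p q hp (by omega)).le
  | succ m ih =>
    obtain ⟨q, rfl⟩ : ∃ q', q = q' + 1 := ⟨q - 1, by omega⟩
    rintro x ⟨hx, hxK⟩
    obtain ⟨u, hu, v, hv, rfl⟩ := Submodule.mem_sup.1 hx
    have hKq : K p * 𝕃 ^ (q + 1) ≤ K (m + s) * 𝕃 := by
      rw [pow_succ, ← mul_assoc]
      refine mul_le_mul_left ((mul_pow_le_of_mul_letters_le hKL p q).trans_eq ?_) _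
      congr 1; omega
    -- Both `u + v` and `u` lie in `K (m + s) * 𝕃`, so `hker` applies to `v`. Its component `y` is
    -- absorbed by the earlier placements, and `z` already has coefficients in `K`.
    have hv' : v ∈ K (m + s) * 𝕃 := by
      have := sub_mem (hKq hxK) (mul_le_mul_left (placements_le hRK hKL m) 𝕃 hu)
      simpa using this
    obtain ⟨y, hy, z, hz, rfl⟩ := Submodule.mem_sup.1 (hker m ⟨hv, hv'⟩)
    have hy' : y ∈ placements R m * 𝕃 := by
      have h1 : 𝕃 ^ m * (𝕃 * R ⊓ R * 𝕃) ≤ placements R m * 𝕃 := by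
        refine (mul_le_mul_right inf_le_right _).trans ?_
        rw [← mul_assoc]
        exact mul_le_mul_left (pow_mul_le_placements R m) _
      exact h1 hy
    have hz' : z ∈ K p * 𝕃 ^ (q + 1) := by
      have h1 : K (m + 1) * R ≤ K p * 𝕃 ^ (q + 1) := by
        obtain ⟨c, rfl⟩ : ∃ c, p = m + 1 + c := ⟨p - (m + 1), by omega⟩
        obtain rfl : s = c + (q + 1) := by omega
        refine (mul_le_mul_right hRs _).trans ?_
        rw [pow_add, ← mul_assoc]
        exact mul_le_mul_left (mul_pow_le_of_mul_letters_le hKL _ _) _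
      exact h1 hz
    have h2 : u + y ∈ (placements R m ⊓ K p * 𝕃 ^ q) * 𝕃 := by
      rw [← mul_letters_inf, mul_assoc, ← pow_succ]
      refine ⟨add_mem hu hy', ?_⟩
      have := sub_mem hxK hz'
      simpa [← add_assoc] using this
    rw [← add_assoc]
    exact add_mem (Submodule.mem_sup_left (mul_le_mul_left (ih q (by omega) (by omega)) 𝕃 h2))
      (Submodule.mem_sup_right hz)

/-- Induction on `r`, trading coefficients in `K (r + 1)` for coefficients in `K r * 𝕃`. A map `φ`
acting on the first `r + 1` letters sends `K (r + 1)` into `K r * 𝕃` and fixes `K r * 𝕃`. For `x` in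
the intersection, `x - φ x` has coefficients in `K (r + 1)` in front of an instance of `ih` with `m
< p`, and `φ x` falls under the case `r`. The process ends because `K 0 = ⊥`. -/
lemma pow_mul_inf_idealPlacements_le (hR : R ≤ 𝕃 ^ s) (hK : ∀ m : ℕ, K m ≤ 𝕃 ^ m)
    (hKL : ∀ m : ℕ, K m * 𝕃 ≤ K (m + 1)) (hK0 : K 0 = ⊥) {p : ℕ}
    (ih : ∀ m < p, 𝕃 ^ (m + 1) * R ⊓ placements R m * 𝕃 ≤ 𝕃 ^ m * (R * 𝕃)) (r m : ℕ)
    (hrm : r + m = p) :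
    𝕃 ^ (p + 1) * R ⊓ (K r * (placements R m * 𝕃) ⊔ idealPlacements K R r * 𝕃 ^ (m + 1)) ≤
      𝕃 ^ p * (R * 𝕃) := by
  induction r generalizing m with
  | zero => simp [hK0, idealPlacements]
  | succ r ihr =>
    obtain ⟨f, hf, hf'⟩ := exists_linearMap_fix_and_map_inf (K (r + 1)) (K r * 𝕃)
    set φ := leftMap (r + 1) f LinearMap.id
    have hφ : ∀ Y : Submodule k 𝕋, ∀ z ∈ K (r + 1) * Y, φ z ∈ K r * 𝕃 * Y := by
      intro Y z hz
      refine map_mem_of_mul φ (fun x hx w hw => ?_) hz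
      rw [leftMap_mul f _ (hK _ hx)]
      exact Submodule.mul_mem_mul (hf' x hx).2 hw
    rintro x ⟨hx, hx'⟩
    have h1 : K (r + 1) * (placements R m * 𝕃) ⊔ idealPlacements K R (r + 1) * 𝕃 ^ (m + 1) ≤
        K (r + 1) * (placements R m * 𝕃) ⊔ idealPlacements K R r * 𝕃 ^ (m + 2) := by
      refine sup_le le_sup_left ?_
      rw [idealPlacements, Submodule.sup_mul]
      refine sup_le (le_sup_of_le_right ?_) (le_sup_of_le_left ?_)
      · rw [mul_assoc, ← pow_succ']
      · rw [mul_assoc, pow_succ, ← mul_assoc R]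
        refine mul_le_mul_right (mul_le_mul_left ?_ _) _
        have h1 := placements_mul_pow R 0 m
        rwa [zero_add] at h1
    obtain ⟨u, hu, w, hw, rfl⟩ := Submodule.mem_sup.1 (h1 hx')
    have hw1 : w ∈ K r * 𝕃 * 𝕃 ^ (s + m + 1) := by
      have h2 : idealPlacements K R r * 𝕃 ^ (m + 2) ≤ K r * 𝕃 * 𝕃 ^ (s + m + 1) := by
        refine (mul_le_mul_left (idealPlacements_le hR hKL r) _).trans_eq ?_
        rw [mul_assoc, mul_assoc, ← pow_add, ← pow_succ']
        congr 2
      exact h2 hw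
    have hφw : φ w = w := map_eq_of_mul φ LinearMap.id (fun x hx y _ => by
      rw [leftMap_mul f _ (hK _ (hKL _ hx)), hf x hx]; rfl) hw1
    have hxK : u + w ∈ K (r + 1) * (𝕃 ^ (m + 1) * R) := by
      have h2 : u + w ∈ K (r + 1) * ⊤ := add_mem (mem_mul_mono le_rfl le_top hu)
        (mem_mul_mono (hKL r) le_top hw1)
      have h3 : u + w ∈ 𝕃 ^ (r + 1) * (𝕃 ^ (m + 1) * R) := by
        rwa [← mul_assoc, ← pow_add, show r + 1 + (m + 1) = p + 1 by omega]
      have h4 := (mul_inf_mul_of_left_le (hK _) le_rfl).le ⟨h2, h3⟩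
      exact mem_mul_mono inf_le_left inf_le_right h4
    have hd : (u + w) - φ (u + w) ∈ 𝕃 ^ p * (R * 𝕃) := by
      have h2 : (u + w) - φ (u + w) ∈
          K (r + 1) * (𝕃 ^ (m + 1) * R) ⊓ K (r + 1) * (placements R m * 𝕃) := by
        refine ⟨sub_mem hxK (mul_le_mul_left (hKL r) _ (hφ _ _ hxK)), ?_⟩
        rw [map_add, hφw, add_sub_add_right_eq_sub]
        exact sub_mem hu (mul_le_mul_left (hKL r) _ (hφ _ _ hu))
      rw [mul_inf_mul_of_left_le (hK _) (hK _), inf_idem] at h2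
      have h3 := mul_le_mul' (hK _) (ih m (by omega)) h2
      rwa [← mul_assoc, ← pow_add, show r + 1 + m = p by omega] at h3
    have hφx : φ (u + w) ∈ 𝕃 ^ p * (R * 𝕃) := by
      refine ihr (m + 1) (by omega) ⟨?_, ?_⟩
      · have h2 := mul_le_mul_left ((hKL r).trans (hK _)) _ (hφ _ _ hxK)
        rwa [← mul_assoc, ← pow_add, show r + 1 + (m + 1) = p + 1 by omega] at h2
      · rw [map_add, hφw]
        refine add_mem (Submodule.mem_sup_left ?_) (Submodule.mem_sup_right hw)
        have h2 := hφ _ _ hu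
        rw [mul_assoc, ← mul_assoc 𝕃] at h2
        exact mul_le_mul_right (mul_le_mul_left (letters_mul_placements R m) _) _ h2
    simpa using add_mem hd hφx

/-- A combination of relations of length `s` at earlier places, which is itself a combination of
relations at the last place, is one at the last but one place. -/
lemma pow_succ_mul_inf_placements_le (hRs : R ≤ 𝕃 ^ s) (hK : ∀ m : ℕ, K m ≤ 𝕃 ^ m)
    (hK0 : K 0 = ⊥) (hRK : ∀ m : ℕ, 𝕃 ^ m * R ≤ K (m + s)) (hKL : ∀ m : ℕ, K m * 𝕃 ≤ K (m + 1))
    (hmin : ∀ p q : ℕ, p < s → p + q = s → R ⊓ K p * 𝕃 ^ q = ⊥)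
    (hker : ∀ m : ℕ, 𝕃 ^ (m + 1) * R ⊓ K (m + s) * 𝕃 ≤
      𝕃 ^ m * (𝕃 * R ⊓ R * 𝕃) ⊔ K (m + 1) * R)
    {p : ℕ} (hp : p + 1 < s) :
    𝕃 ^ (p + 1) * R ⊓ placements R p * 𝕃 ≤ 𝕃 ^ p * (R * 𝕃) := by
  induction p using Nat.strong_induction_on with
  | _ p ih =>
    rintro x ⟨hx, hx'⟩
    obtain ⟨y, hy, z, hz, rfl⟩ := Submodule.mem_sup.1
      (hker p ⟨hx, mul_le_mul_left (placements_le hRK hKL p) 𝕃 hx'⟩)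
    have hy' : y ∈ 𝕃 ^ p * (R * 𝕃) := mem_mul_mono le_rfl inf_le_right hy
    have hyR : y ∈ 𝕃 ^ (p + 1) * R := by
      rw [pow_succ, mul_assoc]
      exact mem_mul_mono le_rfl inf_le_left hy
    have hyP : y ∈ placements R p * 𝕃 := by
      have := hy'
      rw [← mul_assoc] at this
      exact mul_le_mul_left (pow_mul_le_placements R p) _ this
    refine add_mem hy' ?_
    have hzR : z ∈ 𝕃 ^ (p + 1) * R := by simpa using sub_mem hx hyR
    have hzP : z ∈ placements R p * 𝕃 := by simpa using sub_mem hx' hyP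
    -- From here on the relations have length `s + 1`. Splitting off one last letter places `z` in
    -- `(placements R p ⊓ K (p + 1) * 𝕃 ^ s) * 𝕃`, to which the previous bound applies with `p + 1`
    -- for its `p` and `p` for its `m`.
    obtain ⟨s, rfl⟩ : ∃ s', s = s' + 1 := ⟨s - 1, by omega⟩
    have hzD : z ∈ idealPlacements K R p * 𝕃 := by
      have h1 : z ∈ K (p + 1) * 𝕃 ^ s * 𝕃 := by
        rw [mul_assoc, ← pow_succ]
        exact mul_le_mul_right hRs _ hz
      have h2 := (mul_letters_inf _ _).le ⟨hzP, h1⟩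
      exact mul_le_mul_left (placements_inf_le_idealPlacements hRs hRK hKL hmin hker hp p s
        (by omega) (by omega)) _ h2
    refine pow_mul_inf_idealPlacements_le hRs hK hKL hK0
      (fun m hm => ih m hm (by omega)) p 0 (by omega) ⟨hzR, Submodule.mem_sup_right ?_⟩
    simpa using hzD

end Overlaps
/-! ### The ideal of relations -/

lemma homProj_mul_mem {X Y W : Submodule k 𝕋} {p w : ℕ} (hW : W ≤ 𝕃 ^ w)
    (h : ∀ x ∈ X, homProj k V p x ∈ Y) {z : 𝕋} (hz : z ∈ X * W) :
    homProj k V (p + w) z ∈ Y * W := by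
  refine map_mem_of_mul _ (fun x hx y hy => ?_) hz
  have : homProj k V (p + w) (x * y) = homProj k V p x * y :=
    DirectSum.coe_decompose_mul_add_of_right_mem (fun n : ℕ => 𝕃 ^ n) (hW hy)
  rw [this]
  exact Submodule.mul_mem_mul (h x hx) hy

lemma homProj_mul_eq_zero {X W : Submodule k 𝕋} {n w : ℕ} (hW : W ≤ 𝕃 ^ w) (h : n < w)
    {z : 𝕋} (hz : z ∈ X * W) : homProj k V n z = 0 := by
  have : homProj k V n z ∈ (⊥ : Submodule k 𝕋) :=
    map_mem_of_mul _ (fun x hx y hy => (Submodule.mem_bot k).2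
      (DirectSum.coe_decompose_mul_of_right_mem_of_not_le (fun n : ℕ => 𝕃 ^ n) (hW hy) (by omega)))
      hz
  exact (Submodule.mem_bot k).1 this

lemma homProj_mem_pow (n : ℕ) (x : 𝕋) : homProj k V n x ∈ 𝕃 ^ n :=
  (DirectSum.decompose (fun n : ℕ => 𝕃 ^ n) x n).2

/-- The component of degree `m` of the two-sided ideal generated by `R ⊆ V^{(s)}`. -/
def relPart (s : ℕ) (R : Submodule k 𝕋) (m : ℕ) : Submodule k 𝕋 :=
  ⨆ (j : ℕ) (l : ℕ) (_ : j + s + l = m), 𝕃 ^ j * R * 𝕃 ^ l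

lemma le_relPart {s : ℕ} {R : Submodule k 𝕋} {m : ℕ} (j l : ℕ) (h : j + s + l = m) :
    𝕃 ^ j * R * 𝕃 ^ l ≤ relPart s R m :=
  le_iSup_of_le j (le_iSup_of_le l (le_iSup_of_le h le_rfl))

lemma relPart_le_iff {s : ℕ} {R : Submodule k 𝕋} {m : ℕ} {X : Submodule k 𝕋} :
    relPart s R m ≤ X ↔ ∀ j l, j + s + l = m → 𝕃 ^ j * R * 𝕃 ^ l ≤ X := by
  simp [relPart]

lemma relPart_mul_pow_le {s : ℕ} {R : Submodule k 𝕋} (m q : ℕ) :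
    relPart s R m * 𝕃 ^ q ≤ relPart s R (m + q) := by
  simp only [relPart, Submodule.iSup_mul]
  refine iSup_le fun j => iSup_le fun l => iSup_le fun h => ?_
  rw [mul_assoc, ← pow_add]
  exact le_relPart j (l + q) (by omega)

lemma relPart_eq_bot {s : ℕ} {R : Submodule k 𝕋} {m : ℕ} (h : m < s) : relPart s R m = ⊥ := by
  rw [eq_bot_iff, relPart_le_iff]
  intros
  omega

lemma relPart_le_pow {s : ℕ} {R : Submodule k 𝕋} (hR : R ≤ 𝕃 ^ s) (m : ℕ) :
    relPart s R m ≤ 𝕃 ^ m := by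
  rw [relPart_le_iff]
  rintro j l rfl
  rw [pow_add, pow_add]
  gcongr

/-- The relations of degree `m + 1` are generated by those of degree `m` and those at the last
place. -/
lemma relPart_succ_le {s : ℕ} {R X : Submodule k 𝕋} {m : ℕ} (h1 : relPart s R m * 𝕃 ≤ X)
    (h2 : ∀ j, j + s = m + 1 → 𝕃 ^ j * R ≤ X) : relPart s R (m + 1) ≤ X := by
  rw [relPart_le_iff]
  rintro j (_ | l) h
  · simpa using h2 j (by omega)
  · rw [pow_succ, ← mul_assoc]
    exact (mul_le_mul_left (le_relPart j l (by omega)) _).trans h1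

variable (Ra Rb : Submodule k (TensorAlgebra k V))

/-- The ideal of relations as a subspace of `T(V)`. -/
abbrev relSubmodule : Submodule k 𝕋 := (relIdeal Ra Rb).restrictScalars k

/-- The component of degree `m` of the ideal of relations. -/
def idealPiece (m : ℕ) : Submodule k 𝕋 := relSubmodule Ra Rb ⊓ 𝕃 ^ m

lemma relIdealPiece_natCast (m : ℕ) : relIdealPiece Ra Rb m = idealPiece Ra Rb m := by
  rw [relIdealPiece, TP_natCast, idealPiece]

lemma mul_relSubmodule_le (X : Submodule k 𝕋) : X * relSubmodule Ra Rb ≤ relSubmodule Ra Rb :=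
  Submodule.mul_le.2 fun x _ _ hy => (relIdeal Ra Rb).mul_mem_left x hy

lemma relSubmodule_mul_le (X : Submodule k 𝕋) : relSubmodule Ra Rb * X ≤ relSubmodule Ra Rb :=
  Submodule.mul_le.2 fun _ hx y _ => (relIdeal Ra Rb).mul_mem_right y hx

lemma left_le_relSubmodule : Ra ≤ relSubmodule Ra Rb := fun _ hx =>
  TwoSidedIdeal.mem_asIdeal.2 (TwoSidedIdeal.subset_span (Or.inl hx))

lemma right_le_relSubmodule : Rb ≤ relSubmodule Ra Rb := fun _ hx =>
  TwoSidedIdeal.mem_asIdeal.2 (TwoSidedIdeal.subset_span (Or.inr hx))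

lemma relPart_le_relSubmodule {s : ℕ} {R : Submodule k 𝕋} (hR : R ≤ relSubmodule Ra Rb) (m : ℕ) :
    relPart s R m ≤ relSubmodule Ra Rb := by
  rw [relPart_le_iff]
  intro j l _
  exact (mul_le_mul_left ((mul_le_mul_right hR _).trans (mul_relSubmodule_le _ _ _)) _).trans
    (relSubmodule_mul_le _ _ _)

lemma mul_mul_mem_iSup_relPart (s : ℕ) {R : Submodule k 𝕋} {r : 𝕋} (hr : r ∈ R) (x y : 𝕋) :
    x * r * y ∈ ⨆ m, relPart s R m := by
  have hx : x ∈ ⨆ n : ℕ, 𝕃 ^ n := by rw [iSup_letters_pow]; trivial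
  have hy : y ∈ ⨆ n : ℕ, 𝕃 ^ n := by rw [iSup_letters_pow]; trivial
  have h : x * r * y ∈ (⨆ n : ℕ, 𝕃 ^ n) * R * (⨆ n : ℕ, 𝕃 ^ n) :=
    Submodule.mul_mem_mul (Submodule.mul_mem_mul hx hr) hy
  simp only [Submodule.iSup_mul, Submodule.mul_iSup] at h
  refine (iSup_le fun l => iSup_le fun j => ?_ :
    (⨆ l : ℕ, ⨆ j : ℕ, 𝕃 ^ j * R * 𝕃 ^ l) ≤ ⨆ m, relPart s R m) h
  exact le_iSup_of_le (j + s + l) (le_relPart j l rfl)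

/-- The ideal is additively spanned by the products `u r v` with `r` a relation, and `u`, `v`
decompose into homogeneous components. Homogeneity of the ideal follows. -/
lemma relSubmodule_eq_iSup (a b : ℕ) :
    relSubmodule Ra Rb = ⨆ m, (relPart a Ra m ⊔ relPart b Rb m) := by
  apply le_antisymm
  · intro x hx
    have hx' : x ∈ TwoSidedIdeal.span ((Ra : Set 𝕋) ∪ (Rb : Set 𝕋)) :=
      TwoSidedIdeal.mem_asIdeal.1 hx
    rw [TwoSidedIdeal.mem_span_iff_mem_addSubgroup_closure] at hx'
    refine (AddSubgroup.closure_le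
      (K := (⨆ m, (relPart a Ra m ⊔ relPart b Rb m)).toAddSubgroup)).2 ?_ hx'
    rintro _ ⟨_, ⟨u, -, r, hr | hr, rfl⟩, v, -, rfl⟩
    · exact (iSup_mono fun m => le_sup_left : (⨆ m, relPart a Ra m) ≤ _)
        (mul_mul_mem_iSup_relPart a hr u v)
    · exact (iSup_mono fun m => le_sup_right : (⨆ m, relPart b Rb m) ≤ _)
        (mul_mul_mem_iSup_relPart b hr u v)
  · exact iSup_le fun m => sup_le
      (relPart_le_relSubmodule _ _ (left_le_relSubmodule _ _) m)
      (relPart_le_relSubmodule _ _ (right_le_relSubmodule _ _) m)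

lemma idealPiece_le_pow (m : ℕ) : idealPiece Ra Rb m ≤ 𝕃 ^ m := inf_le_right

lemma idealPiece_le_relSubmodule (m : ℕ) : idealPiece Ra Rb m ≤ relSubmodule Ra Rb := inf_le_left

lemma idealPiece_mul_pow_le (m q : ℕ) :
    idealPiece Ra Rb m * 𝕃 ^ q ≤ idealPiece Ra Rb (m + q) := by
  refine le_inf ((mul_le_mul_left inf_le_left _).trans (relSubmodule_mul_le _ _ _)) ?_
  rw [pow_add]
  exact mul_le_mul_left inf_le_right _

lemma pow_mul_idealPiece_le (m q : ℕ) :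
    𝕃 ^ q * idealPiece Ra Rb m ≤ idealPiece Ra Rb (q + m) := by
  refine le_inf ((mul_le_mul_right inf_le_left _).trans (mul_relSubmodule_le _ _ _)) ?_
  rw [pow_add]
  exact mul_le_mul_right inf_le_right _

/-- The standing assumptions on the spaces of relations. -/
structure RelationData (a b : ℕ) : Prop where
  two_le : 2 ≤ a
  lt : a < b
  left_le : Ra ≤ 𝕃 ^ a
  right_le : Rb ≤ 𝕃 ^ b
  inf_relPart : Rb ⊓ relPart a Ra b = ⊥

/-- What the spaces `R_a` and `R_b` have in common. -/
structure IsRelationSpace (s : ℕ) (R : Submodule k (TensorAlgebra k V)) : Prop where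
  two_le : 2 ≤ s
  le_pow : R ≤ 𝕃 ^ s
  le_relSubmodule : R ≤ relSubmodule Ra Rb
  inf_idealPiece : ∀ p q : ℕ, p < s → p + q = s → R ⊓ idealPiece Ra Rb p * 𝕃 ^ q = ⊥

variable {Ra Rb} {a b : ℕ}

lemma RelationData.relPart_sup_le_pow (h : RelationData Ra Rb a b) (m : ℕ) :
    relPart a Ra m ⊔ relPart b Rb m ≤ 𝕃 ^ m :=
  sup_le (relPart_le_pow h.left_le m) (relPart_le_pow h.right_le m)

lemma RelationData.idealPiece_eq (h : RelationData Ra Rb a b) (m : ℕ) :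
    idealPiece Ra Rb m = relPart a Ra m ⊔ relPart b Rb m := by
  apply le_antisymm
  · rintro x ⟨hx, hm⟩
    rw [relSubmodule_eq_iSup Ra Rb a b] at hx
    exact mem_of_mem_iSup h.relPart_sup_le_pow hx hm
  · refine le_inf ?_ (h.relPart_sup_le_pow m)
    rw [relSubmodule_eq_iSup Ra Rb a b]
    exact le_iSup (fun m => relPart a Ra m ⊔ relPart b Rb m) m

lemma RelationData.homProj_mem (h : RelationData Ra Rb a b) (m : ℕ) {x : 𝕋}
    (hx : x ∈ relSubmodule Ra Rb) : homProj k V m x ∈ idealPiece Ra Rb m := by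
  rw [relSubmodule_eq_iSup Ra Rb a b] at hx
  rw [h.idealPiece_eq]
  exact MultiKoszul.homProj_mem h.relPart_sup_le_pow m hx

lemma RelationData.idealPiece_eq_relPart (h : RelationData Ra Rb a b) {m : ℕ} (hm : m < b) :
    idealPiece Ra Rb m = relPart a Ra m := by
  rw [h.idealPiece_eq, relPart_eq_bot hm, sup_bot_eq]

lemma RelationData.idealPiece_eq_bot (h : RelationData Ra Rb a b) {m : ℕ} (hm : m < a) :
    idealPiece Ra Rb m = ⊥ := by
  rw [h.idealPiece_eq_relPart (hm.trans h.lt), relPart_eq_bot hm]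

lemma RelationData.isRelationSpace_left (h : RelationData Ra Rb a b) :
    IsRelationSpace Ra Rb a Ra where
  two_le := h.two_le
  le_pow := h.left_le
  le_relSubmodule := left_le_relSubmodule _ _
  inf_idealPiece p q hp _ := by simp [h.idealPiece_eq_bot hp]

lemma RelationData.isRelationSpace_right (h : RelationData Ra Rb a b) :
    IsRelationSpace Ra Rb b Rb where
  two_le := h.two_le.trans h.lt.le
  le_pow := h.right_le
  le_relSubmodule := right_le_relSubmodule _ _
  inf_idealPiece p q hp hpq := by
    -- Below degree `b` the ideal consists of consequences of `Ra` only, so the minimality condition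
    -- applies.
    rw [eq_bot_iff, ← h.inf_relPart, h.idealPiece_eq_relPart hp, ← hpq]
    exact inf_le_inf_left _ (relPart_mul_pow_le p q)

/-- The kernel of `δ₂` is generated by `J₃`. -/
def KernelTwo (Ra Rb : Submodule k (TensorAlgebra k V)) : Prop :=
  -- Both summands are mapped to `A ⊗ V`, where their images could cancel; hence one condition on
  -- the sum. Concluding for `x` and `y` separately is what later keeps `Ra` and `Rb` apart.
  ∀ x ∈ ⊤ * Ra, ∀ y ∈ ⊤ * Rb, x + y ∈ relSubmodule Ra Rb * 𝕃 →
    x ∈ ⊤ * (𝕃 * Ra ⊓ Ra * 𝕃) ⊔ relSubmodule Ra Rb * Ra ∧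
      y ∈ ⊤ * (𝕃 * Rb ⊓ Rb * 𝕃) ⊔ relSubmodule Ra Rb * Rb

lemma RelationData.mem_pow_mul_sup_of_mem (h : RelationData Ra Rb a b) {s : ℕ}
    {R : Submodule k 𝕋} (hR : R ≤ 𝕃 ^ s) {m : ℕ} {x : 𝕋} (hx : x ∈ 𝕃 ^ (m + 1) * R)
    (hx' : x ∈ ⊤ * (𝕃 * R ⊓ R * 𝕃) ⊔ relSubmodule Ra Rb * R) :
    x ∈ 𝕃 ^ m * (𝕃 * R ⊓ R * 𝕃) ⊔ idealPiece Ra Rb (m + 1) * R := by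
  have hxs : x ∈ 𝕃 ^ (m + 1 + s) := by
    rw [pow_add]
    exact mem_mul_mono le_rfl hR hx
  obtain ⟨y, hy, z, hz, rfl⟩ := Submodule.mem_sup.1 hx'
  rw [← homProj_of_mem hxs, map_add]
  refine add_mem (Submodule.mem_sup_left ?_) (Submodule.mem_sup_right ?_)
  · have hJ : 𝕃 * R ⊓ R * 𝕃 ≤ 𝕃 ^ (1 + s) := by
      rw [pow_add, pow_one]
      exact inf_le_left.trans (mul_le_mul_right hR _)
    have := homProj_mul_mem hJ (fun x _ => homProj_mem_pow m x) hy
    rwa [← add_assoc] at this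
  · exact homProj_mul_mem hR (fun x hx => h.homProj_mem _ hx) hz

lemma IsRelationSpace.pow_mul_le_idealPiece {s : ℕ} {R : Submodule k 𝕋}
    (hR : IsRelationSpace Ra Rb s R) (m : ℕ) : 𝕃 ^ m * R ≤ idealPiece Ra Rb (m + s) := by
  refine le_inf ((mul_le_mul_right hR.le_relSubmodule _).trans (mul_relSubmodule_le _ _ _)) ?_
  rw [pow_add]
  exact mul_le_mul_right hR.le_pow _

/-- The graded form of exactness at `A ⊗ R_s`. -/
def KernelTwoAt (Ra Rb : Submodule k (TensorAlgebra k V)) (s : ℕ)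
    (R : Submodule k (TensorAlgebra k V)) : Prop :=
  ∀ m : ℕ, 𝕃 ^ (m + 1) * R ⊓ idealPiece Ra Rb (m + s) * 𝕃 ≤
    𝕃 ^ m * (𝕃 * R ⊓ R * 𝕃) ⊔ idealPiece Ra Rb (m + 1) * R

lemma KernelTwo.left (hk : KernelTwo Ra Rb) (h : RelationData Ra Rb a b) :
    KernelTwoAt Ra Rb a Ra := by
  rintro m x ⟨hx, hx'⟩
  exact h.mem_pow_mul_sup_of_mem h.left_le hx
    (hk x (mem_mul_mono le_top le_rfl hx) 0 (zero_mem _)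
      (by simpa using mem_mul_mono inf_le_left le_rfl hx')).1

lemma KernelTwo.right (hk : KernelTwo Ra Rb) (h : RelationData Ra Rb a b) :
    KernelTwoAt Ra Rb b Rb := by
  rintro m x ⟨hx, hx'⟩
  exact h.mem_pow_mul_sup_of_mem h.right_le hx
    (hk 0 (zero_mem _) x (mem_mul_mono le_top le_rfl hx)
      (by simpa using mem_mul_mono inf_le_left le_rfl hx')).2

lemma IsRelationSpace.pow_succ_mul_inf_placements_le {s : ℕ} {R : Submodule k 𝕋}
    (hR : IsRelationSpace Ra Rb s R) (hk : KernelTwoAt Ra Rb s R)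
    (h0 : idealPiece Ra Rb 0 = ⊥) {p : ℕ} (hp : p + 1 < s) :
    𝕃 ^ (p + 1) * R ⊓ placements R p * 𝕃 ≤ 𝕃 ^ p * (R * 𝕃) :=
  MultiKoszul.pow_succ_mul_inf_placements_le (K := idealPiece Ra Rb) hR.le_pow
    (idealPiece_le_pow Ra Rb) h0 hR.pow_mul_le_idealPiece
    (fun m => by simpa using idealPiece_mul_pow_le Ra Rb m 1) hR.inf_idealPiece hk hp

/-! ### Overlapping relations -/

/-- `⋂_{j = 0}^m V^{(j)} ⊗ R ⊗ V^{(m - j)}`. -/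
def overlaps (R : Submodule k 𝕋) (m : ℕ) : Submodule k 𝕋 :=
  ⨅ j ∈ Finset.range (m + 1), 𝕃 ^ j * R * 𝕃 ^ (m - j)

lemma mem_overlaps {R : Submodule k 𝕋} {m : ℕ} {x : 𝕋} :
    x ∈ overlaps R m ↔ ∀ j l, j + l = m → x ∈ 𝕃 ^ j * R * 𝕃 ^ l := by
  simp only [overlaps, Submodule.mem_iInf, Finset.mem_range]
  constructor
  · rintro h j l rfl
    simpa using h j (by omega)
  · intro h j hj
    exact h j _ (by omega)

lemma overlaps_le {R : Submodule k 𝕋} {m : ℕ} (j l : ℕ) (h : j + l = m) :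
    overlaps R m ≤ 𝕃 ^ j * R * 𝕃 ^ l := fun _ hx => mem_overlaps.1 hx j l h

lemma overlaps_le_left {R : Submodule k 𝕋} (m : ℕ) : overlaps R m ≤ R * 𝕃 ^ m := by
  simpa using overlaps_le (R := R) 0 m (by omega)

@[simp] lemma overlaps_zero (R : Submodule k 𝕋) : overlaps R 0 = R := by
  simp [overlaps]

lemma overlaps_one (R : Submodule k 𝕋) : overlaps R 1 = 𝕃 * R ⊓ R * 𝕃 := by
  ext x
  rw [mem_overlaps]
  constructor
  · intro h
    exact ⟨by simpa using h 1 0 rfl, by simpa using h 0 1 rfl⟩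
  · rintro ⟨h1, h2⟩ j l hjl
    obtain ⟨rfl, rfl⟩ | ⟨rfl, rfl⟩ : j = 1 ∧ l = 0 ∨ j = 0 ∧ l = 1 := by omega
    · simpa using h1
    · simpa using h2

lemma overlaps_le_pow {R : Submodule k 𝕋} {s : ℕ} (hR : R ≤ 𝕃 ^ s) (m : ℕ) :
    overlaps R m ≤ 𝕃 ^ (s + m) := by
  rw [pow_add]
  exact (overlaps_le_left m).trans (mul_le_mul_left hR _)

lemma mem_pow_mul_iInf {ι : Type*} (t : Finset ι) (X : ι → Submodule k 𝕋) {p : ℕ} {x : 𝕋}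
    (h : x ∈ 𝕃 ^ p * ⊤) (hx : ∀ i ∈ t, x ∈ 𝕃 ^ p * X i) : x ∈ 𝕃 ^ p * ⨅ i ∈ t, X i := by
  classical
  induction t using Finset.induction_on with
  | empty => simpa using h
  | insert i t hi ih =>
    rw [Finset.iInf_insert, ← letters_pow_mul_inf]
    exact ⟨hx i (Finset.mem_insert_self _ _), ih fun j hj => hx j (Finset.mem_insert_of_mem hj)⟩

lemma overlaps_add_le (R : Submodule k 𝕋) (c m : ℕ) :
    overlaps R (c + m) ≤ 𝕃 ^ c * overlaps R m := by
  intro x hx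
  refine mem_pow_mul_iInf _ _ ?_ fun j hj => ?_
  · have := mem_overlaps.1 hx c m rfl
    rw [mul_assoc] at this
    exact mem_mul_mono le_rfl le_top this
  · have := mem_overlaps.1 hx (c + j) (m - j) (by have := Finset.mem_range.1 hj; omega)
    rwa [pow_add, mul_assoc, mul_assoc, ← mul_assoc (𝕃 ^ j)] at this

lemma overlaps_inf_le (R : Submodule k 𝕋) (c m : ℕ) :
    overlaps R c * 𝕃 ^ m ⊓ 𝕃 ^ c * overlaps R m ≤ overlaps R (c + m) := by
  rintro x ⟨h1, h2⟩
  refine mem_overlaps.2 fun j l hjl => ?_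
  by_cases hj : j ≤ c
  · have := mem_mul_mono (overlaps_le j (c - j) (by omega)) le_rfl h1
    rwa [mul_assoc, ← pow_add, show c - j + m = l by omega] at this
  · have := mem_mul_mono le_rfl (overlaps_le (j - c) l (by omega)) h2
    rwa [← mul_assoc, ← mul_assoc, ← pow_add, show c + (j - c) = j by omega] at this

lemma overlaps_mul_inf_le (R : Submodule k 𝕋) (m : ℕ) :
    overlaps R m * 𝕃 ⊓ 𝕃 ^ (m + 1) * R ≤ overlaps R (m + 1) := by
  rintro x ⟨h1, h2⟩
  refine mem_overlaps.2 fun j l hjl => ?_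
  obtain _ | l := l
  · obtain rfl : j = m + 1 := by omega
    simpa using h2
  · have := mem_mul_mono (overlaps_le j l (by omega)) le_rfl h1
    rwa [mul_assoc, ← pow_succ] at this

/-- For small shifts, relations at the last place which are combinations of relations `d` places
before are relations at all the intermediate places. -/
lemma IsRelationSpace.pow_mul_inf_placements_le {s : ℕ} {R : Submodule k 𝕋}
    (hR : IsRelationSpace Ra Rb s R) (hk : KernelTwoAt Ra Rb s R)
    (h0 : idealPiece Ra Rb 0 = ⊥) (e d : ℕ) (h : e + d < s) :
    𝕃 ^ (e + d) * R ⊓ placements R e * 𝕃 ^ d ≤ 𝕃 ^ e * overlaps R d := by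
  induction d with
  | zero => simp
  | succ d ih =>
    rintro x ⟨h1, h2⟩
    have h2' : x ∈ placements R (e + d) * 𝕃 := by
      rw [pow_succ, ← mul_assoc] at h2
      exact mem_mul_mono (placements_mul_pow R e d) le_rfl h2
    -- The one-step result moves the relation from the last place to the last but one; after removal
    -- of the last letter the induction hypothesis reaches the other places.
    have h3 := hR.pow_succ_mul_inf_placements_le hk h0 (p := e + d) (by omega) ⟨h1, h2'⟩
    have h4 : x ∈ 𝕃 ^ e * overlaps R d * 𝕃 := by
      refine mem_mul_mono (ih (by omega)) le_rfl ?_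
      rw [← mul_letters_inf]
      rw [← mul_assoc] at h3
      rw [pow_succ, ← mul_assoc] at h2
      exact ⟨h3, h2⟩
    rw [← add_assoc, add_assoc, pow_add, mul_assoc] at h1
    rw [mul_assoc] at h4
    exact mem_mul_mono le_rfl (overlaps_mul_inf_le R d) ((letters_pow_mul_inf _ _).le ⟨h4, h1⟩)

/-! ### Sums of placements with integral bounds -/

lemma relSum_le_iff {s : ℕ} {R X : Submodule k 𝕋} {N : ℕ} {lo hi : ℤ} :
    relSum s R N lo hi ≤ X ↔
      ∀ j l : ℕ, j + s + l = N → lo ≤ j → j ≤ hi → 𝕃 ^ j * R * 𝕃 ^ l ≤ X := by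
  simp only [relSum, iSup_le_iff, Finset.mem_Icc]
  constructor
  · rintro h j l rfl h1 h2
    have := h j ⟨h1, h2⟩
    rwa [show ((j + s + l : ℕ) : ℤ) - s - j = l by push_cast; ring, TP_natCast, TP_natCast] at this
  · rintro h j ⟨h1, h2⟩
    obtain hj | hj := lt_or_ge j 0
    · simp [TP_of_neg hj]
    lift j to ℕ using hj
    obtain hl | hl := lt_or_ge ((N : ℤ) - s - j) 0
    · simp [TP_of_neg hl]
    obtain ⟨l, hl⟩ := Int.eq_ofNat_of_zero_le hl
    rw [hl]
    rw [TP_natCast, TP_natCast]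
    exact h j l (by omega) h1 h2

lemma le_relSum {s : ℕ} {R : Submodule k 𝕋} {N : ℕ} {lo hi : ℤ} (j l : ℕ) (h : j + s + l = N)
    (h1 : lo ≤ j) (h2 : j ≤ hi) : 𝕃 ^ j * R * 𝕃 ^ l ≤ relSum s R N lo hi :=
  relSum_le_iff.1 le_rfl j l h h1 h2

lemma relSum_add_le {s : ℕ} {R : Submodule k 𝕋} (c : ℕ) {N : ℕ} {lo hi : ℤ} (hlo : 0 ≤ lo) :
    relSum s R (c + N : ℕ) (c + lo) (c + hi) ≤ 𝕃 ^ c * relSum s R N lo hi := by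
  rw [relSum_le_iff]
  intro j l h h1 h2
  obtain ⟨j, rfl⟩ : ∃ j', j = c + j' := ⟨j - c, by omega⟩
  rw [pow_add, mul_assoc, mul_assoc, ← mul_assoc (𝕃 ^ j)]
  exact mul_le_mul_right (le_relSum j l (by omega) (by omega) (by omega)) _

lemma relPart_le_relSum {s : ℕ} {R : Submodule k 𝕋} (N : ℕ) :
    relPart s R N ≤ relSum s R N 0 (N - s) := by
  rw [relPart_le_iff]
  intro j l h
  exact le_relSum j l h (by omega) (by omega)

lemma Jbar_eq_overlaps (s : ℕ) (R : Submodule k 𝕋) (m : ℕ) :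
    Jbar s R (s + m : ℕ) = overlaps R m := by
  ext x
  simp only [Jbar, Submodule.mem_iInf, Finset.mem_Icc, mem_overlaps]
  constructor
  · rintro h j l rfl
    have := h j ⟨by omega, by omega⟩
    rwa [show ((s + (j + l) : ℕ) : ℤ) - s - j = l by push_cast; ring, TP_natCast, TP_natCast]
      at this
  · rintro h j ⟨h0, h1⟩
    lift j to ℕ using h0
    obtain ⟨l, rfl⟩ : ∃ l, m = j + l := ⟨m - j, by omega⟩
    rw [show ((s + (j + l) : ℕ) : ℤ) - s - j = l by push_cast; ring, TP_natCast, TP_natCast]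
    exact h j l rfl

lemma TP_sub_of_le {p d : ℕ} (h : d ≤ p) : TP k V ((p : ℤ) - d) = 𝕃 ^ (p - d) := by
  rw [← TP_natCast, Nat.cast_sub h]

lemma TP_sub_of_lt {p d : ℕ} (h : p < d) : TP k V ((p : ℤ) - d) = ⊥ := TP_of_neg (by omega)

lemma pow_mul_TP_sub_le (c p d : ℕ) :
    𝕃 ^ c * TP k V ((p : ℤ) - d) ≤ TP k V (((c + p : ℕ) : ℤ) - d) := by
  obtain h | h := lt_or_ge p d
  · simp [TP_sub_of_lt h]
  · rw [TP_sub_of_le h, TP_sub_of_le (by omega), ← pow_add, show c + p - d = c + (p - d) by omega]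

variable (Ra Rb) in
/-- The elements of `V^{(p)} ⊗ J_i^s` which represent boundaries. -/
def boundaries (R : Submodule k 𝕋) (q d p : ℕ) : Submodule k 𝕋 :=
  idealPiece Ra Rb p * overlaps R q ⊔ TP k V ((p : ℤ) - d) * overlaps R (q + d)

lemma pow_mul_boundaries_le (R : Submodule k 𝕋) (q d p c : ℕ) :
    𝕃 ^ c * boundaries Ra Rb R q d p ≤ boundaries Ra Rb R q d (c + p) := by
  rw [boundaries, Submodule.mul_sup, ← mul_assoc, ← mul_assoc]
  exact sup_le_sup (mul_le_mul_left (pow_mul_idealPiece_le _ _ _ _) _)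
    (mul_le_mul_left (pow_mul_TP_sub_le _ _ _) _)

/-- To bound the intersection with placements beginning among the last letters, one may drop
the first letters. -/
lemma inf_relSum_le_of_shift {X : Submodule k 𝕋} {Y : ℕ → Submodule k 𝕋} {s : ℕ}
    {R : Submodule k 𝕋} {p₀ N : ℕ} {hi : ℤ} (hs : s ≤ p₀ + 1)
    (hY : ∀ c p, 𝕃 ^ c * Y p ≤ Y (c + p))
    (h : 𝕃 ^ p₀ * X ⊓ relSum s R (p₀ + N : ℕ) (p₀ - s + 1) (p₀ + hi) ≤ Y p₀) (p : ℕ) (hp : p₀ ≤ p) :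
    𝕃 ^ p * X ⊓ relSum s R (p + N : ℕ) (p - s + 1) (p + hi) ≤ Y p := by
  obtain ⟨c, rfl⟩ : ∃ c, p = c + p₀ := ⟨p - p₀, by omega⟩
  rintro x ⟨h1, h2⟩
  rw [pow_add, mul_assoc] at h1
  have h3 : x ∈ 𝕃 ^ c * relSum s R (p₀ + N : ℕ) (p₀ - s + 1) (p₀ + hi) := by
    refine relSum_add_le c (by omega) ?_
    have e : relSum s R (c + (p₀ + N) : ℕ) (c + ((p₀ : ℤ) - s + 1)) (c + (p₀ + hi)) =
        relSum s R (c + p₀ + N : ℕ) ((c + p₀ : ℕ) - s + 1) ((c + p₀ : ℕ) + hi) := by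
      congr 1 <;> (push_cast; ring)
    rw [e]
    exact h2
  exact hY c p₀ (mem_mul_mono le_rfl h ((letters_pow_mul_inf _ _).le ⟨h1, h3⟩))

lemma RelationData.idealPiece_zero (h : RelationData Ra Rb a b) : idealPiece Ra Rb 0 = ⊥ :=
  h.idealPiece_eq_bot (by have := h.two_le; omega)

/-! ### The intersections `E^s ∩ G^s_{s'}` -/

lemma relSum_le_pow_mul_placements {s : ℕ} {R : Submodule k 𝕋} {e d q : ℕ} (lo : ℤ) :
    relSum s R (e + d + s + q : ℕ) lo e ≤ placements R e * 𝕃 ^ d * 𝕃 ^ q := by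
  rw [relSum_le_iff]
  intro j l h _ h2
  obtain ⟨c, rfl⟩ : ∃ c, e = j + c := ⟨e - j, by omega⟩
  obtain rfl : l = c + (d + q) := by omega
  rw [pow_add, ← mul_assoc, mul_assoc _ (𝕃 ^ d), ← pow_add]
  exact mul_le_mul_left ((mul_le_mul_left (pow_mul_le_placements R j) _).trans
    (placements_mul_pow R j c)) _

/-- This bounds `E^s ∩ G^s_s`. Shifting reduces to `p < s`. Then, with `e = p - d`, the relation
starting after `p` letters is a combination of relations starting after at most `e` letters, so it
is a relation at every place between `e` and `p`. Gluing this with the overlaps already present in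
`overlaps R q` gives `d` further overlaps. -/
lemma IsRelationSpace.inf_relSum_le {s : ℕ} {R : Submodule k 𝕋}
    (hR : IsRelationSpace Ra Rb s R) (hk : KernelTwoAt Ra Rb s R)
    (h0 : idealPiece Ra Rb 0 = ⊥) {q d : ℕ} (p : ℕ) :
    𝕃 ^ p * overlaps R q ⊓ relSum s R (p + (s + q) : ℕ) (p - s + 1) (p + -d) ≤
      TP k V ((p : ℤ) - d) * overlaps R (q + d) := by
  have small : ∀ p < s, 𝕃 ^ p * overlaps R q ⊓
      relSum s R (p + (s + q) : ℕ) (p - s + 1) (p + -d) ≤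
        TP k V ((p : ℤ) - d) * overlaps R (q + d) := by
    intro p hps
    obtain hd | hd := lt_or_ge p d
    -- The upper bound `p - d` of the sum is negative, so the sum is empty.
    · refine inf_le_right.trans (relSum_le_iff.2 ?_)
      intros
      omega
    obtain ⟨e, rfl⟩ : ∃ e, p = e + d := ⟨p - d, by omega⟩
    rw [TP_sub_of_le hd, show e + d - d = e by omega]
    rintro x ⟨h1, h2⟩
    have h3 : x ∈ placements R e * 𝕃 ^ d * 𝕃 ^ q := by
      refine relSum_le_pow_mul_placements (s := s) (((e + d : ℕ) : ℤ) - s + 1) ?_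
      have e : relSum s R (e + d + s + q : ℕ) ((e + d : ℕ) - s + 1) e =
          relSum s R (e + d + (s + q) : ℕ) ((e + d : ℕ) - s + 1) ((e + d : ℕ) + -d) := by
        congr 1 <;> (push_cast; ring)
      rw [e]
      exact h2
    have h4 : x ∈ 𝕃 ^ (e + d) * R * 𝕃 ^ q := by
      rw [mul_assoc]
      exact mem_mul_mono le_rfl (overlaps_le_left q) h1
    have h5 := mem_mul_mono (hR.pow_mul_inf_placements_le hk h0 e d hps) le_rfl
      ((mul_letters_pow_inf _ _).le ⟨h4, h3⟩)
    rw [mul_assoc] at h5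
    rw [pow_add, mul_assoc] at h1
    have h6 := mem_mul_mono le_rfl (overlaps_inf_le R d q) ((letters_pow_mul_inf _ _).le ⟨h5, h1⟩)
    rwa [add_comm d q] at h6
  obtain hp | hp := lt_or_ge p s
  · exact small p hp
  have hs := hR.two_le
  exact inf_relSum_le_of_shift (X := overlaps R q)
    (Y := fun p => TP k V ((p : ℤ) - d) * overlaps R (q + d)) (p₀ := s - 1)
    (by omega) (fun c p => by rw [← mul_assoc]; exact mul_le_mul_left (pow_mul_TP_sub_le _ _ _) _)
    (small (s - 1) (by omega)) p (by omega)

/-- The minimality condition is the case `p = 0`. In the inductive step, `x` is split into a term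
`w` divisible by a last letter and a term `t` with a relation of length `a` at the end. Exactness at
`A ⊗ J_2`, applied to the pair `(-t, x)`, shows that `x` is in `𝕃 ^ p * Rb * 𝕃` and `t` in `relPart
a Ra (p + b) * 𝕃`; then the last letter can be removed. -/
lemma RelationData.pow_mul_inf_relPart_eq_bot (h : RelationData Ra Rb a b)
    (hk : KernelTwo Ra Rb) (p : ℕ) (hp : p < a) : 𝕃 ^ p * Rb ⊓ relPart a Ra (p + b) = ⊥ := by
  induction p with
  | zero => simpa using h.inf_relPart
  | succ p ih =>
    rw [eq_bot_iff]
    rintro x ⟨hx, hx'⟩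
    have hlt := h.lt
    obtain ⟨m, hm⟩ : ∃ m, p + b = m + a := ⟨p + b - a, by omega⟩
    have key : relPart a Ra (p + 1 + b) ≤ relPart a Ra (p + b) * 𝕃 ⊔ 𝕃 ^ (m + 1) * Ra := by
      rw [show p + 1 + b = p + b + 1 by omega]
      refine relPart_succ_le le_sup_left fun j hj => ?_
      obtain rfl : j = m + 1 := by omega
      exact le_sup_right
    obtain ⟨w, hw, t, ht, rfl⟩ := Submodule.mem_sup.1 (key hx')
    have hwI : w ∈ relSubmodule Ra Rb * 𝕃 :=
      mem_mul_mono (relPart_le_relSubmodule _ _ (left_le_relSubmodule _ _) _) le_rfl hw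
    have h2 := hk (-t) (neg_mem (mem_mul_mono le_top le_rfl ht)) (w + t)
      (mem_mul_mono le_top le_rfl hx) (by simpa using hwI)
    have ht2 := h.mem_pow_mul_sup_of_mem h.left_le ht (by simpa using neg_mem h2.1)
    have hx2 := h.mem_pow_mul_sup_of_mem h.right_le hx h2.2
    -- Here `p + 1 < a` is used: the ideal has no element of degree `p + 1`.
    rw [h.idealPiece_eq_bot (by omega), Submodule.bot_mul, sup_bot_eq] at hx2
    have ht3 : t ∈ relPart a Ra (p + b) * 𝕃 := by
      have : 𝕃 ^ m * (𝕃 * Ra ⊓ Ra * 𝕃) ⊔ idealPiece Ra Rb (m + 1) * Ra ≤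
          relPart a Ra (p + b) * 𝕃 := by
        refine sup_le ?_ ?_
        · refine (mul_le_mul_right inf_le_right _).trans ?_
          rw [← mul_assoc]
          refine mul_le_mul_left ?_ _
          simpa using le_relPart (R := Ra) (s := a) (m := p + b) m 0 (by omega)
        · rw [h.idealPiece_eq_relPart (by omega)]
          refine (mul_le_mul_right h.left_le _).trans ?_
          obtain ⟨c, rfl⟩ : ∃ c, a = c + 1 := ⟨a - 1, by omega⟩
          rw [pow_succ, ← mul_assoc]
          refine mul_le_mul_left ((relPart_mul_pow_le _ _).trans_eq ?_) _
          congr 1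
          omega
      exact this ht2
    have hx3 : w + t ∈ 𝕃 ^ p * Rb * 𝕃 := by
      rw [mul_assoc]
      exact mem_mul_mono le_rfl inf_le_right hx2
    have h4 := (mul_letters_inf _ _).le ⟨hx3, add_mem hw ht3⟩
    rwa [ih (by omega), Submodule.bot_mul] at h4

/-- This says `E^b ∩ G^b_a = 0`. All the placements of `Ra` involved end within the first `p + b`
letters, so the last `q` letters can be split off, and shifting reduces to `p < a`. -/
lemma RelationData.right_inf_relSum_left_eq_bot (h : RelationData Ra Rb a b)
    (hk : KernelTwo Ra Rb) {q d : ℕ} (p : ℕ) :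
    𝕃 ^ p * overlaps Rb q ⊓ relSum a Ra (p + (b + q) : ℕ) (p - a + 1) (p + (b - d - a)) ≤ ⊥ := by
  have small : ∀ p < a, 𝕃 ^ p * overlaps Rb q ⊓
      relSum a Ra (p + (b + q) : ℕ) (p - a + 1) (p + (b - d - a)) ≤ ⊥ := by
    intro p hp
    have h1 : 𝕃 ^ p * overlaps Rb q ≤ 𝕃 ^ p * Rb * 𝕃 ^ q := by
      rw [mul_assoc]
      exact mul_le_mul_right (overlaps_le_left q) _
    have h2 : relSum a Ra (p + (b + q) : ℕ) (p - a + 1) (p + (b - d - a)) ≤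
        relPart a Ra (p + b) * 𝕃 ^ q := by
      rw [relSum_le_iff]
      intro j l h _ h2
      obtain ⟨c, rfl⟩ : ∃ c, l = c + q := ⟨l - q, by omega⟩
      rw [pow_add, ← mul_assoc]
      exact mul_le_mul_left (le_relPart j c (by omega)) _
    refine (inf_le_inf h1 h2).trans ?_
    rw [mul_letters_pow_inf, h.pow_mul_inf_relPart_eq_bot hk p hp, Submodule.bot_mul]
  obtain hp | hp := lt_or_ge p a
  · exact small p hp
  have := h.two_le
  exact inf_relSum_le_of_shift (X := overlaps Rb q) (Y := fun _ => ⊥) (p₀ := a - 1)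
    (by omega) (fun c p => by simp) (small (a - 1) (by omega)) p (by omega)

/-! ### The distributivity criterion -/

/-- The graded form of exactness at `A ⊗ J_i^s`, where `n_s(i) = s + q` and
`n_s(i - 1) = q + d`. -/
def ExactAt (Ra Rb : Submodule k (TensorAlgebra k V)) (s : ℕ)
    (R : Submodule k (TensorAlgebra k V)) (q d : ℕ) : Prop :=
  ∀ p : ℕ, 𝕃 ^ p * overlaps R q ⊓ idealPiece Ra Rb (p + (s - d)) * 𝕃 ^ (q + d) ≤
    boundaries Ra Rb R q d p

lemma iSup_fin_three {α : Type*} [CompleteLattice α] (f : Fin 3 → α) :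
    ⨆ j, f j = f 0 ⊔ f 1 ⊔ f 2 := by
  apply le_antisymm
  · refine iSup_le fun j => ?_
    fin_cases j
    · exact le_sup_of_le_left le_sup_left
    · exact le_sup_of_le_left le_sup_right
    · exact le_sup_right
  · exact sup_le (sup_le (le_iSup f 0) (le_iSup f 1)) (le_iSup f 2)

lemma isDistributive_three_iff {W : Type*} [AddCommGroup W] [Module k W]
    (E F G H : Submodule k W) :
    IsDistributive E ![F, G, H] ↔ E ⊓ (F ⊔ G ⊔ H) ≤ E ⊓ F ⊔ E ⊓ G ⊔ E ⊓ H := by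
  rw [IsDistributive, iSup_fin_three, iSup_fin_three]
  refine ⟨fun h => h.le, fun h => le_antisymm h ?_⟩
  exact sup_le (sup_le (inf_le_inf_left _ (le_sup_of_le_left le_sup_left))
    (inf_le_inf_left _ (le_sup_of_le_left le_sup_right))) (inf_le_inf_left _ le_sup_right)

lemma relSum_mul_pow_le_idealPiece {s' : ℕ} {R' : Submodule k 𝕋}
    (hR' : IsRelationSpace Ra Rb s' R') {N m r : ℕ} (h : N = m + r) {lo hi : ℤ}
    (hhi : hi + s' ≤ m) : relSum s' R' N lo hi ≤ idealPiece Ra Rb m * 𝕃 ^ r := by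
  rw [relSum_le_iff]
  intro j l hj _ h2
  obtain ⟨c, rfl⟩ : ∃ c, l = c + r := ⟨l - r, by omega⟩
  rw [pow_add, ← mul_assoc]
  refine mul_le_mul_left ((mul_le_mul_left (hR'.pow_mul_le_idealPiece j) _).trans
    ((idealPiece_mul_pow_le _ _ _ _).trans_eq ?_)) _
  congr 1
  omega

/-- The decomposition `F + G_a + G_b`: a relation of length `s'` placed at `j` lies within the first
`p` letters if `j + s' ≤ p`, and otherwise `j ≥ p - s' + 1`, which is the lower bound of the sum. -/
lemma RelationData.idealPiece_mul_pow_eq (h : RelationData Ra Rb a b) {s : ℕ} {q d p : ℕ}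
    (hd : d ≤ s) :
    idealPiece Ra Rb (p + (s - d)) * 𝕃 ^ (q + d) =
      idealPiece Ra Rb p * 𝕃 ^ (s + q) ⊔
        relSum a Ra (p + (s + q) : ℕ) (p - a + 1) (p + (s - d - a)) ⊔
        relSum b Rb (p + (s + q) : ℕ) (p - b + 1) (p + (s - d - b)) := by
  apply le_antisymm
  · have key : ∀ s' R', IsRelationSpace Ra Rb s' R' →
        relPart s' R' (p + (s - d)) * 𝕃 ^ (q + d) ≤ idealPiece Ra Rb p * 𝕃 ^ (s + q) ⊔
          relSum s' R' (p + (s + q) : ℕ) (p - s' + 1) (p + (s - d - s')) := by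
      intro s' R' hR'
      simp only [relPart, Submodule.iSup_mul]
      refine iSup_le fun j => iSup_le fun l => iSup_le fun hjl => ?_
      obtain hj | hj := le_or_gt (j + s') p
      · refine le_sup_of_le_left ?_
        obtain ⟨c, rfl⟩ : ∃ c, p = j + s' + c := ⟨p - (j + s'), by omega⟩
        rw [mul_assoc, ← pow_add, show l + (q + d) = c + (s + q) by omega, pow_add, ← mul_assoc]
        exact mul_le_mul_left ((mul_le_mul_left (hR'.pow_mul_le_idealPiece j) _).trans
          (idealPiece_mul_pow_le _ _ _ _)) _
      · refine le_sup_of_le_right ?_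
        rw [mul_assoc, ← pow_add]
        exact le_relSum j _ (by omega) (by omega) (by omega)
    rw [h.idealPiece_eq, Submodule.sup_mul]
    refine sup_le ((key _ _ h.isRelationSpace_left).trans le_sup_left)
      ((key _ _ h.isRelationSpace_right).trans ?_)
    exact sup_le (le_sup_of_le_left le_sup_left) le_sup_right
  · refine sup_le (sup_le ?_ ?_) ?_
    · rw [show s + q = s - d + (q + d) by omega, pow_add, ← mul_assoc]
      exact mul_le_mul_left (idealPiece_mul_pow_le _ _ _ _) _
    · exact relSum_mul_pow_le_idealPiece h.isRelationSpace_left (by omega) (by omega)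
    · exact relSum_mul_pow_le_idealPiece h.isRelationSpace_right (by omega) (by omega)

lemma IsRelationSpace.inf_idealPiece_mul_eq {s : ℕ} {R : Submodule k 𝕋}
    (hR : IsRelationSpace Ra Rb s R) (q p : ℕ) :
    𝕃 ^ p * overlaps R q ⊓ idealPiece Ra Rb p * 𝕃 ^ (s + q) =
      idealPiece Ra Rb p * overlaps R q := by
  rw [mul_inf_mul_of_right_le (overlaps_le_pow hR.le_pow q) le_rfl,
    inf_eq_right.2 (idealPiece_le_pow Ra Rb p), inf_eq_left.2 (overlaps_le_pow hR.le_pow q)]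

/-- The boundaries coming from `J_{i+1}` lie in `E^s ∩ G^s_s`; this is why exactness forces
distributivity. The condition `d < s` ensures that the place `p - d` is at least `p - s + 1`. -/
lemma TP_mul_overlaps_le (s : ℕ) {R : Submodule k 𝕋} {q d : ℕ} (hd : d < s)
    (p : ℕ) : TP k V ((p : ℤ) - d) * overlaps R (q + d) ≤
      𝕃 ^ p * overlaps R q ⊓ relSum s R (p + (s + q) : ℕ) (p - s + 1) (p + (s - d - s)) := by
  obtain h | h := lt_or_ge p d
  · simp [TP_sub_of_lt h]
  obtain ⟨e, rfl⟩ : ∃ e, p = e + d := ⟨p - d, by omega⟩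
  rw [TP_sub_of_le h, show e + d - d = e by omega]
  refine le_inf ?_ ?_
  · rw [pow_add, mul_assoc, add_comm q]
    exact mul_le_mul_right (overlaps_add_le R d q) _
  · refine (mul_le_mul_right (overlaps_le_left _) _).trans ?_
    rw [← mul_assoc]
    exact le_relSum e _ (by omega) (by push_cast; omega) (by push_cast; omega)

/-- Exactness at `A ⊗ J_i^s` in terms of the intersections `E^s ∩ G^s_{s'}`. -/
lemma RelationData.exact_iff (h : RelationData Ra Rb a b) {s : ℕ} {R : Submodule k 𝕋}
    (hR : IsRelationSpace Ra Rb s R)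
    (hs : s = a ∧ R = Ra ∨ s = b ∧ R = Rb) {q d : ℕ} (hd : d < s) :
    ExactAt Ra Rb s R q d ↔ ∀ p : ℕ,
      IsDistributive (𝕃 ^ p * overlaps R q) ![idealPiece Ra Rb p * 𝕃 ^ (s + q),
        relSum a Ra (p + (s + q) : ℕ) (p - a + 1) (p + (s - d - a)),
        relSum b Rb (p + (s + q) : ℕ) (p - b + 1) (p + (s - d - b))] ∧
      𝕃 ^ p * overlaps R q ⊓ relSum a Ra (p + (s + q) : ℕ) (p - a + 1) (p + (s - d - a)) ≤
        boundaries Ra Rb R q d p ∧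
      𝕃 ^ p * overlaps R q ⊓ relSum b Rb (p + (s + q) : ℕ) (p - b + 1) (p + (s - d - b)) ≤
        boundaries Ra Rb R q d p := by
  refine forall_congr' fun p => ?_
  rw [h.idealPiece_mul_pow_eq hd.le, isDistributive_three_iff, hR.inf_idealPiece_mul_eq]
  constructor
  · intro hE
    -- The two summands of `boundaries` lie in `E ∩ F` and in `E ∩ G_s` respectively, so an
    -- inclusion in `boundaries` is stronger than distributivity.
    refine ⟨hE.trans (sup_le (le_sup_of_le_left le_sup_left)
      ((TP_mul_overlaps_le s hd p).trans ?_)), (inf_le_inf_left _ ?_).trans hE,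
      (inf_le_inf_left _ le_sup_right).trans hE⟩
    · obtain ⟨rfl, rfl⟩ | ⟨rfl, rfl⟩ := hs
      · exact le_sup_of_le_left le_sup_right
      · exact le_sup_right
    · exact le_sup_of_le_left le_sup_right
  · rintro ⟨h1, h2, h3⟩
    exact h1.trans (sup_le (sup_le le_sup_left h2) h3)

lemma IsRelationSpace.inf_relSum_le_boundaries {s : ℕ} {R : Submodule k 𝕋}
    (hR : IsRelationSpace Ra Rb s R) (hk : KernelTwoAt Ra Rb s R)
    (h0 : idealPiece Ra Rb 0 = ⊥) {q d : ℕ} (p : ℕ) :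
    𝕃 ^ p * overlaps R q ⊓ relSum s R (p + (s + q) : ℕ) (p - s + 1) (p + (s - d - s)) ≤
      boundaries Ra Rb R q d p := by
  rw [show (s : ℤ) - d - s = -d by ring]
  exact (hR.inf_relSum_le hk h0 p).trans le_sup_right

/-- The missing inclusion, for `n = p + n_a(i)`. -/
def MixedInclusion (Ra Rb : Submodule k (TensorAlgebra k V)) (a b q d p : ℕ) : Prop :=
  𝕃 ^ p * overlaps Ra q ⊓ relSum b Rb (p + (a + q) : ℕ) (p - b + 1) (p + (a - d - b)) ≤
    boundaries Ra Rb Ra q d p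

/-- Of the four bounds on `E^s ∩ G^s_{s'}`, those with `s = s'` follow from
`IsRelationSpace.inf_relSum_le`, and for `(s, s') = (b, a)` the intersection vanishes. Only `(a, b)`
remains as a condition. -/
lemma RelationData.exact_iff_distributive (h : RelationData Ra Rb a b) (hk : KernelTwo Ra Rb)
    {qa da qb db : ℕ} (hda : da < a) (hdb : db < b) :
    (ExactAt Ra Rb a Ra qa da ∧ ExactAt Ra Rb b Rb qb db) ↔
      (∀ p : ℕ, IsDistributive (𝕃 ^ p * overlaps Ra qa) ![idealPiece Ra Rb p * 𝕃 ^ (a + qa),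
        relSum a Ra (p + (a + qa) : ℕ) (p - a + 1) (p + (a - da - a)),
        relSum b Rb (p + (a + qa) : ℕ) (p - b + 1) (p + (a - da - b))]) ∧
      (∀ p : ℕ, IsDistributive (𝕃 ^ p * overlaps Rb qb) ![idealPiece Ra Rb p * 𝕃 ^ (b + qb),
        relSum a Ra (p + (b + qb) : ℕ) (p - a + 1) (p + (b - db - a)),
        relSum b Rb (p + (b + qb) : ℕ) (p - b + 1) (p + (b - db - b))]) ∧
      ∀ p : ℕ, MixedInclusion Ra Rb a b qa da p := by
  rw [h.exact_iff h.isRelationSpace_left (Or.inl ⟨rfl, rfl⟩) hda,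
    h.exact_iff h.isRelationSpace_right (Or.inr ⟨rfl, rfl⟩) hdb]
  constructor
  · rintro ⟨h1, h2⟩
    exact ⟨fun p => (h1 p).1, fun p => (h2 p).1, fun p => (h1 p).2.2⟩
  · rintro ⟨h1, h2, h3⟩
    refine ⟨fun p => ⟨h1 p, ?_, h3 p⟩, fun p => ⟨h2 p, ?_, ?_⟩⟩
    · exact h.isRelationSpace_left.inf_relSum_le_boundaries (hk.left h) h.idealPiece_zero p
    · exact (h.right_inf_relSum_left_eq_bot hk p).trans bot_le
    · exact h.isRelationSpace_right.inf_relSum_le_boundaries (hk.right h) h.idealPiece_zero p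

/-- It is enough to consider shifts smaller than `b`. -/
lemma RelationData.forall_mixedInclusion_iff (h : RelationData Ra Rb a b) {q d : ℕ} :
    (∀ p, MixedInclusion Ra Rb a b q d p) ↔ ∀ p < b, MixedInclusion Ra Rb a b q d p := by
  refine ⟨fun H p _ => H p, fun H p => ?_⟩
  obtain hp | hp := lt_or_ge p b
  · exact H p hp
  have := h.two_le
  have := h.lt
  -- `b - 1` is the least shift for which the lower bound `p - b + 1` of the sum is nonnegative.
  exact inf_relSum_le_of_shift (p₀ := b - 1) (by omega)
    (fun c p => pow_mul_boundaries_le Ra q d p c) (H (b - 1) (by omega)) p (by omega)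

/-! ### Numerology -/

/-- The difference `n_s(i + 1) - n_s(i)`. -/
def gap (s i : ℕ) : ℕ := if Even i then 1 else s - 1

lemma nfun_add_two (s i : ℕ) : nfun s (i + 2) = s + nfun s i := by
  simp only [nfun, Nat.add_div_right _ two_pos, Nat.add_mod_right]
  ring

lemma nfun_succ {s : ℕ} (hs : 1 ≤ s) (i : ℕ) : nfun s (i + 1) = nfun s i + gap s i := by
  obtain ⟨s, rfl⟩ : ∃ s', s = s' + 1 := ⟨s - 1, by omega⟩
  obtain ⟨l, rfl | rfl⟩ := i.even_or_odd'
  · have h1 : (2 * l + 1) / 2 = l := by omega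
    have h2 : 2 * l / 2 = l := by omega
    have h3 : (2 * l + 1) % 2 = 1 := by omega
    have h4 : 2 * l % 2 = 0 := by omega
    simp [nfun, gap, h1, h3]
  · have h1 : (2 * l + 1) / 2 = l := by omega
    have h2 : (2 * l + 1 + 1) / 2 = l + 1 := by omega
    have h3 : (2 * l + 1) % 2 = 1 := by omega
    have h4 : (2 * l + 1 + 1) % 2 = 0 := by omega
    simp only [nfun, h1, h2, h3, h4, gap, if_neg (by simp : ¬ Even (2 * l + 1))]
    simp only [add_tsub_cancel_right]
    ring

lemma gap_add_two (s i : ℕ) : gap s (i + 2) = gap s i := by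
  simp [gap, Nat.even_add]

lemma gap_lt {s : ℕ} (hs : 2 ≤ s) (i : ℕ) : gap s i < s := by
  unfold gap
  split <;> omega

/-! ### Translation of the criterion -/

lemma J_add_two (s : ℕ) (R : Submodule k 𝕋) (j : ℕ) : J s R (j + 2) = overlaps R (nfun s j) := by
  rw [J, nfun_add_two, Jbar_eq_overlaps]

lemma J_add_three {s : ℕ} (hs : 1 ≤ s) (R : Submodule k 𝕋) (j : ℕ) :
    J s R (j + 3) = overlaps R (nfun s j + gap s j) := by
  rw [← nfun_succ hs, ← J_add_two]

lemma ESub_add_two (s : ℕ) (R : Submodule k 𝕋) (j p : ℕ) :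
    ESub s R (j + 2) (p + (s + nfun s j) : ℕ) = 𝕃 ^ p * overlaps R (nfun s j) := by
  rw [ESub, nfun_add_two, Jbar_eq_overlaps]
  congr 1
  rw [← TP_natCast]
  congr 1
  push_cast
  ring

lemma FSub_add_two (s : ℕ) (j p : ℕ) :
    FSub Ra Rb s (j + 2) (p + (s + nfun s j) : ℕ) = idealPiece Ra Rb p * 𝕃 ^ (s + nfun s j) := by
  rw [FSub, nfun_add_two, ← TP_natCast, ← relIdealPiece_natCast]
  congr 2
  push_cast
  ring

lemma GSub_add_two {s : ℕ} (hs : 1 ≤ s) (s' : ℕ) (R' : Submodule k 𝕋) (j p : ℕ) :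
    GSub s s' R' (j + 2) (p + (s + nfun s j) : ℕ) =
      relSum s' R' (p + (s + nfun s j) : ℕ) (p - s' + 1) (p + (s - gap s j - s')) := by
  rw [GSub, nfun_add_two, show j + 2 - 1 = j + 1 from rfl, nfun_succ hs]
  congr 1 <;> (push_cast; ring)

lemma isDistributive_bot {W : Type*} [AddCommGroup W] [Module k W] {t : ℕ}
    (F : Fin t → Submodule k W) : IsDistributive ⊥ F := by
  simp [IsDistributive]

/-- With `n = p + n_a(i)` the tuples match those of the exactness criterion. For `n < n_a(i)` the
space `E^a` is zero and distributivity is trivial, whence the equivalence of the two ranges of `n`.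
-/
lemma tupleADistributive_iff (ha : 1 ≤ a) (j : ℕ) :
    ((∀ n : ℕ, TupleADistributive Ra Rb a b (j + 2) n) ↔
      ∀ p : ℕ, IsDistributive (𝕃 ^ p * overlaps Ra (nfun a j))
        ![idealPiece Ra Rb p * 𝕃 ^ (a + nfun a j),
        relSum a Ra (p + (a + nfun a j) : ℕ) (p - a + 1) (p + (a - gap a j - a)),
        relSum b Rb (p + (a + nfun a j) : ℕ) (p - b + 1) (p + (a - gap a j - b))]) ∧
    ((∀ n : ℕ, nfun a (j + 2) ≤ n → TupleADistributive Ra Rb a b (j + 2) n) ↔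
      ∀ n : ℕ, TupleADistributive Ra Rb a b (j + 2) n) := by
  have key : ∀ p : ℕ, TupleADistributive Ra Rb a b (j + 2) (p + (a + nfun a j) : ℕ) ↔
      IsDistributive (𝕃 ^ p * overlaps Ra (nfun a j))
        ![idealPiece Ra Rb p * 𝕃 ^ (a + nfun a j),
        relSum a Ra (p + (a + nfun a j) : ℕ) (p - a + 1) (p + (a - gap a j - a)),
        relSum b Rb (p + (a + nfun a j) : ℕ) (p - b + 1) (p + (a - gap a j - b))] := by
    intro p
    rw [TupleADistributive, ESub_add_two, FSub_add_two, GSub_add_two ha, GSub_add_two ha]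
  have low : ∀ n : ℕ, n < nfun a (j + 2) → TupleADistributive Ra Rb a b (j + 2) n := by
    intro n hn
    rw [TupleADistributive, ESub, TP_of_neg (by omega), Submodule.bot_mul]
    exact isDistributive_bot _
  refine ⟨⟨fun H p => (key p).1 (H _), fun H n => ?_⟩, fun H n => ?_, fun H n _ => H n⟩
  · obtain hn | hn := lt_or_ge n (nfun a (j + 2))
    · exact low n hn
    · rw [nfun_add_two] at hn
      obtain ⟨p, rfl⟩ : ∃ p, n = p + (a + nfun a j) := ⟨n - (a + nfun a j), by omega⟩
      exact (key p).2 (H p)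
  · obtain hn | hn := lt_or_ge n (nfun a (j + 2))
    · exact low n hn
    · exact H n hn

lemma tupleBDistributive_iff (hb : 1 ≤ b) (j : ℕ) :
    ((∀ n : ℕ, TupleBDistributive Ra Rb a b (j + 2) n) ↔
      ∀ p : ℕ, IsDistributive (𝕃 ^ p * overlaps Rb (nfun b j))
        ![idealPiece Ra Rb p * 𝕃 ^ (b + nfun b j),
        relSum a Ra (p + (b + nfun b j) : ℕ) (p - a + 1) (p + (b - gap b j - a)),
        relSum b Rb (p + (b + nfun b j) : ℕ) (p - b + 1) (p + (b - gap b j - b))]) ∧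
    ((∀ n : ℕ, nfun b (j + 2) ≤ n → TupleBDistributive Ra Rb a b (j + 2) n) ↔
      ∀ n : ℕ, TupleBDistributive Ra Rb a b (j + 2) n) := by
  have key : ∀ p : ℕ, TupleBDistributive Ra Rb a b (j + 2) (p + (b + nfun b j) : ℕ) ↔
      IsDistributive (𝕃 ^ p * overlaps Rb (nfun b j))
        ![idealPiece Ra Rb p * 𝕃 ^ (b + nfun b j),
        relSum a Ra (p + (b + nfun b j) : ℕ) (p - a + 1) (p + (b - gap b j - a)),
        relSum b Rb (p + (b + nfun b j) : ℕ) (p - b + 1) (p + (b - gap b j - b))] := by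
    intro p
    rw [TupleBDistributive, ESub_add_two, FSub_add_two, GSub_add_two hb, GSub_add_two hb]
  have low : ∀ n : ℕ, n < nfun b (j + 2) → TupleBDistributive Ra Rb a b (j + 2) n := by
    intro n hn
    rw [TupleBDistributive, ESub, TP_of_neg (by omega), Submodule.bot_mul]
    exact isDistributive_bot _
  refine ⟨⟨fun H p => (key p).1 (H _), fun H n => ?_⟩, fun H n => ?_, fun H n _ => H n⟩
  · obtain hn | hn := lt_or_ge n (nfun b (j + 2))
    · exact low n hn
    · rw [nfun_add_two] at hn
      obtain ⟨p, rfl⟩ : ∃ p, n = p + (b + nfun b j) := ⟨n - (b + nfun b j), by omega⟩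
      exact (key p).2 (H p)
  · obtain hn | hn := lt_or_ge n (nfun b (j + 2))
    · exact low n hn
    · exact H n hn

lemma TP_mul_Jbar_eq {s : ℕ} (hs : 1 ≤ s) (R : Submodule k 𝕋) (j p : ℕ) :
    TP k V ((p + (s + nfun s j) : ℕ) - nfun s (j + 2 + 1)) * Jbar s R (nfun s (j + 2 + 1)) ⊔
      relIdealPiece Ra Rb ((p + (s + nfun s j) : ℕ) - nfun s (j + 2)) *
        Jbar s R (nfun s (j + 2)) = boundaries Ra Rb R (nfun s j) (gap s j) p := by
  have h1 : Jbar s R (nfun s (j + 2 + 1)) = overlaps R (nfun s j + gap s j) :=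
    J_add_three hs R j
  have h2 : Jbar s R (nfun s (j + 2)) = overlaps R (nfun s j) := J_add_two s R j
  rw [h1, h2, boundaries, sup_comm, ← relIdealPiece_natCast, nfun_succ hs (j + 2), gap_add_two,
    nfun_add_two]
  congr 3 <;> (push_cast; ring)

lemma relSum_mul_pow_le {s : ℕ} {R X Y : Submodule k 𝕋} {N : ℕ} {lo hi : ℤ}
    (h : ∀ j l : ℕ, j + s + l = N → lo ≤ j → j ≤ hi → 𝕃 ^ j * R * 𝕃 ^ l * Y ≤ X) :
    relSum s R N lo hi * Y ≤ X := by
  rw [Submodule.mul_le]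
  intro x hx y hy
  have : relSum s R N lo hi ≤ X.comap (LinearMap.mulRight k y) :=
    relSum_le_iff.2 fun j l hj h1 h2 z hz => h j l hj h1 h2 (Submodule.mul_mem_mul hz hy)
  exact this hx

/-- For `d = 1` the placements of `Rb` end within the first `p + a - 1` letters, so the last `q`
letters split off. As `p < b`, the lower bound `p - b + 1` is no restriction. The factor `V^{(p)} ⊗
Ra` of `XSub` costs nothing, since the left-hand space lies in `𝕃 ^ p * Ra * 𝕃 ^ q`. -/
lemma inf_relSum_eq_inf_XSub_mul (q p : ℕ) (hp : p < b) :
    𝕃 ^ p * overlaps Ra q ⊓ relSum b Rb (p + (a + q) : ℕ) (p - b + 1) (p + (a - 1 - b)) =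
      𝕃 ^ p * overlaps Ra q ⊓ XSub a b Ra Rb p * 𝕃 ^ q := by
  have h1 : relSum b Rb (p + (a + q) : ℕ) (p - b + 1) (p + (a - 1 - b)) =
      relSum b Rb (p + a : ℕ) 0 (p + a - b - 1) * 𝕃 ^ q := by
    apply le_antisymm
    · rw [relSum_le_iff]
      intro j l hj _ h2
      obtain ⟨c, rfl⟩ : ∃ c, l = c + q := ⟨l - q, by omega⟩
      rw [pow_add, ← mul_assoc]
      exact mul_le_mul_left (le_relSum j c (by omega) (by omega) (by omega)) _
    · refine relSum_mul_pow_le fun j l h h1 h2 => ?_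
      rw [mul_assoc, ← pow_add]
      exact le_relSum j _ (by omega) (by omega) (by omega)
  have h2 : 𝕃 ^ p * overlaps Ra q ≤ 𝕃 ^ p * Ra * 𝕃 ^ q := by
    rw [mul_assoc]
    exact mul_le_mul_right (overlaps_le_left q) _
  rw [h1, XSub, TP_natCast, ← mul_letters_pow_inf, ← inf_assoc, inf_eq_left.2 h2, Nat.cast_add]

lemma mixedInclusion_iff_even (ha : 1 ≤ a) (hab : a < b) {j : ℕ} (hj : Even j) :
    (∀ p < b, MixedInclusion Ra Rb a b (nfun a j) (gap a j) p) ↔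
      EvenInclusions Ra Rb a b (j + 2) := by
  have hg : gap a j = 1 := by simp [gap, hj]
  have hn : nfun a (j + 1) = nfun a j + 1 := by rw [nfun_succ ha, hg]
  have key : ∀ p < b, MixedInclusion Ra Rb a b (nfun a j) (gap a j) p ↔
      𝕃 ^ p * overlaps Ra (nfun a j) ⊓ XSub a b Ra Rb p * 𝕃 ^ nfun a j ≤
        boundaries Ra Rb Ra (nfun a j) (gap a j) p := by
    intro p hp
    rw [MixedInclusion, ← inf_relSum_eq_inf_XSub_mul _ _ hp, hg, Nat.cast_one]
  have key' : ∀ p : ℕ, ESub a Ra (j + 2) (p + (a + nfun a j) : ℕ) ⊓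
        (XSub a b Ra Rb ((p + (a + nfun a j) : ℕ) - nfun a (j + 2)) *
          TP k V (nfun a (j + 2 - 2))) =
      𝕃 ^ p * overlaps Ra (nfun a j) ⊓ XSub a b Ra Rb p * 𝕃 ^ nfun a j := by
    intro p
    rw [ESub_add_two, show j + 2 - 2 = j from rfl, TP_natCast, nfun_add_two,
      show ((p + (a + nfun a j) : ℕ) : ℤ) - (a + nfun a j : ℕ) = p by push_cast; ring]
  constructor
  · intro H n h1 h2
    rw [show j + 2 - 1 = j + 1 from rfl, hn] at h1
    rw [nfun_add_two] at h2
    obtain ⟨p, rfl⟩ : ∃ p : ℕ, n = (p + (a + nfun a j) : ℕ) :=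
      ⟨(n - (a + nfun a j)).toNat, by omega⟩
    rw [key', TP_mul_Jbar_eq ha]
    exact (key p (by omega)).1 (H p (by omega))
  · intro H p hp
    -- For `p + a ≤ b` the sum over `j ≤ p + a - 1 - b` is empty. The other shifts `p < b`
    -- correspond to the stated range of `n`.
    obtain hlt | hle := lt_or_ge (p + a) (b + 1)
    · refine inf_le_right.trans (relSum_le_iff.2 ?_)
      intros
      rw [hg] at *
      omega
    · rw [key p hp, ← key', ← TP_mul_Jbar_eq ha]
      refine H _ ?_ ?_
      · rw [show j + 2 - 1 = j + 1 from rfl, hn]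
        push_cast
        omega
      · rw [nfun_add_two]
        push_cast
        omega

/-- For `d = a - 1` the placements satisfy `j ≤ p + 1 - b`. Among the shifts `p < b` only `p = b -
1` allows one, namely `j = 0`, and this produces the single space `Rb ⊗ V^{(a-1)}`. -/
lemma mixedInclusion_iff_odd (ha : 1 ≤ a) (hab : a < b) {j : ℕ} (hj : Odd j) :
    (∀ p < b, MixedInclusion Ra Rb a b (nfun a j) (gap a j) p) ↔
      OddInclusion Ra Rb a b (j + 2) := by
  have hg : gap a j = a - 1 := by simp [gap, Nat.not_even_iff_odd.2 hj]
  have hg' : (gap a j : ℤ) = a - 1 := by rw [hg]; push_cast [ha]; ring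
  have h1 : ∀ p : ℕ, p < b - 1 → MixedInclusion Ra Rb a b (nfun a j) (gap a j) p := by
    intro p hp
    refine inf_le_right.trans (relSum_le_iff.2 ?_)
    intros
    omega
  obtain ⟨c, rfl⟩ : ∃ c, b = c + 1 := ⟨b - 1, by omega⟩
  obtain ⟨d, rfl⟩ : ∃ d, a = d + 1 := ⟨a - 1, by omega⟩
  set q := nfun (d + 1) j
  have h2 : relSum (c + 1) Rb (c + (d + 1 + q) : ℕ) (c - (c + 1 : ℕ) + 1)
      (c + ((d + 1 : ℕ) - gap (d + 1) j - (c + 1 : ℕ))) = Rb * 𝕃 ^ d * 𝕃 ^ q := by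
    rw [mul_assoc, ← pow_add]
    apply le_antisymm
    · rw [relSum_le_iff]
      intro i l h _ _
      obtain rfl : i = 0 := by omega
      obtain rfl : l = d + q := by omega
      simp
    · have := le_relSum (R := Rb) (s := c + 1) (N := c + (d + 1 + q))
        (lo := c - (c + 1 : ℕ) + 1)
        (hi := c + ((d + 1 : ℕ) - gap (d + 1) j - (c + 1 : ℕ))) 0 (d + q) (by omega)
        (by push_cast; omega) (by push_cast at hg' ⊢; omega)
      simpa using this
  have h3 : 𝕃 ^ c * overlaps Ra q ≤ 𝕃 ^ c * Ra * 𝕃 ^ q := by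
    rw [mul_assoc]
    exact mul_le_mul_right (overlaps_le_left q) _
  have h4 : MixedInclusion Ra Rb (d + 1) (c + 1) q (gap (d + 1) j) c ↔
      OddInclusion Ra Rb (d + 1) (c + 1) (j + 2) := by
    have e1 : ((c + 1 : ℕ) : ℤ) - 1 = c := by push_cast; ring
    have e2 : ((d + 1 : ℕ) : ℤ) - 1 = d := by push_cast; ring
    have e3 : Jbar (d + 1) Ra (nfun (d + 1) (j + 2)) = overlaps Ra q := J_add_two _ _ j
    have e4 : Jbar (d + 1) Ra (nfun (d + 1) (j + 2 + 1)) =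
      overlaps Ra (q + gap (d + 1) j) := J_add_three ha Ra j
    have e5 : ((c + 1 : ℕ) : ℤ) - (d + 1 : ℕ) = c - (gap (d + 1) j : ℕ) := by
      push_cast at hg' ⊢; omega
    rw [OddInclusion, e1, e2, e3, e4, e5, show j + 2 - 2 = j from rfl, MixedInclusion, h2,
      boundaries, TP_natCast, TP_natCast, TP_natCast, relIdealPiece_natCast,
      ← mul_letters_pow_inf, ← inf_assoc, inf_eq_left.2 h3, sup_comm]
  rw [← h4]
  refine ⟨fun H => H c (by omega), fun H p hp => ?_⟩
  obtain hp' | rfl : p < c ∨ p = c := by omega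
  · exact h1 p (by omega)
  · exact H

/-- The combinatorial half of the criterion. -/
theorem RelationData.exact_iff_criterion (h : RelationData Ra Rb a b) (hk : KernelTwo Ra Rb)
    (j : ℕ) :
    ((ExactAt Ra Rb a Ra (nfun a j) (gap a j) ∧ ExactAt Ra Rb b Rb (nfun b j) (gap b j)) ↔
      (∀ n : ℕ, TupleADistributive Ra Rb a b (j + 2) n) ∧
      (∀ n : ℕ, TupleBDistributive Ra Rb a b (j + 2) n) ∧
      (Even (j + 2) → EvenInclusions Ra Rb a b (j + 2)) ∧
      (Odd (j + 2) → OddInclusion Ra Rb a b (j + 2))) := by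
  have ha := h.two_le
  have hb := ha.trans h.lt.le
  rw [h.exact_iff_distributive hk (gap_lt ha j) (gap_lt hb j),
    (tupleADistributive_iff (by omega) j).1, (tupleBDistributive_iff (by omega) j).1,
    h.forall_mixedInclusion_iff]
  refine and_congr_right fun _ => and_congr_right fun _ => ?_
  obtain hj | hj := j.even_or_odd
  · have h1 : Even (j + 2) := by simpa [Nat.even_add] using hj
    rw [mixedInclusion_iff_even (by omega) h.lt hj]
    simp [h1, Nat.not_odd_iff_even.2 h1]
  · have h1 : Odd (j + 2) := by simpa [Nat.odd_add] using hj
    rw [mixedInclusion_iff_odd (by omega) h.lt hj]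
    simp [h1, Nat.not_even_iff_odd.2 h1]

end MultiKoszul
end

noncomputable section
namespace MultiKoszul

/-! ### Graded modules generated in two degrees -/

section GradedModule

variable {k A M : Type*} [Field k] [Ring A] [Algebra k A] [AddCommGroup M] [Module k M] [Module A M]
  [IsScalarTower k A M]

/-- `ℳ` is a grading of a module over the connected graded algebra `⨁ₘ 𝒜 m`. -/
structure IsGradedAction (𝒜 : ℤ → Submodule k A) (ℳ : ℤ → Submodule k M) : Prop where
  neg : ∀ m < 0, 𝒜 m = ⊥
  zero : ∀ x ∈ 𝒜 0, ∃ c : k, x = algebraMap k A c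
  one_mem : 1 ∈ 𝒜 0
  iSup_eq_top : ⨆ m, 𝒜 m = ⊤
  mul_mem : ∀ m n, ∀ x ∈ 𝒜 m, ∀ y ∈ 𝒜 n, x * y ∈ 𝒜 (m + n)
  smul_mem : ∀ m n, ∀ x ∈ 𝒜 m, ∀ y ∈ ℳ n, x • y ∈ ℳ (m + n)
  -- That the components span the module is not required: it follows whenever the module is
  -- generated by homogeneous subspaces.
  indep : iSupIndep ℳ

lemma mem_of_mem_iSup_of_iSupIndep {ℳ B : ℤ → Submodule k M} (h : iSupIndep ℳ)
    (hB : ∀ n, B n ≤ ℳ n) {n : ℤ} {x : M} (hx : x ∈ ℳ n) (hx' : x ∈ ⨆ n, B n) : x ∈ B n := by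
  rw [iSup_split_single B n] at hx'
  obtain ⟨y, hy, z, hz, rfl⟩ := Submodule.mem_sup.1 hx'
  have h1 : z ∈ ℳ n := by simpa using sub_mem hx (hB n hy)
  have h2 : z ∈ ⨆ m, ⨆ _ : m ≠ n, ℳ m := (iSup₂_mono fun m _ => hB m) hz
  rw [(Submodule.disjoint_def.1 (h n)) z h1 h2, add_zero]
  exact hy

/-- The component of degree `n` of the submodule generated by a subspace `Q` of degree `l`. -/
def generated (𝒜 : ℤ → Submodule k A) (Q : Submodule k M) (l n : ℤ) : Submodule k M :=
  Submodule.map₂ (Algebra.lsmul k k M).toLinearMap (𝒜 (n - l)) Q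

lemma smul_mem_generated {𝒜 : ℤ → Submodule k A} {Q : Submodule k M} {l n : ℤ} {α : A} {x : M}
    (hα : α ∈ 𝒜 (n - l)) (hx : x ∈ Q) : α • x ∈ generated 𝒜 Q l n :=
  Submodule.apply_mem_map₂ _ hα hx

lemma generated_le_iff {𝒜 : ℤ → Submodule k A} {Q X : Submodule k M} {l n : ℤ} :
    generated 𝒜 Q l n ≤ X ↔ ∀ α ∈ 𝒜 (n - l), ∀ x ∈ Q, α • x ∈ X :=
  Submodule.map₂_le

lemma generated_le_span (𝒜 : ℤ → Submodule k A) (Q : Submodule k M) (l n : ℤ) :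
    generated 𝒜 Q l n ≤ (Submodule.span A (Q : Set M)).restrictScalars k :=
  generated_le_iff.2 fun α _ _ hx =>
    (Submodule.span A (Q : Set M)).smul_mem α (Submodule.subset_span hx)

/-- The part of positive degree of the submodule generated by a subspace `Q` of degree `l`. -/
def generatedPos (𝒜 : ℤ → Submodule k A) (Q : Submodule k M) (l n : ℤ) : Submodule k M :=
  if l < n then generated 𝒜 Q l n else ⊥

lemma generatedPos_le (𝒜 : ℤ → Submodule k A) (Q : Submodule k M) (l n : ℤ) :
    generatedPos 𝒜 Q l n ≤ generated 𝒜 Q l n := by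
  unfold generatedPos
  split_ifs
  · exact le_rfl
  · exact bot_le

lemma generatedPos_le_irrelevantSMul (𝒜 : ℤ → Submodule k A) (Q : Submodule k M) (l n : ℤ) :
    generatedPos 𝒜 Q l n ≤ (irrelevantSMul M 𝒜).restrictScalars k := by
  unfold generatedPos
  split_ifs with h
  · exact generated_le_iff.2 fun α hα x _ =>
      Submodule.subset_span ⟨n - l, by omega, α, hα, x, rfl⟩
  · exact bot_le

namespace IsGradedAction

variable {𝒜 : ℤ → Submodule k A} {ℳ : ℤ → Submodule k M}

lemma smul_mem_iSup (h : IsGradedAction 𝒜 ℳ) {B : ℤ → Submodule k M}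
    (hB : ∀ p n, 0 ≤ p → ∀ α ∈ 𝒜 p, ∀ x ∈ B n, α • x ∈ B (p + n)) (α : A) {x : M}
    (hx : x ∈ ⨆ n, B n) : α • x ∈ ⨆ n, B n := by
  have hα : α ∈ ⨆ m, 𝒜 m := by rw [h.iSup_eq_top]; trivial
  induction hα using Submodule.iSup_induction' with
  | mem p α hα =>
    obtain hp | hp := lt_or_ge p 0
    · rw [h.neg p hp, Submodule.mem_bot] at hα
      simp [hα]
    induction hx using Submodule.iSup_induction' with
    | mem n x hx => exact Submodule.mem_iSup_of_mem _ (hB p n hp α hα x hx)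
    | zero => simp
    | add x y _ _ hx hy => rw [smul_add]; exact add_mem hx hy
  | zero => simp
  | add α β _ _ hα hβ => rw [add_smul]; exact add_mem hα hβ

lemma smul_mem_generated_add (h : IsGradedAction 𝒜 ℳ) {Q : Submodule k M} {l n p : ℤ} {α : A}
    (hα : α ∈ 𝒜 p) {x : M}
    (hx : x ∈ generated 𝒜 Q l n) : α • x ∈ generated 𝒜 Q l (p + n) := by
  have : generated 𝒜 Q l n ≤ (generated 𝒜 Q l (p + n)).comap (Algebra.lsmul k k M α) := by
    refine generated_le_iff.2 fun β hβ x hx => ?_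
    have h1 := h.mul_mem p (n - l) α hα β hβ
    rw [← add_sub_assoc] at h1
    have h2 := smul_mem_generated h1 hx
    rw [mul_smul] at h2
    exact h2
  exact this hx

lemma generated_of_lt (h : IsGradedAction 𝒜 ℳ) {Q : Submodule k M} {l n : ℤ} (hn : n < l) :
    generated 𝒜 Q l n = ⊥ := by
  rw [generated, h.neg _ (by omega), Submodule.map₂_bot_left]

lemma generated_self (h : IsGradedAction 𝒜 ℳ) (Q : Submodule k M) (l : ℤ) :
    generated 𝒜 Q l l = Q := by
  apply le_antisymm
  · refine generated_le_iff.2 fun α hα x hx => ?_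
    rw [sub_self] at hα
    obtain ⟨c, rfl⟩ := h.zero α hα
    rw [algebraMap_smul]
    exact Q.smul_mem c hx
  · intro x hx
    rw [← one_smul A x]
    exact smul_mem_generated (by rw [sub_self]; exact h.one_mem) hx

lemma generated_le (h : IsGradedAction 𝒜 ℳ) {Q : Submodule k M} {l : ℤ} (hQ : Q ≤ ℳ l) (n : ℤ) :
    generated 𝒜 Q l n ≤ ℳ n := by
  refine generated_le_iff.2 fun α hα x hx => ?_
  simpa using h.smul_mem _ _ α hα x (hQ hx)

lemma smul_mem_generatedPos (h : IsGradedAction 𝒜 ℳ) {Q : Submodule k M} {l n p : ℤ} (hp : 0 ≤ p)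
    {α : A} (hα : α ∈ 𝒜 p)
    {x : M} (hx : x ∈ generatedPos 𝒜 Q l n) : α • x ∈ generatedPos 𝒜 Q l (p + n) := by
  unfold generatedPos at hx ⊢
  split_ifs at hx with h1
  · rw [if_pos (by omega)]
    exact h.smul_mem_generated_add hα hx
  · rw [(Submodule.mem_bot k).1 hx, smul_zero]
    exact zero_mem _

lemma smul_mem_generatedPos_of_pos (h : IsGradedAction 𝒜 ℳ) {Q : Submodule k M} {l n p : ℤ}
    (hp : 0 < p) {α : A}
    (hα : α ∈ 𝒜 p) {x : M} (hx : x ∈ generated 𝒜 Q l n) :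
    α • x ∈ generatedPos 𝒜 Q l (p + n) := by
  obtain hn | hn := lt_or_ge n l
  · rw [h.generated_of_lt hn, Submodule.mem_bot] at hx
    simp [hx]
  · rw [generatedPos, if_pos (by omega)]
    exact h.smul_mem_generated_add hα hx

lemma span_le_iSup_generated (h : IsGradedAction 𝒜 ℳ) (Q : Submodule k M) (l : ℤ) :
    (Submodule.span A (Q : Set M)).restrictScalars k ≤ ⨆ n, generated 𝒜 Q l n := by
  intro x hx
  rw [Submodule.restrictScalars_mem] at hx
  induction hx using Submodule.span_induction with
  | mem x hx => exact Submodule.mem_iSup_of_mem l (by rw [h.generated_self]; exact hx)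
  | zero => exact zero_mem _
  | add x y _ _ hx hy => exact add_mem hx hy
  | smul α x _ hx =>
    exact h.smul_mem_iSup (fun p n _ β hβ x hx => h.smul_mem_generated_add hβ hx) α hx

variable {Q₀ Q₁ : Submodule k M} {l₀ l₁ : ℤ}

lemma mem_iSup_generated (h : IsGradedAction 𝒜 ℳ)
    (htop : Submodule.span A (Q₀ : Set M) ⊔ Submodule.span A (Q₁ : Set M) = ⊤) (x : M) :
    x ∈ ⨆ n, (generated 𝒜 Q₀ l₀ n ⊔ generated 𝒜 Q₁ l₁ n) := by
  have hx : x ∈ Submodule.span A (Q₀ : Set M) ⊔ Submodule.span A (Q₁ : Set M) := by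
    rw [htop]; trivial
  obtain ⟨y, hy, z, hz, rfl⟩ := Submodule.mem_sup.1 hx
  rw [iSup_sup_eq]
  exact add_mem (Submodule.mem_sup_left (h.span_le_iSup_generated Q₀ l₀ hy))
    (Submodule.mem_sup_right (h.span_le_iSup_generated Q₁ l₁ hz))

lemma irrelevantSMul_le (h : IsGradedAction 𝒜 ℳ)
    (htop : Submodule.span A (Q₀ : Set M) ⊔ Submodule.span A (Q₁ : Set M) = ⊤) :
    (irrelevantSMul M 𝒜).restrictScalars k ≤
      ⨆ n, (generatedPos 𝒜 Q₀ l₀ n ⊔ generatedPos 𝒜 Q₁ l₁ n) := by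
  intro x hx
  rw [Submodule.restrictScalars_mem] at hx
  induction hx using Submodule.span_induction with
  | mem x hx =>
    obtain ⟨m, hm, α, hα, y, rfl⟩ := hx
    have hy := h.mem_iSup_generated (l₀ := l₀) (l₁ := l₁) htop y
    induction hy using Submodule.iSup_induction' with
    | mem n y hy =>
      obtain ⟨u, hu, v, hv, rfl⟩ := Submodule.mem_sup.1 hy
      rw [smul_add]
      exact Submodule.mem_iSup_of_mem (m + n) (add_mem
        (Submodule.mem_sup_left (h.smul_mem_generatedPos_of_pos hm hα hu))
        (Submodule.mem_sup_right (h.smul_mem_generatedPos_of_pos hm hα hv)))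
    | zero => simp
    | add y z _ _ hy hz => rw [smul_add]; exact add_mem hy hz
  | zero => exact zero_mem _
  | add x y _ _ hx hy => exact add_mem hx hy
  | smul α x _ hx =>
    refine h.smul_mem_iSup (fun p n hp β hβ x hx => ?_) α hx
    obtain ⟨u, hu, v, hv, rfl⟩ := Submodule.mem_sup.1 hx
    rw [smul_add]
    exact add_mem (Submodule.mem_sup_left (h.smul_mem_generatedPos hp hβ hu))
        (Submodule.mem_sup_right (h.smul_mem_generatedPos hp hβ hv))

/-- The elements of degree `n` of `A_{>0} • M`. -/
lemma mem_generatedPos_of_mem_irrelevantSMul (h : IsGradedAction 𝒜 ℳ)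
    (htop : Submodule.span A (Q₀ : Set M) ⊔ Submodule.span A (Q₁ : Set M) = ⊤)
    (h₀ : Q₀ ≤ ℳ l₀) (h₁ : Q₁ ≤ ℳ l₁) {n : ℤ} {x : M} (hx : x ∈ ℳ n)
    (hx' : x ∈ irrelevantSMul M 𝒜) :
    x ∈ generatedPos 𝒜 Q₀ l₀ n ⊔ generatedPos 𝒜 Q₁ l₁ n :=
  mem_of_mem_iSup_of_iSupIndep h.indep
    (fun n => sup_le ((generatedPos_le _ _ _ _).trans (h.generated_le h₀ n))
      ((generatedPos_le _ _ _ _).trans (h.generated_le h₁ n))) hx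
    (h.irrelevantSMul_le htop hx')

lemma eq_zero_of_mem_irrelevantSMul_of_mem_lowest (h : IsGradedAction 𝒜 ℳ)
    (htop : Submodule.span A (Q₀ : Set M) ⊔ Submodule.span A (Q₁ : Set M) = ⊤)
    (h₀ : Q₀ ≤ ℳ l₀) (h₁ : Q₁ ≤ ℳ l₁) (hl : l₀ < l₁) {x : M} (hx : x ∈ ℳ l₀)
    (hx' : x ∈ irrelevantSMul M 𝒜) : x = 0 := by
  have := h.mem_generatedPos_of_mem_irrelevantSMul htop h₀ h₁ hx hx'
  simpa [generatedPos, hl.le] using this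

/-- In degree `l₁` the generators `Q₁` contribute to `A_{>0} • M` nothing of positive degree, so
only multiples of `Q₀` remain. -/
lemma mem_span_of_mem_irrelevantSMul (h : IsGradedAction 𝒜 ℳ)
    (htop : Submodule.span A (Q₀ : Set M) ⊔ Submodule.span A (Q₁ : Set M) = ⊤)
    (h₀ : Q₀ ≤ ℳ l₀) (h₁ : Q₁ ≤ ℳ l₁) {x : M} (hx : x ∈ ℳ l₁)
    (hx' : x ∈ irrelevantSMul M 𝒜) : x ∈ Submodule.span A (Q₀ : Set M) := by
  have := h.mem_generatedPos_of_mem_irrelevantSMul htop h₀ h₁ hx hx'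
  have h2 : generatedPos 𝒜 Q₁ l₁ l₁ = ⊥ := by simp [generatedPos]
  rw [h2, sup_bot_eq] at this
  exact generated_le_span _ _ _ _ (generatedPos_le _ _ _ _ this)

end IsGradedAction

/-! ### Purity in two degrees and comparison of generators -/

lemma isPure_two_iff {ℳ : ℤ → Submodule k M} {l₀ l₁ : ℤ} :
    IsPure (A := A) ℳ ![l₀, l₁] ↔ l₀ < l₁ ∧ ∃ Q₀ Q₁ : Submodule k M, Q₀ ≤ ℳ l₀ ∧ Q₁ ≤ ℳ l₁ ∧
      Submodule.span A (Q₀ : Set M) ⊔ Submodule.span A (Q₁ : Set M) = ⊤ ∧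
      Q₁ ⊓ (Submodule.span A (Q₀ : Set M)).restrictScalars k = ⊥ := by
  have e : ∀ N : Fin 2 → Submodule k M, (⨆ j, ⨆ _ : j < (1 : Fin 2),
      Submodule.span A (N j : Set M)) = Submodule.span A (N 0 : Set M) := by
    intro N
    apply le_antisymm
    · refine iSup₂_le fun j hj => ?_
      obtain rfl : j = 0 := by omega
      exact le_rfl
    · exact le_iSup₂_of_le 0 (by decide) le_rfl
  have e' : ∀ N : Fin 2 → Submodule k M, (⨆ j, Submodule.span A (N j : Set M)) =
      Submodule.span A (N 0 : Set M) ⊔ Submodule.span A (N 1 : Set M) := by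
    intro N
    apply le_antisymm
    · refine iSup_le fun j => ?_
      fin_cases j
      · exact le_sup_left
      · exact le_sup_right
    · exact sup_le (le_iSup (fun j => Submodule.span A (N j : Set M)) 0)
        (le_iSup (fun j => Submodule.span A (N j : Set M)) 1)
  constructor
  · rintro ⟨hl, N, h1, h2, h3⟩
    refine ⟨hl (by decide : (0 : Fin 2) < 1), N 0, N 1, h1 0, h1 1, by rw [← e', h2], ?_⟩
    rw [← e]
    exact h3 1
  · rintro ⟨hl, Q₀, Q₁, h0, h1, h2, h3⟩
    refine ⟨?_, ![Q₀, Q₁], ?_, by rw [e']; exact h2, ?_⟩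
    · intro i j hij
      fin_cases i <;> fin_cases j <;> simp_all
    · intro i
      fin_cases i
      · exact h0
      · exact h1
    · intro i
      fin_cases i
      · simp
      · change Q₁ ⊓ _ = _
        erw [e]
        exact h3

/-- If a pure module and its subspaces `Q₀`, `Q₁` have the same size in the degrees of the
generators, then these subspaces generate the module. -/
theorem IsGradedAction.span_eq_top_of_isPure {𝒜 : ℤ → Submodule k A} {ℳ : ℤ → Submodule k M}
    (h : IsGradedAction 𝒜 ℳ) {Q₀ Q₁ : Submodule k M} {l₀ l₁ : ℤ}
    (hpure : IsPure (A := A) ℳ ![l₀, l₁]) (h₀ : Q₀ ≤ ℳ l₀) (h₁ : Q₁ ≤ ℳ l₁)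
    (hQ : Q₁ ⊓ (Submodule.span A (Q₀ : Set M)).restrictScalars k = ⊥)
    [Module.Finite k (Coinv M 𝒜)]
    (hd₀ : Module.finrank k (coinvGrading 𝒜 ℳ l₀) = Module.finrank k Q₀)
    (hd₁ : Module.finrank k (coinvGrading 𝒜 ℳ l₁) = Module.finrank k Q₁) :
    Submodule.span A (Q₀ : Set M) ⊔ Submodule.span A (Q₁ : Set M) = ⊤ := by
  obtain ⟨hl, N₀, N₁, hN₀, hN₁, htop, -⟩ := isPure_two_iff.1 hpure
  set c : M →ₗ[k] Coinv M 𝒜 := (irrelevantSMul M 𝒜).mkQ.restrictScalars k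
  have hc : ∀ x, c x = 0 ↔ x ∈ irrelevantSMul M 𝒜 := fun x =>
    Submodule.Quotient.mk_eq_zero _
  have hinj₀ : Function.Injective (c.domRestrict (ℳ l₀)) := by
    rw [← LinearMap.ker_eq_bot, LinearMap.ker_eq_bot']
    rintro ⟨x, hx⟩ hcx
    exact Subtype.ext (h.eq_zero_of_mem_irrelevantSMul_of_mem_lowest htop hN₀ hN₁ hl hx
      ((hc x).1 hcx))
  have hfin : Module.Finite k (ℳ l₀) := Module.Finite.of_injective _ hinj₀
  -- In the lowest degree `k ⊗_A M` and `M` agree, so equal dimensions force `Q₀` to be everything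
  -- there.
  have e₀ : Q₀ = ℳ l₀ := by
    refine Submodule.eq_of_le_of_finrank_eq h₀ ?_
    rw [← hd₀, ← LinearMap.finrank_range_of_inj hinj₀, LinearMap.range_domRestrict]
    rfl
  have hNQ : Submodule.span A (N₀ : Set M) ≤ Submodule.span A (Q₀ : Set M) :=
    Submodule.span_mono (by rw [e₀]; exact hN₀)
  have hinj₁ : Function.Injective (c.domRestrict Q₁) := by
    rw [← LinearMap.ker_eq_bot, LinearMap.ker_eq_bot']
    rintro ⟨x, hx⟩ hcx
    have h1 := hNQ (h.mem_span_of_mem_irrelevantSMul htop hN₀ hN₁ (h₁ hx) ((hc x).1 hcx))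
    have h2 : x ∈ Q₁ ⊓ (Submodule.span A (Q₀ : Set M)).restrictScalars k := ⟨hx, h1⟩
    rw [hQ] at h2
    exact Subtype.ext ((Submodule.mem_bot k).1 h2)
  -- `c` is injective on `Q₁` because its kernel in degree `l₁` lies in the submodule generated by
  -- `Q₀`. Counting dimensions, `Q₁` represents all of `k ⊗_A M` in degree `l₁`, so `N₁` lies in
  -- `Q₁` plus that submodule.
  have e₁ : Q₁.map c = coinvGrading 𝒜 ℳ l₁ := by
    refine Submodule.eq_of_le_of_finrank_eq (Submodule.map_mono h₁) ?_
    rw [hd₁, ← LinearMap.finrank_range_of_inj hinj₁, LinearMap.range_domRestrict]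
  have hN : (N₁ : Set M) ⊆ (Submodule.span A (Q₀ : Set M) ⊔ Submodule.span A (Q₁ : Set M) :
      Submodule A M) := by
    intro x hx
    have h1 : c x ∈ Q₁.map c := by
      rw [e₁]
      exact Submodule.mem_map_of_mem (hN₁ hx)
    obtain ⟨y, hy, hxy⟩ := h1
    have h2 : x - y ∈ irrelevantSMul M 𝒜 := by
      rw [← hc, map_sub, hxy, sub_self]
    have h3 := hNQ (h.mem_span_of_mem_irrelevantSMul htop hN₀ hN₁
      (sub_mem (hN₁ hx) (h₁ hy)) h2)
    have h4 := add_mem (Submodule.mem_sup_left h3)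
      (Submodule.mem_sup_right (Submodule.subset_span hy : y ∈ Submodule.span A (Q₁ : Set M)))
    simpa using h4
  rw [eq_top_iff, ← htop]
  exact sup_le (hNQ.trans le_sup_left) (Submodule.span_le.2 hN)

/-- A module generated by independent subspaces of two different degrees is pure. -/
theorem IsGradedAction.isPure_of_span_eq_top {𝒜 : ℤ → Submodule k A} {ℳ : ℤ → Submodule k M}
    (h : IsGradedAction 𝒜 ℳ) {l₀ l₁ : ℤ} (hl : l₀ < l₁) {J₀ J₁ : Type*} [AddCommGroup J₀]
    [Module k J₀] [AddCommGroup J₁] [Module k J₁] (φ₀ : J₀ →ₗ[k] M) (φ₁ : J₁ →ₗ[k] M)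
    (hφ₀ : Function.Injective φ₀) (hφ₁ : Function.Injective φ₁)
    (h₀ : LinearMap.range φ₀ ≤ ℳ l₀) (h₁ : LinearMap.range φ₁ ≤ ℳ l₁)
    (hQ : LinearMap.range φ₁ ⊓
      (Submodule.span A (LinearMap.range φ₀ : Set M)).restrictScalars k = ⊥)
    (htop : Submodule.span A (LinearMap.range φ₀ : Set M) ⊔
      Submodule.span A (LinearMap.range φ₁ : Set M) = ⊤)
    {G : ℤ → Submodule k (J₀ × J₁)} (hG₀ : G l₀ = Submodule.prod ⊤ ⊥)
    (hG₁ : G l₁ = Submodule.prod ⊥ ⊤) (hG : ∀ n, n ≠ l₀ → n ≠ l₁ → G n = ⊥) :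
    IsPure (A := A) ℳ ![l₀, l₁] ∧ ∃ e : Coinv M 𝒜 ≃ₗ[k] J₀ × J₁,
      ∀ n, (coinvGrading 𝒜 ℳ n).map e.toLinearMap = G n := by
  refine ⟨isPure_two_iff.2 ⟨hl, _, _, h₀, h₁, htop, hQ⟩, ?_⟩
  set c : M →ₗ[k] Coinv M 𝒜 := (irrelevantSMul M 𝒜).mkQ.restrictScalars k
  have hc : ∀ x, c x = 0 ↔ x ∈ irrelevantSMul M 𝒜 := fun x =>
    Submodule.Quotient.mk_eq_zero _
  have hcpos : ∀ Q l n, ∀ x ∈ generatedPos 𝒜 Q l n, c x = 0 := fun Q l n x hx =>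
    (hc x).2 (generatedPos_le_irrelevantSMul 𝒜 Q l n hx)
  have hℳ : ∀ n, ∀ x ∈ ℳ n, x ∈ generated 𝒜 (LinearMap.range φ₀) l₀ n ⊔
      generated 𝒜 (LinearMap.range φ₁) l₁ n := fun n x hx =>
    mem_of_mem_iSup_of_iSupIndep h.indep
      (fun n => sup_le (h.generated_le h₀ n) (h.generated_le h₁ n)) hx (h.mem_iSup_generated htop x)
  have hne : ∀ Q l n, n ≠ l → ∀ x ∈ generated 𝒜 Q l n, c x = 0 := by
    intro Q l n hn x hx
    obtain hlt | hgt := lt_or_gt_of_ne hn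
    · rw [h.generated_of_lt hlt, Submodule.mem_bot] at hx
      rw [hx, map_zero]
    · refine hcpos Q l n x ?_
      rwa [generatedPos, if_pos hgt]
  set f : J₀ × J₁ →ₗ[k] Coinv M 𝒜 := c ∘ₗ φ₀.coprod φ₁
  have hgr : ∀ n, coinvGrading 𝒜 ℳ n = (G n).map f := by
    intro n
    apply le_antisymm
    · rintro _ ⟨x, hx, rfl⟩
      obtain ⟨y, hy, z, hz, rfl⟩ := Submodule.mem_sup.1 (hℳ n x hx)
      change c (y + z) ∈ _
      rw [map_add]
      obtain rfl | hn₀ := eq_or_ne n l₀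
      · rw [h.generated_self] at hy
        obtain ⟨u, rfl⟩ := hy
        rw [hne _ _ _ hl.ne z hz, add_zero]
        exact ⟨(u, 0), by simp [hG₀], by simp [f]⟩
      · rw [hne _ _ _ hn₀ y hy, zero_add]
        obtain rfl | hn₁ := eq_or_ne n l₁
        · rw [h.generated_self] at hz
          obtain ⟨u, rfl⟩ := hz
          exact ⟨(0, u), by simp [hG₁], by simp [f]⟩
        · rw [hne _ _ _ hn₁ z hz]
          exact zero_mem _
    · rintro _ ⟨⟨u, v⟩, huv, rfl⟩
      obtain rfl | hn₀ := eq_or_ne n l₀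
      · rw [hG₀] at huv
        obtain rfl : v = 0 := by simpa using huv
        exact ⟨φ₀ u, h₀ ⟨u, rfl⟩, by simp [f, c]⟩
      · obtain rfl | hn₁ := eq_or_ne n l₁
        · rw [hG₁] at huv
          obtain rfl : u = 0 := by simpa using huv
          exact ⟨φ₁ v, h₁ ⟨v, rfl⟩, by simp [f, c]⟩
        · rw [hG n hn₀ hn₁] at huv
          rw [(Submodule.mem_bot k).1 huv, map_zero]
          exact zero_mem _
  have hinj : Function.Injective f := by
    rw [← LinearMap.ker_eq_bot, LinearMap.ker_eq_bot']
    rintro ⟨u, v⟩ huv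
    have h1 : φ₀ u + φ₁ v ∈ irrelevantSMul M 𝒜 := by
      rw [← hc]
      simpa [f] using huv
    -- Isolates the component of degree `l₀`, where neither positive multiples of `range φ₀` nor
    -- multiples of `range φ₁` occur; hence `φ₀ u = 0`. Then `φ₁ v` lies in the submodule generated
    -- by `range φ₀`, so it vanishes by `hQ`.
    have h2 : φ₀ u ∈ ⨆ n, (generatedPos 𝒜 (LinearMap.range φ₀) l₀ n ⊔
        generated 𝒜 (LinearMap.range φ₁) l₁ n) := by
      rw [← add_sub_cancel_right (φ₀ u) (φ₁ v)]
      refine sub_mem ((iSup_mono fun n => sup_le_sup_left (generatedPos_le _ _ _ _) _ :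
        (⨆ n, (generatedPos 𝒜 (LinearMap.range φ₀) l₀ n ⊔
          generatedPos 𝒜 (LinearMap.range φ₁) l₁ n)) ≤ _) (h.irrelevantSMul_le htop h1)) ?_
      exact Submodule.mem_iSup_of_mem l₁ (Submodule.mem_sup_right
        (by rw [h.generated_self]; exact ⟨v, rfl⟩))
    have h3 := mem_of_mem_iSup_of_iSupIndep h.indep
      (fun n => sup_le ((generatedPos_le _ _ _ _).trans (h.generated_le h₀ n))
        (h.generated_le h₁ n)) (h₀ ⟨u, rfl⟩) h2
    rw [h.generated_of_lt hl, generatedPos, if_neg (lt_irrefl _), sup_bot_eq,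
      Submodule.mem_bot] at h3
    rw [h3, zero_add] at h1
    have h4 : φ₁ v ∈ LinearMap.range φ₁ ⊓
        (Submodule.span A (LinearMap.range φ₀ : Set M)).restrictScalars k :=
      ⟨⟨v, rfl⟩, h.mem_span_of_mem_irrelevantSMul htop h₀ h₁ (h₁ ⟨v, rfl⟩) h1⟩
    rw [hQ, Submodule.mem_bot] at h4
    exact Prod.ext (hφ₀ (by rw [h3]; simp)) (hφ₁ (by rw [h4]; simp))
  have hsurj : Function.Surjective f := by
    intro x
    obtain ⟨x, rfl⟩ := Submodule.Quotient.mk_surjective _ x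
    change c x ∈ LinearMap.range f
    have h1 := h.mem_iSup_generated (l₀ := l₀) (l₁ := l₁) htop x
    induction h1 using Submodule.iSup_induction' with
    | mem n x hx =>
      have h2 : c x ∈ coinvGrading 𝒜 ℳ n := Submodule.mem_map_of_mem
        (sup_le (h.generated_le h₀ n) (h.generated_le h₁ n) hx)
      rw [hgr] at h2
      exact LinearMap.map_le_range h2
    | zero => rw [map_zero]; exact zero_mem _
    | add x y _ _ hx hy => rw [map_add]; exact add_mem hx hy
  refine ⟨(LinearEquiv.ofBijective f ⟨hinj, hsurj⟩).symm, fun n => ?_⟩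
  rw [hgr]
  rw [← Submodule.map_comp]
  have : (LinearEquiv.ofBijective f ⟨hinj, hsurj⟩).symm.toLinearMap ∘ₗ f = LinearMap.id :=
    LinearMap.ext fun x => (LinearEquiv.ofBijective f ⟨hinj, hsurj⟩).symm_apply_apply x
  rw [this, Submodule.map_id]

end GradedModule
end MultiKoszul
end

noncomputable section
namespace MultiKoszul
variable {k V : Type*} [Field k] [AddCommGroup V] [Module k V]
local notation "𝕋" => TensorAlgebra k V
local notation "𝕃" => letters k V

/-! ### Representing elements of `A ⊗ J` by tensors -/

/-- A linear retraction onto a subspace. -/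
def retraction (J : Submodule k (TensorAlgebra k V)) : TensorAlgebra k V →ₗ[k] J :=
  Classical.choose (J.subtype.exists_leftInverse_of_injective J.ker_subtype)

lemma retraction_apply {J : Submodule k 𝕋} {x : 𝕋} (hx : x ∈ J) : retraction J x = ⟨x, hx⟩ :=
  LinearMap.congr_fun
    (Classical.choose_spec (J.subtype.exists_leftInverse_of_injective J.ker_subtype)) ⟨x, hx⟩

variable (Ra Rb : Submodule k (TensorAlgebra k V))

lemma proj_eq_zero_iff {x : 𝕋} : proj Ra Rb x = 0 ↔ x ∈ relSubmodule Ra Rb :=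
  Ideal.Quotient.eq_zero_iff_mem

lemma proj_surjective : Function.Surjective (proj Ra Rb) := Ideal.Quotient.mk_surjective

/-- The map `t w ↦ t ⊗ w` for `w` of degree `r`, with the coefficient `t` taken in `A`. -/
def cosplit (r : ℕ) : TensorAlgebra k V →ₗ[k] Alg Ra Rb ⊗[k] TensorAlgebra k V :=
  (proj Ra Rb).toLinearMap.rTensor (TensorAlgebra k V) ∘ₗ rsplit k V r

variable {Ra Rb}

lemma cosplit_mul {r : ℕ} (t : 𝕋) {w : 𝕋} (hw : w ∈ 𝕃 ^ r) :
    cosplit Ra Rb r (t * w) = proj Ra Rb t ⊗ₜ[k] w := by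
  simp [cosplit, rsplit_mul r t w hw]

/-- Right exactness of `- ⊗ T(V)` lifts an element of the kernel to `I ⊗ T(V)`; a projection of the
second factor onto `𝕃 ^ r` then brings the lift into `I ⊗ V^{(r)}`. -/
lemma cosplit_eq_zero_iff {r : ℕ} {x : 𝕋} (hx : x ∈ ⊤ * 𝕃 ^ r) :
    cosplit Ra Rb r x = 0 ↔ x ∈ relSubmodule Ra Rb * 𝕃 ^ r := by
  constructor
  · intro h
    have hex : Function.Exact (relSubmodule Ra Rb).subtype (proj Ra Rb).toLinearMap := by
      intro y
      refine (proj_eq_zero_iff Ra Rb).trans ?_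
      simp
    obtain ⟨w, hw⟩ := (rTensor_exact (TensorAlgebra k V) hex (proj_surjective Ra Rb) _).1 h
    obtain ⟨π, hπ, hπ'⟩ := exists_linearMap_fix_and_map_inf (⊤ : Submodule k 𝕋) (𝕃 ^ r)
    have h1 : rightMap r LinearMap.id π x = x := map_eq_of_mul _ LinearMap.id
      (fun t _ w hw => by simp [rightMap_mul _ _ t hw, hπ w hw]) hx
    rw [← h1]
    have h2 : rightMap r LinearMap.id π x = LinearMap.mul' k 𝕋
        (TensorProduct.map LinearMap.id π (rsplit k V r x)) := rfl
    have h3 : ∀ w, LinearMap.mul' k 𝕋 (TensorProduct.map LinearMap.id π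
        ((relSubmodule Ra Rb).subtype.rTensor 𝕋 w)) ∈ relSubmodule Ra Rb * 𝕃 ^ r := by
      intro w
      induction w using TensorProduct.induction_on with
      | zero => simp only [map_zero]; exact zero_mem _
      | tmul u v => simpa using Submodule.mul_mem_mul u.2 (hπ' v trivial).2
      | add u v hu hv => simp only [map_add]; exact add_mem hu hv
    rw [h2, ← hw]
    exact h3 w
  · intro h
    refine map_eq_of_mul _ 0 (fun t ht w hw => ?_) h
    rw [cosplit_mul t hw, (proj_eq_zero_iff Ra Rb).2 ht, TensorProduct.zero_tmul]
    rfl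

/-- A map that fixes `𝕃 ^ r` and kills `𝕃 ^ r'` separates the two terms. This is how the summands
`a` and `b` decouple for `i ≥ 3`. -/
lemma cosplit_add_eq_zero_iff {r r' : ℕ} (hr : r ≠ r') {x y : 𝕋} (hx : x ∈ ⊤ * 𝕃 ^ r)
    (hy : y ∈ ⊤ * 𝕃 ^ r') : cosplit Ra Rb r x + cosplit Ra Rb r' y = 0 ↔
      cosplit Ra Rb r x = 0 ∧ cosplit Ra Rb r' y = 0 := by
  refine ⟨fun h => ?_, fun h => by rw [h.1, h.2, add_zero]⟩
  obtain ⟨π, hπ, hπ'⟩ := exists_linearMap_fix_and_map_inf (𝕃 ^ r' : Submodule k 𝕋) (𝕃 ^ r)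
  rw [letters_pow_inf_of_ne hr.symm] at hπ'
  have h1 : π.lTensor (Alg Ra Rb) (cosplit Ra Rb r x) = cosplit Ra Rb r x :=
    map_eq_of_mul (π.lTensor (Alg Ra Rb) ∘ₗ cosplit Ra Rb r) (cosplit Ra Rb r)
      (fun t _ w hw => by simp [cosplit_mul t hw, hπ w hw]) hx
  have h2 : π.lTensor (Alg Ra Rb) (cosplit Ra Rb r' y) = 0 :=
    map_eq_of_mul (π.lTensor (Alg Ra Rb) ∘ₗ cosplit Ra Rb r') 0
      (fun t _ w hw => by simp [cosplit_mul t hw, (Submodule.mem_bot k).1 (hπ' w hw)]) hy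
  have h3 : cosplit Ra Rb r x = 0 := by
    have := congrArg (π.lTensor (Alg Ra Rb)) h
    rwa [map_add, h1, h2, add_zero, map_zero] at this
  rw [h3, zero_add] at h
  exact ⟨h3, h⟩

variable {W : Type*} [AddCommGroup W] [Module k W]

variable (Ra Rb) in
/-- The map `t w ↦ t ⊗ φ w` for `w ∈ J`, where `J` is a subspace of `V^{(r)}`. -/
def embed (r : ℕ) (J : Submodule k (TensorAlgebra k V)) (φ : J →ₗ[k] W) :
    TensorAlgebra k V →ₗ[k] Alg Ra Rb ⊗[k] W :=
  TensorProduct.map (proj Ra Rb).toLinearMap (φ ∘ₗ retraction J) ∘ₗ rsplit k V r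

lemma embed_mul {r : ℕ} {J : Submodule k 𝕋} (hJ : J ≤ 𝕃 ^ r) (φ : J →ₗ[k] W) (t : 𝕋) {w : 𝕋}
    (hw : w ∈ J) : embed Ra Rb r J φ (t * w) = proj Ra Rb t ⊗ₜ[k] φ ⟨w, hw⟩ := by
  simp [embed, rsplit_mul r t w (hJ hw), retraction_apply hw]

lemma embed_smul {r : ℕ} {J : Submodule k 𝕋} (hJ : J ≤ 𝕃 ^ r) (φ : J →ₗ[k] W) (t : 𝕋) {x : 𝕋}
    (hx : x ∈ ⊤ * J) : embed Ra Rb r J φ (t * x) = proj Ra Rb t • embed Ra Rb r J φ x := by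
  refine map_eq_of_mul (embed Ra Rb r J φ ∘ₗ LinearMap.mulLeft k t)
    (Algebra.lsmul k k _ (proj Ra Rb t) ∘ₗ embed Ra Rb r J φ) (fun u _ w hw => ?_) hx
  simp only [LinearMap.comp_apply, LinearMap.mulLeft_apply, ← mul_assoc, embed_mul hJ φ _ hw]
  simp [TensorProduct.smul_tmul']

lemma embed_eq_zero {r : ℕ} {J : Submodule k 𝕋} (hJ : J ≤ 𝕃 ^ r) (φ : J →ₗ[k] W) {x : 𝕋}
    (hx : x ∈ relSubmodule Ra Rb * J) : embed Ra Rb r J φ x = 0 := by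
  refine map_eq_of_mul _ 0 (fun t ht w hw => ?_) hx
  rw [embed_mul hJ φ t hw, (proj_eq_zero_iff Ra Rb).2 ht, TensorProduct.zero_tmul]
  rfl

lemma lTensor_embed {r : ℕ} {J : Submodule k 𝕋} (hJ : J ≤ 𝕃 ^ r) (φ : J →ₗ[k] W)
    (π : W →ₗ[k] 𝕋) (hπ : ∀ w, π (φ w) = w) {x : 𝕋} (hx : x ∈ ⊤ * J) :
    π.lTensor (Alg Ra Rb) (embed Ra Rb r J φ x) = cosplit Ra Rb r x :=
  map_eq_of_mul (π.lTensor (Alg Ra Rb) ∘ₗ embed Ra Rb r J φ) (cosplit Ra Rb r)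
    (fun t _ w hw => by simp [embed_mul hJ φ t hw, cosplit_mul t (hJ hw), hπ]) hx

lemma lTensor_embed_eq_zero {r : ℕ} {J : Submodule k 𝕋} (hJ : J ≤ 𝕃 ^ r) (φ : J →ₗ[k] W)
    (π : W →ₗ[k] 𝕋) (hπ : ∀ w, π (φ w) = 0) {x : 𝕋} (hx : x ∈ ⊤ * J) :
    π.lTensor (Alg Ra Rb) (embed Ra Rb r J φ x) = 0 :=
  map_eq_of_mul (π.lTensor (Alg Ra Rb) ∘ₗ embed Ra Rb r J φ) 0
    (fun t _ w hw => by simp [embed_mul hJ φ t hw, hπ]) hx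

/-! ### The differential on representing tensors -/

section Differential

variable {a b : ℕ}

lemma J_le_pow {s : ℕ} {R : Submodule k 𝕋} (hR : R ≤ 𝕃 ^ s) (j : ℕ) :
    J s R (j + 2) ≤ 𝕃 ^ nfun s (j + 2) := by
  rw [J_add_two, nfun_add_two]
  exact overlaps_le_pow hR _

variable (Ra Rb a b) in
/-- The map `T(V) × T(V) → A ⊗ (J_i^a ⊕ J_i^b)`, which is surjective on
`T(V) J_i^a × T(V) J_i^b`. -/
def represent (i : ℕ) : TensorAlgebra k V × TensorAlgebra k V →ₗ[k] KMod Ra Rb a b i :=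
  (embed Ra Rb (nfun a i) (J a Ra i) (LinearMap.inl k _ _)).coprod
    (embed Ra Rb (nfun b i) (J b Rb i) (LinearMap.inr k _ _))

lemma represent_apply (i : ℕ) (x : 𝕋 × 𝕋) : represent Ra Rb a b i x =
    embed Ra Rb (nfun a i) (J a Ra i) (LinearMap.inl k _ (J b Rb i)) x.1 +
      embed Ra Rb (nfun b i) (J b Rb i) (LinearMap.inr k (J a Ra i) _) x.2 := rfl

variable (Ra Rb a b) in
/-- The pairs of tensors `T(V) J_i^a × T(V) J_i^b`. -/
def pairs (i : ℕ) : Submodule k (TensorAlgebra k V × TensorAlgebra k V) :=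
  (⊤ * J a Ra i).prod (⊤ * J b Rb i)

lemma exists_represent (ha : Ra ≤ 𝕃 ^ a) (hb : Rb ≤ 𝕃 ^ b) (j : ℕ)
    (z : KMod Ra Rb a b (j + 2)) :
    ∃ x ∈ pairs Ra Rb a b (j + 2), represent Ra Rb a b (j + 2) x = z := by
  induction z using TensorProduct.induction_on with
  | zero => exact ⟨0, zero_mem _, map_zero _⟩
  | tmul α w =>
    obtain ⟨t, rfl⟩ := proj_surjective Ra Rb α
    obtain ⟨u, v⟩ := w
    refine ⟨(t * u, t * v), ⟨Submodule.mul_mem_mul trivial u.2, Submodule.mul_mem_mul trivial v.2⟩,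
      ?_⟩
    rw [represent_apply, embed_mul (J_le_pow ha j) _ _ u.2, embed_mul (J_le_pow hb j) _ _ v.2,
      ← TensorProduct.tmul_add]
    simp
  | add y z hy hz =>
    obtain ⟨u, hu, rfl⟩ := hy
    obtain ⟨v, hv, rfl⟩ := hz
    exact ⟨u + v, add_mem hu hv, map_add _ _ _⟩

/-- Projecting to one summand puts the representative in `I ⊗ V^{(r)}`, and the intersection of this
space with `T(V) ⊗ J` is `I ⊗ J`. -/
lemma represent_eq_zero_iff (ha : Ra ≤ 𝕃 ^ a) (hb : Rb ≤ 𝕃 ^ b) {j : ℕ} {x : 𝕋 × 𝕋}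
    (hx : x ∈ pairs Ra Rb a b (j + 2)) : represent Ra Rb a b (j + 2) x = 0 ↔
      x.1 ∈ relSubmodule Ra Rb * J a Ra (j + 2) ∧ x.2 ∈ relSubmodule Ra Rb * J b Rb (j + 2) := by
  constructor
  · intro h
    rw [represent_apply] at h
    have ha' := J_le_pow ha j
    have hb' := J_le_pow hb j
    constructor
    · have h1 := congrArg (((J a Ra (j + 2)).subtype ∘ₗ LinearMap.fst k _ (J b Rb (j + 2))).lTensor
        (Alg Ra Rb)) h
      rw [map_add, lTensor_embed ha' _ _ (fun w => by simp) hx.1,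
        lTensor_embed_eq_zero hb' _ _ (fun w => by simp) hx.2, add_zero, map_zero,
        cosplit_eq_zero_iff (mem_mul_mono le_rfl ha' hx.1)] at h1
      exact mem_mul_mono inf_le_right inf_le_left
        ((mul_inf_mul_of_right_le ha' le_rfl).le ⟨hx.1, h1⟩)
    · have h1 := congrArg (((J b Rb (j + 2)).subtype ∘ₗ LinearMap.snd k (J a Ra (j + 2)) _).lTensor
        (Alg Ra Rb)) h
      rw [map_add, lTensor_embed hb' _ _ (fun w => by simp) hx.2,
        lTensor_embed_eq_zero ha' _ _ (fun w => by simp) hx.1, zero_add, map_zero,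
        cosplit_eq_zero_iff (mem_mul_mono le_rfl hb' hx.2)] at h1
      exact mem_mul_mono inf_le_right inf_le_left
        ((mul_inf_mul_of_right_le hb' le_rfl).le ⟨hx.2, h1⟩)
  · rintro ⟨h1, h2⟩
    rw [represent_apply, embed_eq_zero (J_le_pow ha j) _ h1, embed_eq_zero (J_le_pow hb j) _ h2,
      add_zero]

lemma jump_add_nfun {s : ℕ} (hs : 2 ≤ s) (j : ℕ) :
    nfun s (j + 2) = jump s (j + 2) + nfun s (j + 1) := by
  rw [nfun_add_two, nfun_succ (by omega), jump, gap]
  simp only [Nat.even_add, even_two, iff_true]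
  split_ifs <;> omega

lemma delta_tmul (i : ℕ) (t : 𝕋) (u : J a Ra i) (v : J b Rb i) :
    delta Ra Rb a b i (proj Ra Rb t ⊗ₜ[k] (u, v)) =
      proj Ra Rb t • (proj Ra Rb).toLinearMap.rTensor 𝕋
        (peel k V (jump a i) u + peel k V (jump b i) v) := by
  simp [delta]

/-- Moving the first `p` letters of `w` into the coefficient amounts to cutting `t w` before its
last `r` letters. On representatives `δ_i` thus becomes a change of the place of the cut. -/
lemma smul_rTensor_peel {p r : ℕ} (t : 𝕋) {w : 𝕋} (hw : w ∈ 𝕃 ^ (p + r)) :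
    proj Ra Rb t • (proj Ra Rb).toLinearMap.rTensor 𝕋 (peel k V p w) =
      cosplit Ra Rb r (t * w) := by
  rw [pow_add] at hw
  refine map_eq_of_mul (Algebra.lsmul k k _ (proj Ra Rb t) ∘ₗ
    (proj Ra Rb).toLinearMap.rTensor 𝕋 ∘ₗ peel k V p)
    (cosplit Ra Rb r ∘ₗ LinearMap.mulLeft k t) (fun u hu w hw => ?_) hw
  simp only [LinearMap.comp_apply, peel_mul' p u w hu, LinearMap.mulLeft_apply, ← mul_assoc,
    cosplit_mul _ hw]
  simp [TensorProduct.smul_tmul']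

lemma delta_represent (ha : Ra ≤ 𝕃 ^ a) (hb : Rb ≤ 𝕃 ^ b) (ha2 : 2 ≤ a) (hb2 : 2 ≤ b) {j : ℕ}
    {x : 𝕋 × 𝕋} (hx : x ∈ pairs Ra Rb a b (j + 2)) :
    delta Ra Rb a b (j + 2) (represent Ra Rb a b (j + 2) x) =
      cosplit Ra Rb (nfun a (j + 1)) x.1 + cosplit Ra Rb (nfun b (j + 1)) x.2 := by
  have ha' := J_le_pow ha j
  have hb' := J_le_pow hb j
  rw [represent_apply, map_add]
  congr 1
  · refine map_eq_of_mul ((delta Ra Rb a b (j + 2)).restrictScalars k ∘ₗ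
      embed Ra Rb (nfun a (j + 2)) (J a Ra (j + 2)) (LinearMap.inl k _ (J b Rb (j + 2))))
      (cosplit Ra Rb (nfun a (j + 1))) (fun t _ w hw => ?_) hx.1
    have h1 := ha' hw
    rw [jump_add_nfun ha2] at h1
    rw [LinearMap.comp_apply, embed_mul ha' _ t hw, LinearMap.restrictScalars_apply,
      LinearMap.inl_apply, delta_tmul, ← smul_rTensor_peel t h1]
    simp
  · refine map_eq_of_mul ((delta Ra Rb a b (j + 2)).restrictScalars k ∘ₗ
      embed Ra Rb (nfun b (j + 2)) (J b Rb (j + 2)) (LinearMap.inr k (J a Ra (j + 2)) _))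
      (cosplit Ra Rb (nfun b (j + 1))) (fun t _ w hw => ?_) hx.2
    have h1 := hb' hw
    rw [jump_add_nfun hb2] at h1
    rw [LinearMap.comp_apply, embed_mul hb' _ t hw, LinearMap.restrictScalars_apply,
      LinearMap.inr_apply, delta_tmul, ← smul_rTensor_peel t h1]
    simp

end Differential

variable {a b : ℕ}

/-! ### The grading of the kernel of the differential -/

lemma TP_mul_mem {m n : ℤ} {x y : 𝕋} (hx : x ∈ TP k V m) (hy : y ∈ TP k V n) :
    x * y ∈ TP k V (m + n) := by
  obtain hm | hm := lt_or_ge m 0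
  · rw [TP_of_neg hm, Submodule.mem_bot] at hx
    simp [hx]
  obtain hn | hn := lt_or_ge n 0
  · rw [TP_of_neg hn, Submodule.mem_bot] at hy
    simp [hy]
  lift m to ℕ using hm
  lift n to ℕ using hn
  rw [← Nat.cast_add]
  rw [TP_natCast] at *
  rw [pow_add]
  exact Submodule.mul_mem_mul hx hy

lemma KGrading_eq (ha : Ra ≤ 𝕃 ^ a) (hb : Rb ≤ 𝕃 ^ b) (j : ℕ) (n : ℤ) :
    KGrading Ra Rb a b (j + 2) n =
      ((TP k V (n - nfun a (j + 2)) * J a Ra (j + 2)).prod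
        (TP k V (n - nfun b (j + 2)) * J b Rb (j + 2))).map (represent Ra Rb a b (j + 2)) := by
  have ha' := J_le_pow ha j
  have hb' := J_le_pow hb j
  apply le_antisymm
  · refine sup_le (Submodule.map₂_le.2 ?_) (Submodule.map₂_le.2 ?_)
    · rintro _ ⟨t, ht, rfl⟩ _ ⟨u, rfl⟩
      refine ⟨(t * u, 0), ⟨Submodule.mul_mem_mul ht u.2, zero_mem _⟩, ?_⟩
      rw [represent_apply, embed_mul ha' _ _ u.2]
      simp
    · rintro _ ⟨t, ht, rfl⟩ _ ⟨u, rfl⟩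
      refine ⟨(0, t * u), ⟨zero_mem _, Submodule.mul_mem_mul ht u.2⟩, ?_⟩
      rw [represent_apply, embed_mul hb' _ _ u.2]
      simp
  · rintro _ ⟨x, ⟨h1, h2⟩, rfl⟩
    rw [represent_apply]
    refine add_mem (Submodule.mem_sup_left ?_) (Submodule.mem_sup_right ?_)
    · refine map_mem_of_mul _ (fun t ht w hw => ?_) h1
      rw [embed_mul ha' _ _ hw]
      exact Submodule.apply_mem_map₂ _ ⟨t, ht, rfl⟩ ⟨_, rfl⟩
    · refine map_mem_of_mul _ (fun t ht w hw => ?_) h2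
      rw [embed_mul hb' _ _ hw]
      exact Submodule.apply_mem_map₂ _ ⟨t, ht, rfl⟩ ⟨_, rfl⟩

lemma homProj_mem_relSubmodule_mul (h : RelationData Ra Rb a b) {J : Submodule k 𝕋} {w : ℕ}
    (hJ : J ≤ 𝕃 ^ w) (n : ℕ) {x : 𝕋} (hx : x ∈ relSubmodule Ra Rb * J) :
    homProj k V n x ∈ relSubmodule Ra Rb * J := by
  obtain hn | hn := lt_or_ge n w
  · rw [homProj_mul_eq_zero hJ hn hx]
    exact zero_mem _
  · obtain ⟨p, rfl⟩ : ∃ p, n = p + w := ⟨n - w, by omega⟩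
    exact homProj_mul_mem hJ (fun x hx => idealPiece_le_relSubmodule _ _ _ (h.homProj_mem p hx)) hx

lemma mem_pow_of_mem_TP_mul {J : Submodule k 𝕋} {w : ℕ} (hJ : J ≤ 𝕃 ^ w) (n : ℕ) {x : 𝕋}
    (hx : x ∈ TP k V (n - w) * J) : x ∈ 𝕃 ^ n := by
  obtain hn | hn := lt_or_ge n w
  · rw [TP_of_neg (by omega), Submodule.bot_mul, Submodule.mem_bot] at hx
    rw [hx]
    exact zero_mem _
  · rw [TP_sub_of_le hn] at hx
    have := mem_mul_mono le_rfl hJ hx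
    rwa [← pow_add, Nat.sub_add_cancel hn] at this

/-- Independence is inherited from `T(V)`: lift to tensors and take homogeneous components, which
preserve `I ⊗ J` because `I` is homogeneous. -/
lemma iSupIndep_KGrading (h : RelationData Ra Rb a b) (j : ℕ) :
    iSupIndep (KGrading Ra Rb a b (j + 2)) := by
  have ha' := J_le_pow h.left_le j
  have hb' := J_le_pow h.right_le j
  intro n
  rw [Submodule.disjoint_def]
  intro z hz hz'
  rw [KGrading_eq h.left_le h.right_le] at hz
  obtain ⟨x, hx, rfl⟩ := hz
  obtain hn | hn := lt_or_ge n 0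
  · rw [TP_of_neg (by omega), TP_of_neg (by omega), Submodule.bot_mul, Submodule.bot_mul] at hx
    obtain ⟨h1, h2⟩ := hx
    have : x = 0 := Prod.ext h1 h2
    rw [this, map_zero]
  lift n to ℕ using hn
  have hle : (⨆ m, ⨆ _ : m ≠ (n : ℤ), KGrading Ra Rb a b (j + 2) m) ≤
      (((⊤ * J a Ra (j + 2)) ⊓ LinearMap.ker (homProj k V n)).prod
        ((⊤ * J b Rb (j + 2)) ⊓ LinearMap.ker (homProj k V n))).map
        (represent Ra Rb a b (j + 2)) := by
    refine iSup₂_le fun m hm => ?_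
    rw [KGrading_eq h.left_le h.right_le]
    refine Submodule.map_mono (Submodule.prod_mono ?_ ?_)
    · obtain hm' | hm' := lt_or_ge m 0
      · rw [TP_of_neg (by omega), Submodule.bot_mul]
        exact bot_le
      · lift m to ℕ using hm'
        exact fun x hx => ⟨mem_mul_mono le_top le_rfl hx,
          homProj_of_mem_ne (mem_pow_of_mem_TP_mul ha' m hx) (by exact_mod_cast hm)⟩
    · obtain hm' | hm' := lt_or_ge m 0
      · rw [TP_of_neg (by omega), Submodule.bot_mul]
        exact bot_le
      · lift m to ℕ using hm'
        exact fun x hx => ⟨mem_mul_mono le_top le_rfl hx,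
          homProj_of_mem_ne (mem_pow_of_mem_TP_mul hb' m hx) (by exact_mod_cast hm)⟩
  obtain ⟨y, hy, hxy⟩ := hle hz'
  have hxp : x ∈ pairs Ra Rb a b (j + 2) :=
    ⟨mem_mul_mono le_top le_rfl hx.1, mem_mul_mono le_top le_rfl hx.2⟩
  have hyp : y ∈ pairs Ra Rb a b (j + 2) := ⟨hy.1.1, hy.2.1⟩
  have hd : represent Ra Rb a b (j + 2) (x - y) = 0 := by rw [map_sub, hxy, sub_self]
  rw [represent_eq_zero_iff h.left_le h.right_le (sub_mem hxp hyp)] at hd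
  rw [represent_eq_zero_iff h.left_le h.right_le hxp]
  constructor
  · have := homProj_mem_relSubmodule_mul h ha' n hd.1
    rwa [Prod.fst_sub, map_sub, homProj_of_mem (mem_pow_of_mem_TP_mul ha' n hx.1),
      LinearMap.mem_ker.1 hy.1.2, sub_zero] at this
  · have := homProj_mem_relSubmodule_mul h hb' n hd.2
    rwa [Prod.snd_sub, map_sub, homProj_of_mem (mem_pow_of_mem_TP_mul hb' n hx.2),
      LinearMap.mem_ker.1 hy.2.2, sub_zero] at this

lemma isGradedAction_kerGrading (h : RelationData Ra Rb a b) (j : ℕ) :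
    IsGradedAction (A := Alg Ra Rb) (M := Ker Ra Rb a b (j + 2)) (algGrading Ra Rb)
      (kerGrading Ra Rb a b (j + 2)) where
  neg m hm := by rw [algGrading, TP_of_neg hm, Submodule.map_bot]
  zero := by
    rintro _ ⟨x, hx, rfl⟩
    rw [SetLike.mem_coe, show (0 : ℤ) = (0 : ℕ) from rfl, TP_natCast, pow_zero,
      Submodule.mem_one] at hx
    obtain ⟨c, rfl⟩ := hx
    exact ⟨c, (proj Ra Rb).commutes c⟩
  one_mem := by
    refine ⟨1, ?_, map_one (proj Ra Rb)⟩
    rw [SetLike.mem_coe, show (0 : ℤ) = (0 : ℕ) from rfl, TP_natCast, pow_zero]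
    exact Submodule.mem_one.2 ⟨1, map_one _⟩
  iSup_eq_top := by
    rw [eq_top_iff]
    intro α _
    obtain ⟨t, rfl⟩ := proj_surjective Ra Rb α
    have ht : t ∈ ⨆ n : ℕ, 𝕃 ^ n := by rw [iSup_letters_pow]; trivial
    have hle : (⨆ n : ℕ, 𝕃 ^ n) ≤ (⨆ m, algGrading Ra Rb m).comap (proj Ra Rb).toLinearMap := by
      refine iSup_le fun n x hx => Submodule.mem_iSup_of_mem (n : ℤ) ⟨x, ?_, rfl⟩
      rwa [SetLike.mem_coe, TP_natCast]
    exact hle ht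
  mul_mem := by
    rintro m n _ ⟨x, hx, rfl⟩ _ ⟨y, hy, rfl⟩
    exact ⟨x * y, TP_mul_mem hx hy, map_mul (proj Ra Rb) x y⟩
  smul_mem := by
    rintro m n _ ⟨t, ht, rfl⟩ z hz
    have ha' := J_le_pow h.left_le j
    have hb' := J_le_pow h.right_le j
    change (proj Ra Rb t • (z : KMod Ra Rb a b (j + 2))) ∈ KGrading Ra Rb a b (j + 2) (m + n)
    have hz' : (z : KMod Ra Rb a b (j + 2)) ∈ KGrading Ra Rb a b (j + 2) n := hz
    rw [KGrading_eq h.left_le h.right_le] at hz' ⊢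
    obtain ⟨x, hx, hxz⟩ := hz'
    have key : ∀ (w : ℤ) (J : Submodule k 𝕋) (y : 𝕋), y ∈ TP k V (n - w) * J →
        t * y ∈ TP k V (m + n - w) * J := by
      intro w J y hy
      refine map_mem_of_mul (LinearMap.mulLeft k t) (fun u hu v hv => ?_) hy
      rw [LinearMap.mulLeft_apply, ← mul_assoc, add_sub_assoc]
      exact Submodule.mul_mem_mul (TP_mul_mem ht hu) hv
    refine ⟨(t * x.1, t * x.2), ⟨key _ _ _ hx.1, key _ _ _ hx.2⟩, ?_⟩
    rw [← hxz, represent_apply, represent_apply,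
      embed_smul ha' _ _ (mem_mul_mono le_top le_rfl hx.1),
      embed_smul hb' _ _ (mem_mul_mono le_top le_rfl hx.2), smul_add]
  indep := by
    intro n
    rw [Submodule.disjoint_def]
    intro z hz hz'
    refine Subtype.ext ((Submodule.disjoint_def.1 (iSupIndep_KGrading h j n)) z hz ?_)
    have hle : (⨆ m, ⨆ _ : m ≠ n, kerGrading Ra Rb a b (j + 2) m) ≤
        (⨆ m, ⨆ _ : m ≠ n, KGrading Ra Rb a b (j + 2) m).comap
          ((Ker Ra Rb a b (j + 2)).subtype.restrictScalars k) :=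
      iSup₂_le fun m hm => Submodule.comap_mono
        (le_iSup₂_of_le (f := fun m (_ : m ≠ n) => KGrading Ra Rb a b (j + 2) m) m hm le_rfl)
    exact hle hz'

/-! ### The generators of the kernel -/

lemma J_add_three_le {s : ℕ} (hs : 1 ≤ s) (R : Submodule k 𝕋) (j : ℕ) :
    J s R (j + 3) ≤ 𝕃 ^ gap s j * J s R (j + 2) := by
  rw [J_add_three hs, J_add_two, add_comm]
  exact overlaps_add_le _ _ _

/-- By degree, the coefficients lie in the component of the ideal of degree `gap s j < s`, and an
element of `J_{i+1}` begins with a relation, so minimality applies. Injectivity and independence of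
the generators rest on this. -/
lemma IsRelationSpace.J_inf_eq_bot {s : ℕ} {R : Submodule k 𝕋} (h : RelationData Ra Rb a b)
    (hR : IsRelationSpace Ra Rb s R) (j : ℕ) :
    J s R (j + 3) ⊓ relSubmodule Ra Rb * J s R (j + 2) = ⊥ := by
  have hs := hR.two_le
  have hg := gap_lt hs j
  rw [eq_bot_iff]
  rintro x ⟨h1, h2⟩
  rw [SetLike.mem_coe, J_add_three (by omega)] at h1
  rw [SetLike.mem_coe, J_add_two] at h2
  have h3 := homProj_mul_mem (p := gap s j) (overlaps_le_pow hR.le_pow _)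
    (fun x hx => h.homProj_mem (gap s j) hx) h2
  have e : homProj k V (gap s j + (s + nfun s j)) x = x := by
    apply homProj_of_mem
    have := overlaps_le_pow hR.le_pow _ h1
    rwa [show s + (nfun s j + gap s j) = gap s j + (s + nfun s j) by omega] at this
  rw [e] at h3
  have h4 : x ∈ idealPiece Ra Rb (gap s j) * 𝕃 ^ (s - gap s j) * 𝕃 ^ (nfun s j + gap s j) := by
    rw [mul_assoc, ← pow_add, show s - gap s j + (nfun s j + gap s j) = s + nfun s j by omega]
    exact mem_mul_mono le_rfl (overlaps_le_pow hR.le_pow _) h3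
  have h5 := (mul_letters_pow_inf _ _).le ⟨overlaps_le_left _ h1, h4⟩
  rwa [hR.inf_idealPiece _ _ hg (by omega), Submodule.bot_mul] at h5

/-- The reason for `δ_i δ_{i+1} = 0`: since `n_s(i+1) = s + n_s(i-1)`, an element of `J_{i+1}` is a
relation followed by `n_s(i-1)` letters. -/
lemma IsRelationSpace.J_add_three_le_ker {s : ℕ} {R : Submodule k 𝕋}
    (hR : IsRelationSpace Ra Rb s R) (j : ℕ) :
    J s R (j + 3) ≤ relSubmodule Ra Rb * 𝕃 ^ nfun s (j + 1) := by
  have hs := hR.two_le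
  rw [J_add_three (by omega), nfun_succ (by omega)]
  exact (overlaps_le_left _).trans (mul_le_mul_left hR.le_relSubmodule _)

lemma J_add_three_le_top_mul {s : ℕ} (hs : 1 ≤ s) (R : Submodule k 𝕋) (j : ℕ) :
    J s R (j + 3) ≤ ⊤ * J s R (j + 2) :=
  (J_add_three_le hs R j).trans (mul_le_mul_left le_top _)

lemma RelationData.represent_mem_ker (h : RelationData Ra Rb a b) {j : ℕ} {x : 𝕋 × 𝕋}
    (hx : x ∈ pairs Ra Rb a b (j + 2))
    (h1 : x.1 ∈ relSubmodule Ra Rb * 𝕃 ^ nfun a (j + 1))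
    (h2 : x.2 ∈ relSubmodule Ra Rb * 𝕃 ^ nfun b (j + 1)) :
    represent Ra Rb a b (j + 2) x ∈ Ker Ra Rb a b (j + 2) := by
  rw [LinearMap.mem_ker, delta_represent h.left_le h.right_le h.two_le (h.two_le.trans h.lt.le) hx,
    (cosplit_eq_zero_iff (mem_mul_mono le_top le_rfl h1)).2 h1,
    (cosplit_eq_zero_iff (mem_mul_mono le_top le_rfl h2)).2 h2, add_zero]

/-- The map `J_{i+1}^a → Ker δ_i`. -/
def leftGen (h : RelationData Ra Rb a b) (j : ℕ) : J a Ra (j + 3) →ₗ[k] Ker Ra Rb a b (j + 2) :=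
  LinearMap.codRestrict ((Ker Ra Rb a b (j + 2)).restrictScalars k)
    (represent Ra Rb a b (j + 2) ∘ₗ LinearMap.inl k _ _ ∘ₗ (J a Ra (j + 3)).subtype)
    fun x => h.represent_mem_ker
      ⟨J_add_three_le_top_mul (by have := h.two_le; omega) Ra j x.2, zero_mem _⟩
      (h.isRelationSpace_left.J_add_three_le_ker j x.2) (zero_mem _)

/-- The map `J_{i+1}^b → Ker δ_i`. -/
def rightGen (h : RelationData Ra Rb a b) (j : ℕ) : J b Rb (j + 3) →ₗ[k] Ker Ra Rb a b (j + 2) :=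
  LinearMap.codRestrict ((Ker Ra Rb a b (j + 2)).restrictScalars k)
    (represent Ra Rb a b (j + 2) ∘ₗ LinearMap.inr k _ _ ∘ₗ (J b Rb (j + 3)).subtype)
    fun x => h.represent_mem_ker
      ⟨zero_mem _, J_add_three_le_top_mul (by have := h.lt; omega) Rb j x.2⟩
      (zero_mem _) (h.isRelationSpace_right.J_add_three_le_ker j x.2)

lemma leftGen_apply (h : RelationData Ra Rb a b) (j : ℕ) (x : J a Ra (j + 3)) :
    (leftGen h j x : KMod Ra Rb a b (j + 2)) = represent Ra Rb a b (j + 2) (x, 0) := rfl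

lemma rightGen_apply (h : RelationData Ra Rb a b) (j : ℕ) (x : J b Rb (j + 3)) :
    (rightGen h j x : KMod Ra Rb a b (j + 2)) = represent Ra Rb a b (j + 2) (0, x) := rfl

lemma represent_smul (h : RelationData Ra Rb a b) {j : ℕ} (t : 𝕋) {x : 𝕋 × 𝕋}
    (hx : x ∈ pairs Ra Rb a b (j + 2)) :
    represent Ra Rb a b (j + 2) (t * x.1, t * x.2) =
      proj Ra Rb t • represent Ra Rb a b (j + 2) x := by
  rw [represent_apply, represent_apply, embed_smul (J_le_pow h.left_le j) _ _ hx.1,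
    embed_smul (J_le_pow h.right_le j) _ _ hx.2, smul_add]

lemma mul_mem_top_mul {J : Submodule k 𝕋} (t : 𝕋) {x : 𝕋} (hx : x ∈ ⊤ * J) : t * x ∈ ⊤ * J :=
  map_mem_of_mul (LinearMap.mulLeft k t) (fun u _ v hv => by
    rw [LinearMap.mulLeft_apply, ← mul_assoc]
    exact Submodule.mul_mem_mul trivial hv) hx

lemma top_mul_le_top_mul {X Y : Submodule k 𝕋} (h : X ≤ ⊤ * Y) : ⊤ * X ≤ ⊤ * Y :=
  Submodule.mul_le.2 fun t _ _ hx => mul_mem_top_mul t (h hx)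

lemma mem_span_range_iff {E : Type*} [AddCommGroup E] [Module k E] [Module (Alg Ra Rb) E]
    [IsScalarTower k (Alg Ra Rb) E] (N : Submodule (Alg Ra Rb) E) {J' : Submodule k 𝕋}
    (φ : J' →ₗ[k] N) (ρ : 𝕋 →ₗ[k] E)
    (hρ : ∀ t, ∀ x ∈ ⊤ * J', ρ (t * x) = proj Ra Rb t • ρ x) (hφ : ∀ w, (φ w : E) = ρ w) (z : N) :
    z ∈ Submodule.span (Alg Ra Rb) (LinearMap.range φ : Set N) ↔
      ∃ x ∈ ⊤ * J', ρ x = z := by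
  have hJ : J' ≤ ⊤ * J' := fun x hx => by
    simpa using Submodule.mul_mem_mul (Submodule.mem_top (x := (1 : 𝕋))) hx
  constructor
  · intro hz
    induction hz using Submodule.span_induction with
    | mem z hz =>
      obtain ⟨x, rfl⟩ := hz
      exact ⟨x, hJ x.2, (hφ x).symm⟩
    | zero => exact ⟨0, zero_mem _, map_zero _⟩
    | add y z _ _ hy hz =>
      obtain ⟨u, hu, hy⟩ := hy
      obtain ⟨v, hv, hz⟩ := hz
      exact ⟨u + v, add_mem hu hv, by rw [map_add, hy, hz, Submodule.coe_add]⟩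
    | smul α z _ hz =>
      obtain ⟨u, hu, hz⟩ := hz
      obtain ⟨t, rfl⟩ := proj_surjective Ra Rb α
      exact ⟨t * u, mul_mem_top_mul t hu, by rw [hρ t u hu, hz, Submodule.coe_smul]⟩
  · rintro ⟨x, hx, hxz⟩
    have key : ⊤ * J' ≤ (((Submodule.span (Alg Ra Rb) (LinearMap.range φ :
        Set N)).restrictScalars k).map (N.subtype.restrictScalars k)).comap ρ := by
      refine Submodule.mul_le.2 fun t _ w hw => ?_
      refine ⟨proj Ra Rb t • φ ⟨w, hw⟩,
        Submodule.smul_mem _ _ (Submodule.subset_span (LinearMap.mem_range_self φ ⟨w, hw⟩)), ?_⟩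
      rw [hρ t w (hJ hw), ← hφ ⟨w, hw⟩]
      rfl
    obtain ⟨y, hy, hyx⟩ := key hx
    have : y = z := Subtype.ext (hyx.trans hxz)
    exact this ▸ hy

lemma mem_span_range_leftGen_iff (h : RelationData Ra Rb a b) (j : ℕ)
    (z : Ker Ra Rb a b (j + 2)) :
    z ∈ Submodule.span (Alg Ra Rb) (LinearMap.range (leftGen h j) : Set (Ker Ra Rb a b (j + 2))) ↔
      ∃ x ∈ ⊤ * J a Ra (j + 3), represent Ra Rb a b (j + 2) (x, 0) = z := by
  have ha : 1 ≤ a := by have := h.two_le; omega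
  refine mem_span_range_iff (Ker Ra Rb a b (j + 2)) (leftGen h j)
    (represent Ra Rb a b (j + 2) ∘ₗ LinearMap.inl k _ _) (fun t x hx => ?_)
    (fun w => leftGen_apply h j w) z
  have := represent_smul h (j := j) t (x := (x, 0))
    ⟨top_mul_le_top_mul (J_add_three_le_top_mul ha Ra j) hx, zero_mem _⟩
  rwa [mul_zero] at this

lemma mem_span_range_rightGen_iff (h : RelationData Ra Rb a b) (j : ℕ)
    (z : Ker Ra Rb a b (j + 2)) :
    z ∈ Submodule.span (Alg Ra Rb) (LinearMap.range (rightGen h j) : Set (Ker Ra Rb a b (j + 2))) ↔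
      ∃ x ∈ ⊤ * J b Rb (j + 3), represent Ra Rb a b (j + 2) (0, x) = z := by
  have hb : 1 ≤ b := by have := h.lt; omega
  refine mem_span_range_iff (Ker Ra Rb a b (j + 2)) (rightGen h j)
    (represent Ra Rb a b (j + 2) ∘ₗ LinearMap.inr k _ _) (fun t x hx => ?_)
    (fun w => rightGen_apply h j w) z
  have := represent_smul h (j := j) t (x := (0, x))
    ⟨zero_mem _, top_mul_le_top_mul (J_add_three_le_top_mul hb Rb j) hx⟩
  rwa [mul_zero] at this

/-! ### Purity of the kernel and exactness -/

lemma nfun_lt_nfun (hab : a < b) {t : ℕ} (ht : 2 ≤ t) : nfun a t < nfun b t := by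
  unfold nfun
  have : 0 < t / 2 := Nat.div_pos ht two_pos
  have := Nat.mul_lt_mul_of_pos_right hab this
  omega

lemma comap_TP_self {J : Submodule k 𝕋} {w : ℕ} (hJ : J ≤ 𝕃 ^ w) :
    (TP k V w).comap J.subtype = ⊤ := by
  rw [TP_natCast, eq_top_iff]
  exact fun x _ => hJ x.2

lemma comap_TP_of_ne {J : Submodule k 𝕋} {w : ℕ} (hJ : J ≤ 𝕃 ^ w) {n : ℤ} (hn : n ≠ w) :
    (TP k V n).comap J.subtype = ⊥ := by
  rw [eq_bot_iff]
  intro x hx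
  rw [Submodule.mem_comap] at hx
  have h0 : (x : 𝕋) = 0 := by
    obtain hn0 | hn0 := lt_or_ge n 0
    · rw [TP_of_neg hn0] at hx
      exact (Submodule.mem_bot k).1 hx
    · lift n to ℕ using hn0
      rw [TP_natCast] at hx
      have : (x : 𝕋) ∈ 𝕃 ^ n ⊓ 𝕃 ^ w := ⟨hx, hJ x.2⟩
      rwa [letters_pow_inf_of_ne (by exact_mod_cast hn), Submodule.mem_bot] at this
  exact Subtype.ext h0

lemma finite_of_le_pow [FiniteDimensional k V] {J : Submodule k 𝕋} {w : ℕ} (hJ : J ≤ 𝕃 ^ w) :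
    Module.Finite k J := by
  have h1 : (𝕃 : Submodule k 𝕋).FG :=
    Module.Finite.iff_fg.1 (inferInstanceAs (Module.Finite k
      (LinearMap.range (TensorAlgebra.ι k : V →ₗ[k] 𝕋))))
  have : Module.Finite k (𝕃 ^ w : Submodule k 𝕋) := Module.Finite.iff_fg.2 (h1.pow w)
  exact Submodule.finiteDimensional_of_le hJ

/-- The kernel of `δ_i` is generated by `J_{i+1}`, in terms of representatives. -/
def KernelGenerated (Ra Rb : Submodule k (TensorAlgebra k V)) (a b j : ℕ) : Prop :=
  ∀ x ∈ pairs Ra Rb a b (j + 2), delta Ra Rb a b (j + 2) (represent Ra Rb a b (j + 2) x) = 0 →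
    x.1 ∈ ⊤ * J a Ra (j + 3) ⊔ relSubmodule Ra Rb * J a Ra (j + 2) ∧
      x.2 ∈ ⊤ * J b Rb (j + 3) ⊔ relSubmodule Ra Rb * J b Rb (j + 2)

lemma kernelGenerated_iff (h : RelationData Ra Rb a b) (j : ℕ) :
    KernelGenerated Ra Rb a b j ↔
      Submodule.span (Alg Ra Rb) (LinearMap.range (leftGen h j) : Set (Ker Ra Rb a b (j + 2))) ⊔
        Submodule.span (Alg Ra Rb)
          (LinearMap.range (rightGen h j) : Set (Ker Ra Rb a b (j + 2))) = ⊤ := by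
  have ha : 1 ≤ a := by have := h.two_le; omega
  have hb : 1 ≤ b := by have := h.lt; omega
  constructor
  · intro H
    rw [eq_top_iff]
    rintro ⟨z, hz⟩ -
    obtain ⟨x, hx, rfl⟩ := exists_represent h.left_le h.right_le j z
    obtain ⟨h1, h2⟩ := H x hx hz
    obtain ⟨y₁, hy₁, z₁, hz₁, e₁⟩ := Submodule.mem_sup.1 h1
    obtain ⟨y₂, hy₂, z₂, hz₂, e₂⟩ := Submodule.mem_sup.1 h2
    have hzero : represent Ra Rb a b (j + 2) (z₁, z₂) = 0 :=
      (represent_eq_zero_iff h.left_le h.right_le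
        ⟨mem_mul_mono le_top le_rfl hz₁, mem_mul_mono le_top le_rfl hz₂⟩).2 ⟨hz₁, hz₂⟩
    have hker : ∀ y ∈ ⊤ * J a Ra (j + 3), represent Ra Rb a b (j + 2) (y, 0) ∈
        Ker Ra Rb a b (j + 2) := by
      intro y hy
      refine h.represent_mem_ker
        ⟨top_mul_le_top_mul (J_add_three_le_top_mul ha Ra j) hy, zero_mem _⟩ ?_ (zero_mem _)
      have := mem_mul_mono le_rfl (h.isRelationSpace_left.J_add_three_le_ker j) hy
      rw [← mul_assoc] at this
      exact mem_mul_mono (mul_relSubmodule_le _ _ _) le_rfl this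
    have hker' : ∀ y ∈ ⊤ * J b Rb (j + 3), represent Ra Rb a b (j + 2) (0, y) ∈
        Ker Ra Rb a b (j + 2) := by
      intro y hy
      refine h.represent_mem_ker
        ⟨zero_mem _, top_mul_le_top_mul (J_add_three_le_top_mul hb Rb j) hy⟩ (zero_mem _) ?_
      have := mem_mul_mono le_rfl (h.isRelationSpace_right.J_add_three_le_ker j) hy
      rw [← mul_assoc] at this
      exact mem_mul_mono (mul_relSubmodule_le _ _ _) le_rfl this
    have e : represent Ra Rb a b (j + 2) x =
        represent Ra Rb a b (j + 2) (y₁, 0) + represent Ra Rb a b (j + 2) (0, y₂) := by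
      rw [← map_add, Prod.mk_add_mk, add_zero, zero_add,
        show x = (y₁, y₂) + (z₁, z₂) from Prod.ext e₁.symm e₂.symm, map_add, hzero, add_zero]
    refine Submodule.mem_sup.2 ⟨⟨_, hker y₁ hy₁⟩,
      (mem_span_range_leftGen_iff h j _).2 ⟨y₁, hy₁, rfl⟩, ⟨_, hker' y₂ hy₂⟩,
      (mem_span_range_rightGen_iff h j _).2 ⟨y₂, hy₂, rfl⟩, Subtype.ext e.symm⟩
  · intro H x hx hδ
    have hmem : (⟨represent Ra Rb a b (j + 2) x, hδ⟩ : Ker Ra Rb a b (j + 2)) ∈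
        (⊤ : Submodule (Alg Ra Rb) (Ker Ra Rb a b (j + 2))) := trivial
    rw [← H] at hmem
    obtain ⟨u, hu, v, hv, huv⟩ := Submodule.mem_sup.1 hmem
    obtain ⟨y₁, hy₁, e₁⟩ := (mem_span_range_leftGen_iff h j _).1 hu
    obtain ⟨y₂, hy₂, e₂⟩ := (mem_span_range_rightGen_iff h j _).1 hv
    have e : represent Ra Rb a b (j + 2) (x - (y₁, y₂)) = 0 := by
      have h1 : represent Ra Rb a b (j + 2) (y₁, 0) + represent Ra Rb a b (j + 2) (0, y₂) =
          represent Ra Rb a b (j + 2) x := by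
        rw [e₁, e₂]
        exact congrArg Subtype.val huv
      rw [← map_add, Prod.mk_add_mk, add_zero, zero_add] at h1
      rw [map_sub, h1, sub_self]
    have hy : (y₁, y₂) ∈ pairs Ra Rb a b (j + 2) :=
      ⟨top_mul_le_top_mul (J_add_three_le_top_mul ha Ra j) hy₁,
        top_mul_le_top_mul (J_add_three_le_top_mul hb Rb j) hy₂⟩
    rw [represent_eq_zero_iff h.left_le h.right_le (sub_mem hx hy)] at e
    exact ⟨Submodule.mem_sup.2 ⟨y₁, hy₁, _, e.1, add_sub_cancel _ _⟩,
      Submodule.mem_sup.2 ⟨y₂, hy₂, _, e.2, add_sub_cancel _ _⟩⟩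

lemma leftGen_injective (h : RelationData Ra Rb a b) (j : ℕ) :
    Function.Injective (leftGen h j) := by
  have ha : 1 ≤ a := by have := h.two_le; omega
  refine (injective_iff_map_eq_zero (leftGen h j)).2 fun x hx => ?_
  have h1 : represent Ra Rb a b (j + 2) ((x : 𝕋), 0) = 0 := by
    rw [← leftGen_apply h, hx, Submodule.coe_zero]
  rw [represent_eq_zero_iff h.left_le h.right_le
    ⟨J_add_three_le_top_mul ha Ra j x.2, zero_mem _⟩] at h1
  have h2 := (h.isRelationSpace_left.J_inf_eq_bot h j).le ⟨x.2, h1.1⟩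
  exact Subtype.ext ((Submodule.mem_bot k).1 h2)

lemma rightGen_injective (h : RelationData Ra Rb a b) (j : ℕ) :
    Function.Injective (rightGen h j) := by
  have hb : 1 ≤ b := by have := h.lt; omega
  refine (injective_iff_map_eq_zero (rightGen h j)).2 fun x hx => ?_
  have h1 : represent Ra Rb a b (j + 2) (0, (x : 𝕋)) = 0 := by
    rw [← rightGen_apply h, hx, Submodule.coe_zero]
  rw [represent_eq_zero_iff h.left_le h.right_le
    ⟨zero_mem _, J_add_three_le_top_mul hb Rb j x.2⟩] at h1
  have h2 := (h.isRelationSpace_right.J_inf_eq_bot h j).le ⟨x.2, h1.2⟩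
  exact Subtype.ext ((Submodule.mem_bot k).1 h2)

lemma range_rightGen_inf_span_eq_bot (h : RelationData Ra Rb a b) (j : ℕ) :
    LinearMap.range (rightGen h j) ⊓ (Submodule.span (Alg Ra Rb)
      (LinearMap.range (leftGen h j) : Set (Ker Ra Rb a b (j + 2)))).restrictScalars k = ⊥ := by
  have ha : 1 ≤ a := by have := h.two_le; omega
  have hb : 1 ≤ b := by have := h.lt; omega
  rw [eq_bot_iff]
  rintro _ ⟨⟨y, rfl⟩, hy⟩
  obtain ⟨x, hx, e⟩ := (mem_span_range_leftGen_iff h j _).1 hy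
  have h1 : represent Ra Rb a b (j + 2) (x, -(y : 𝕋)) = 0 := by
    have h2 : ((x, -(y : 𝕋)) : 𝕋 × 𝕋) = (x, 0) - (0, (y : 𝕋)) := by simp
    rw [h2, map_sub, e, rightGen_apply, sub_self]
  rw [represent_eq_zero_iff h.left_le h.right_le
    ⟨top_mul_le_top_mul (J_add_three_le_top_mul ha Ra j) hx,
      neg_mem (J_add_three_le_top_mul hb Rb j y.2)⟩] at h1
  have h2 := (h.isRelationSpace_right.J_inf_eq_bot h j).le ⟨y.2, by simpa using neg_mem h1.2⟩
  have h3 : y = 0 := Subtype.ext ((Submodule.mem_bot k).1 h2)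
  rw [h3, map_zero]
  exact zero_mem _

lemma mem_TP_sub_mul_J {s : ℕ} (hs : 1 ≤ s) (R : Submodule k 𝕋) (j : ℕ) {x : 𝕋}
    (hx : x ∈ J s R (j + 3)) : x ∈ TP k V (nfun s (j + 3) - nfun s (j + 2)) * J s R (j + 2) := by
  have e : (nfun s (j + 3) : ℤ) - nfun s (j + 2) = gap s j := by
    rw [show j + 3 = j + 2 + 1 from rfl, nfun_succ hs, gap_add_two]
    push_cast
    ring
  rw [e, TP_natCast]
  exact J_add_three_le hs R j hx

lemma range_leftGen_le (h : RelationData Ra Rb a b) (j : ℕ) :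
    LinearMap.range (leftGen h j) ≤ kerGrading Ra Rb a b (j + 2) (nfun a (j + 3)) := by
  have ha : 1 ≤ a := by have := h.two_le; omega
  rintro _ ⟨x, rfl⟩
  change (leftGen h j x : KMod Ra Rb a b (j + 2)) ∈ KGrading Ra Rb a b (j + 2) _
  rw [KGrading_eq h.left_le h.right_le, leftGen_apply]
  exact Submodule.mem_map_of_mem ⟨mem_TP_sub_mul_J ha Ra j x.2, zero_mem _⟩

lemma range_rightGen_le (h : RelationData Ra Rb a b) (j : ℕ) :
    LinearMap.range (rightGen h j) ≤ kerGrading Ra Rb a b (j + 2) (nfun b (j + 3)) := by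
  have hb : 1 ≤ b := by have := h.lt; omega
  rintro _ ⟨x, rfl⟩
  change (rightGen h j x : KMod Ra Rb a b (j + 2)) ∈ KGrading Ra Rb a b (j + 2) _
  rw [KGrading_eq h.left_le h.right_le, rightGen_apply]
  exact Submodule.mem_map_of_mem ⟨zero_mem _, mem_TP_sub_mul_J hb Rb j x.2⟩

lemma JJGrading_left (h : RelationData Ra Rb a b) (j : ℕ) :
    JJGrading Ra Rb a b (j + 3) (nfun a (j + 3)) = Submodule.prod ⊤ ⊥ := by
  rw [JJGrading, comap_TP_self (J_le_pow h.left_le (j + 1)),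
    comap_TP_of_ne (J_le_pow h.right_le (j + 1))]
  exact_mod_cast (nfun_lt_nfun h.lt (by omega)).ne

lemma JJGrading_right (h : RelationData Ra Rb a b) (j : ℕ) :
    JJGrading Ra Rb a b (j + 3) (nfun b (j + 3)) = Submodule.prod ⊥ ⊤ := by
  rw [JJGrading, comap_TP_self (J_le_pow h.right_le (j + 1)),
    comap_TP_of_ne (J_le_pow h.left_le (j + 1))]
  exact_mod_cast (nfun_lt_nfun h.lt (by omega)).ne'

lemma JJGrading_of_ne (h : RelationData Ra Rb a b) (j : ℕ) {n : ℤ} (ha : n ≠ nfun a (j + 3))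
    (hb : n ≠ nfun b (j + 3)) : JJGrading Ra Rb a b (j + 3) n = ⊥ := by
  rw [JJGrading, comap_TP_of_ne (J_le_pow h.right_le (j + 1)) hb,
    comap_TP_of_ne (J_le_pow h.left_le (j + 1)) ha, Submodule.prod_bot]

/-- `(P_i)` says that the kernel of `δ_i` is generated by `J_{i+1}`. -/
theorem hasExpectedPurity_iff [FiniteDimensional k V] (h : RelationData Ra Rb a b) (j : ℕ) :
    HasExpectedPurity Ra Rb a b (j + 2) ↔ KernelGenerated Ra Rb a b j := by
  rw [kernelGenerated_iff h]
  constructor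
  · rintro ⟨hpure, e, he⟩
    -- Finite-dimensionality makes the mere existence of a graded isomorphism `e` enough: only the
    -- dimensions in the two degrees are compared.
    have hfa : Module.Finite k (J a Ra (j + 2 + 1)) := finite_of_le_pow (J_le_pow h.left_le (j + 1))
    have hfb : Module.Finite k (J b Rb (j + 2 + 1)) :=
      finite_of_le_pow (J_le_pow h.right_le (j + 1))
    have hfin : Module.Finite k (Coinv (Ker Ra Rb a b (j + 2)) (algGrading Ra Rb)) :=
      Module.Finite.equiv e.symm
    refine (isGradedAction_kerGrading h j).span_eq_top_of_isPure hpure (range_leftGen_le h j)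
      (range_rightGen_le h j) (range_rightGen_inf_span_eq_bot h j) ?_ ?_
    · rw [← LinearEquiv.finrank_map_eq e, LinearMap.finrank_range_of_inj (leftGen_injective h j)]
      have := he (nfun a (j + 3))
      rw [this, JJGrading_left h, ← Submodule.map_inl, Submodule.map_top,
        LinearMap.finrank_range_of_inj LinearMap.inl_injective]
    · rw [← LinearEquiv.finrank_map_eq e, LinearMap.finrank_range_of_inj (rightGen_injective h j)]
      have := he (nfun b (j + 3))
      rw [this, JJGrading_right h, ← Submodule.map_inr, Submodule.map_top,
        LinearMap.finrank_range_of_inj LinearMap.inr_injective]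
  · intro htop
    exact (isGradedAction_kerGrading h j).isPure_of_span_eq_top
      (by exact_mod_cast nfun_lt_nfun h.lt (by omega)) (leftGen h j) (rightGen h j)
      (leftGen_injective h j) (rightGen_injective h j) (range_leftGen_le h j)
      (range_rightGen_le h j) (range_rightGen_inf_span_eq_bot h j) htop
      (JJGrading_left h j) (JJGrading_right h j) (fun n => JJGrading_of_ne h j)

/-! ### From generation of the kernel to exactness in each degree -/

lemma KernelGenerated.kernelTwo (h : RelationData Ra Rb a b) (H : KernelGenerated Ra Rb a b 0) :
    KernelTwo Ra Rb := by
  intro x hx y hy hxy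
  have ha2 := h.two_le
  have hb2 := ha2.trans h.lt.le
  have e0 : ∀ s, nfun s 0 = 0 := fun s => by simp [nfun]
  have e1 : ∀ s, nfun s 1 = 1 := fun s => by simp [nfun]
  have eg : ∀ s, gap s 0 = 1 := fun s => by simp [gap]
  have eJ2 : ∀ s (R : Submodule k 𝕋), J s R (0 + 2) = R := fun s R => by
    rw [J_add_two, e0, overlaps_zero]
  have eJ3 : ∀ s, 1 ≤ s → ∀ R : Submodule k 𝕋, J s R (0 + 3) = 𝕃 * R ⊓ R * 𝕃 := fun s hs R => by
    rw [J_add_three hs, e0, eg, zero_add, overlaps_one]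
  have hp : (x, y) ∈ pairs Ra Rb a b (0 + 2) := by
    refine ⟨?_, ?_⟩
    · rw [eJ2]; exact hx
    · rw [eJ2]; exact hy
  have key := H (x, y) hp (by
    -- Since `n_a(1) = n_b(1) = 1`, both summands are cut before the last letter and their images
    -- add up.
    rw [delta_represent h.left_le h.right_le ha2 hb2 hp, zero_add, e1, e1, ← map_add]
    refine (cosplit_eq_zero_iff ?_).2 (by simpa using hxy)
    exact mem_mul_mono le_top le_rfl (by simpa using hxy))
  rwa [eJ2, eJ2, eJ3 a (by omega), eJ3 b (by omega)] at key

/-- All the subspaces involved are homogeneous, so the inclusion may be tested on components; those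
of degree below `s + q` vanish. -/
lemma RelationData.exactAt_iff (h : RelationData Ra Rb a b) {s : ℕ} {R : Submodule k 𝕋}
    (hR : IsRelationSpace Ra Rb s R) {q d : ℕ} (hd : d ≤ s) : ExactAt Ra Rb s R q d ↔
      ∀ x ∈ ⊤ * overlaps R q, x ∈ relSubmodule Ra Rb * 𝕃 ^ (q + d) →
        x ∈ ⊤ * overlaps R (q + d) ⊔ relSubmodule Ra Rb * overlaps R q := by
  have hq := overlaps_le_pow hR.le_pow q
  have hqd := overlaps_le_pow hR.le_pow (q + d)
  constructor
  · intro H x hx hx'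
    refine mem_of_homProj_mem fun n => ?_
    obtain hn | hn := lt_or_ge n (s + q)
    · rw [homProj_mul_eq_zero hq hn hx]
      exact zero_mem _
    · obtain ⟨p, rfl⟩ : ∃ p, n = p + (s + q) := ⟨n - (s + q), by omega⟩
      have h1 := homProj_mul_mem hq (fun x _ => homProj_mem_pow p x) hx
      have h2 := homProj_mul_mem (p := p + (s - d)) le_rfl (fun x hx => h.homProj_mem _ hx) hx'
      rw [show p + (s - d) + (q + d) = p + (s + q) by omega] at h2
      refine (sup_le ?_ ?_ : boundaries Ra Rb R q d p ≤ _) (H p ⟨h1, h2⟩)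
      · exact (mul_le_mul_left inf_le_left _).trans le_sup_right
      · exact (mul_le_mul_left le_top _).trans le_sup_left
  · rintro H p x ⟨h1, h2⟩
    have hxn : x ∈ 𝕃 ^ (p + (s + q)) := by
      rw [pow_add]
      exact mem_mul_mono le_rfl hq h1
    obtain ⟨y, hy, z, hz, rfl⟩ := Submodule.mem_sup.1
      (H x (mem_mul_mono le_top le_rfl h1) (mem_mul_mono inf_le_left le_rfl h2))
    rw [← homProj_of_mem hxn, map_add]
    refine add_mem (Submodule.mem_sup_right ?_) (Submodule.mem_sup_left ?_)
    · obtain hp | hp := lt_or_ge p d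
      · rw [homProj_mul_eq_zero hqd (by omega) hy]
        exact zero_mem _
      · rw [TP_sub_of_le hp]
        have := homProj_mul_mem hqd (fun x _ => homProj_mem_pow (p - d) x) hy
        rwa [show p - d + (s + (q + d)) = p + (s + q) by omega] at this
    · exact homProj_mul_mem hq (fun x hx => h.homProj_mem p hx) hz

/-- For `j ≥ 1` one has `n_a(j+1) < n_b(j+1)`, so a cycle is a pair of cycles, one in each summand.
-/
lemma kernelGenerated_iff_exactAt (h : RelationData Ra Rb a b) {j : ℕ} (hj : 1 ≤ j) :
    KernelGenerated Ra Rb a b j ↔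
      ExactAt Ra Rb a Ra (nfun a j) (gap a j) ∧ ExactAt Ra Rb b Rb (nfun b j) (gap b j) := by
  have ha2 := h.two_le
  have hb2 := ha2.trans h.lt.le
  have ha1 : 1 ≤ a := by omega
  have hb1 : 1 ≤ b := by omega
  have e1 := h.exactAt_iff h.isRelationSpace_left (q := nfun a j) (gap_lt ha2 j).le
  have e2 := h.exactAt_iff h.isRelationSpace_right (q := nfun b j) (gap_lt hb2 j).le
  rw [← J_add_three ha1, ← nfun_succ ha1, ← J_add_two] at e1
  rw [← J_add_three hb1, ← nfun_succ hb1, ← J_add_two] at e2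
  rw [e1, e2, KernelGenerated]
  have hle : ∀ {s : ℕ} {R : Submodule k 𝕋}, 2 ≤ s → R ≤ 𝕃 ^ s →
      ⊤ * overlaps R (nfun s j) ≤ ⊤ * 𝕃 ^ nfun s (j + 1) := by
    intro s R hs hR
    have h1 := gap_lt hs j
    refine top_mul_le_top_mul ((overlaps_le_pow hR _).trans ?_)
    rw [nfun_succ (by omega), show s + nfun s j = s - gap s j + (nfun s j + gap s j) by omega,
      pow_add]
    exact mul_le_mul_left le_top _
  have key : ∀ x ∈ pairs Ra Rb a b (j + 2),
      delta Ra Rb a b (j + 2) (represent Ra Rb a b (j + 2) x) = 0 ↔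
        x.1 ∈ relSubmodule Ra Rb * 𝕃 ^ nfun a (j + 1) ∧
          x.2 ∈ relSubmodule Ra Rb * 𝕃 ^ nfun b (j + 1) := by
    intro x hx
    have h1 : x.1 ∈ ⊤ * 𝕃 ^ nfun a (j + 1) := hle ha2 h.left_le (by rw [← J_add_two]; exact hx.1)
    have h2 : x.2 ∈ ⊤ * 𝕃 ^ nfun b (j + 1) := hle hb2 h.right_le (by rw [← J_add_two]; exact hx.2)
    rw [delta_represent h.left_le h.right_le ha2 hb2 hx, cosplit_add_eq_zero_iff
      (nfun_lt_nfun h.lt (by omega)).ne h1 h2, cosplit_eq_zero_iff h1, cosplit_eq_zero_iff h2]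
  have hpairs : ∀ x, x ∈ pairs Ra Rb a b (j + 2) ↔
      x.1 ∈ ⊤ * J a Ra (j + 2) ∧ x.2 ∈ ⊤ * J b Rb (j + 2) := fun x => Iff.rfl
  constructor
  · intro H
    refine ⟨fun x hx hx' => ?_, fun y hy hy' => ?_⟩
    · have hp := (hpairs (x, 0)).2 ⟨hx, zero_mem _⟩
      exact (H _ hp ((key _ hp).2 ⟨hx', zero_mem _⟩)).1
    · have hp := (hpairs (0, y)).2 ⟨zero_mem _, hy⟩
      exact (H _ hp ((key _ hp).2 ⟨zero_mem _, hy'⟩)).2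
  · rintro ⟨H1, H2⟩ x hx hδ
    have hx' := (hpairs x).1 hx
    have hδ' := (key x hx).1 hδ
    exact ⟨H1 _ hx'.1 hδ'.1, H2 _ hx'.2 hδ'.2⟩

end MultiKoszul
end

/-! ### The criterion -/

theorem mainTheorem12 {k V : Type*} [Field k] [AddCommGroup V] [Module k V]
    [FiniteDimensional k V] (a b : ℕ) (ha : 2 ≤ a) (hab : a < b)
    (Ra Rb : Submodule k (TensorAlgebra k V))
    (hRa : Ra ≤ MultiKoszul.TP k V a) (hRb : Rb ≤ MultiKoszul.TP k V b)
    (hmin : Rb ⊓ MultiKoszul.relSum a Ra b 0 ((b : ℤ) - a) = ⊥)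
    (i : ℕ) (hi : 3 ≤ i)
    (hker : ∀ j : ℕ, 2 ≤ j → j < i → MultiKoszul.HasExpectedPurity Ra Rb a b j) :
    (MultiKoszul.HasExpectedPurity Ra Rb a b i ↔
      (∀ n : ℕ, MultiKoszul.TupleADistributive Ra Rb a b i n) ∧
      (∀ n : ℕ, MultiKoszul.TupleBDistributive Ra Rb a b i n) ∧
      (Even i → MultiKoszul.EvenInclusions Ra Rb a b i) ∧
      (Odd i → MultiKoszul.OddInclusion Ra Rb a b i)) ∧
    (MultiKoszul.HasExpectedPurity Ra Rb a b i ↔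
      (∀ n : ℕ, MultiKoszul.nfun a i ≤ n → MultiKoszul.TupleADistributive Ra Rb a b i n) ∧
      (∀ n : ℕ, MultiKoszul.nfun b i ≤ n → MultiKoszul.TupleBDistributive Ra Rb a b i n) ∧
      (Even i → MultiKoszul.EvenInclusions Ra Rb a b i) ∧
      (Odd i → MultiKoszul.OddInclusion Ra Rb a b i)) := by
  obtain ⟨j, rfl⟩ : ∃ j, i = j + 2 := ⟨i - 2, by omega⟩
  have h : MultiKoszul.RelationData Ra Rb a b :=
    { two_le := ha
      lt := hab
      left_le := by rwa [MultiKoszul.TP_natCast] at hRa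
      right_le := by rwa [MultiKoszul.TP_natCast] at hRb
      inf_relPart := by
        rw [eq_bot_iff, ← hmin]
        exact inf_le_inf_left _ (MultiKoszul.relPart_le_relSum b) }
  -- `(P_2)` is available because `i ≥ 3`; it provides the exactness at `A ⊗ J_2` behind the
  -- automatic bounds.
  have hk : MultiKoszul.KernelTwo Ra Rb := MultiKoszul.KernelGenerated.kernelTwo h
    ((MultiKoszul.hasExpectedPurity_iff h 0).1 (hker 2 le_rfl (by omega)))
  have hmain := h.exact_iff_criterion hk j
  rw [← MultiKoszul.kernelGenerated_iff_exactAt h (by omega),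
    ← MultiKoszul.hasExpectedPurity_iff h] at hmain
  refine ⟨hmain, ?_⟩
  rw [(MultiKoszul.tupleADistributive_iff (by omega) j).2,
    (MultiKoszul.tupleBDistributive_iff (by omega) j).2]
  exact hmain
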